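/- **Setting.** For functions on $\mathbb R_+=[0,\infty)$ write $(f*g)(t)=\int_0^t f(t-s)g(s)\,ds$. Let $b\in\mathbb R$, $c>0$, $\Lambda\ge 0$, $\rho\in[-1,1]$, and let $\nu$ be a nonnegative measure on $\mathbb R_+$ with $\nu(\{0\})=0$ and $\int z^2\,\nu(dz)<\infty$. Write $y^+=\max(y,0)$, $\mathbb C_-=\{z:\Re z\le 0\}$. The kernel $K\in L^2_{loc}(\mathbb R_+)$ is nonnegative, nonincreasing, not identically zero and continuously differentiable on $(0,\infty)$, and it has a resolvent of the first kind $L$ (a measure on $\mathbb R_+$ with $K*L=1$ a.e.) that is nonnegative and such that $s\mapsto L([s,s+t])$ is nonincreasing on $\mathbb R_+$ for every $t\ge0$. The resolvent of the second kind $R_k\in L^1_{loc}(\mathbb R_+)$ of a kernel $k$ is the solution of $k*R_k=R_k*k=k-R_k$ a.e.; the canonical resolvent of $k$ with parameter $\lambda\in\mathbb R$ is $E_{\lambda,k}=-\lambda^{-1}R_{-\lambda k}$ for $\lambda\ne0$, and $E_{0,k}=k$. For $n\ge1$ let $K_n(t)=\sum_{j=1}^n m_{j,n}e^{-x_{j,n}t}$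 with $m_{j,n},x_{j,n}>0$, and put $E_{\lambda,n}=E_{\lambda,K_n}$, $\mathbf m=(m_{j,n})$, $\mathbf x=(x_{j,n})$. Let $$F(u,v)=\tfrac12(u^2-u)+(b+\rho\sqrt c\,u)v+\tfrac c2v^2+\int\left[e^{(v-\Lambda u)z}-u(e^{-\Lambda z}-1)-1-vz\right]\nu(dz),$$ $$G(u)=bu+\tfrac c2u^2+\int\left(e^{uz}-1-uz\right)\nu(dz).$$ For $\delta>0$ (in the model $\delta=\frac1{12}$) let $$h(t)=-10^4\,\tfrac2\delta\, c_1\left[1+b\,(E_{b,K}*1)(\delta-t)\right]1_{\{t\le\delta\}},\qquad c_1=-\tfrac12-\int(e^{-\Lambda z}-1+\Lambda z)\,\nu(dz).$$ For $0\le\Re w\le1$ let $\psi_w,\psi_{w,n}:\mathbb R_+\to\mathbb C_-$ be continuous solutions of $$\psi_w=K*F(w,\psi_w(\cdot)),\qquad \psi_{w,n}=K_n*F(w,\psi_{w,n}(\cdot)).$$ For $w\in\mathbb C_-$ let $\phi_w,\phi_{w,n}:\mathbb R_+\to\mathbb C_-$ be continuous solutions of $$\phi_w(t)=\int_0^\infty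 w\,h(s)K(s+t)\,ds+(K*G(\phi_w(\cdot)))(t),\qquad \phi_{w,n}(t)=\int_0^\infty w\,h(s)K_n(s+t)\,ds+(K_n*G(\phi_{w,n}(\cdot)))(t).$$ **Theorem.** Let $T>0$. (i) Suppose that $\sup_{n\ge1}\int_0^T|E_{b+\rho^+\sqrt c,n}(s)|\,ds<\infty$. Then there is a constant $C>0$, depending on $K,\rho,b,c,\Lambda,\nu,\mathbf m,\mathbf x,T$, such that for every $w$ with $\Re w\in[0,1]$ and every $n\ge1$ $$\sup_{t\in[0,T]}|\psi_w(t)-\psi_{w,n}(t)|\le C\,(1+|\Im w|^6)\int_0^TE_{C(1+|\Im w|^2),K}(s)\,ds\int_0^T|K_n(s)-K(s)|\,ds .$$ If $b<0$ and $\rho<0$, this holds for all $K,\mathbf m,\mathbf x,T$ as above (no bound on the resolvents has to be assumed) with a constant $C$ that depends on $\rho,b,c,\Lambda,\nu$ and $\|K\|_{L^1([0,T])}$ only; in particular $C$ does not depend on $\mathbf m$ or $\mathbf x$. (ii) Suppose that $\sup_{n\ge1}\int_0^{\max(T,\delta)}|E_{b^+,n}(s)|\,ds<\infty$. Then there is a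 constant $C>0$, depending on $K,b,c,\Lambda,\nu,\mathbf m,\mathbf x,T,\delta$, such that for every $w\in\mathbb C_-$ and every $n\ge1$ $$\sup_{t\in[0,T]}|\phi_w(t)-\phi_{w,n}(t)|\le C\,(1+|w|^6)\int_0^TE_{C(1+|w|^2),K}(s)\,ds\int_0^{T+\delta}|K_n(s)-K(s)|\,ds .$$ -/

import Mathlib

open MeasureTheory Set Filter

namespace RoughHawkesHeston

noncomputable section

/-- Convolution on the half line, `(k * g)(t) = ∫₀ᵗ k (t - s) g s ds`, with `k` real valued and
`g` real or complex valued. Functions on `[0, ∞)` or `(0, ∞)` are total functions on `ℝ` whose values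
elsewhere are never used. -/
def conv {E : Type*} [NormedAddCommGroup E] [NormedSpace ℝ E] (k : ℝ → ℝ) (g : ℝ → E) (t : ℝ) : E :=
  ∫ s in (0 : ℝ)..t, k (t - s) • g s

/-- `L` is a nonnegative resolvent of the first kind of `K`: a locally finite nonnegative measure
carried by `[0, ∞)` with `(K * L)(t) = ∫_{[0,t]} K (t - s) L(ds) = 1` for a.e. `t > 0`. -/
structure IsResolventFirstKind (K : ℝ → ℝ) (L : Measure ℝ) : Prop where
  locallyFinite : IsLocallyFiniteMeasure L
  support : L (Iio 0) = 0
  conv_eq_one : ∀ᵐ t ∂(volume.restrict (Ioi (0 : ℝ))), ∫ s in Icc 0 t, K (t - s) ∂L = 1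

/-- The standing assumption on the kernel: `K ∈ L²_loc(ℝ₊)` is nonnegative, nonincreasing, not
identically zero and continuously differentiable on `(0, ∞)`, and its resolvent of the first kind `L`
exists, is nonnegative, and `s ↦ L [s, s + t]` is nonincreasing on `[0, ∞)` for every `t ≥ 0`. -/
structure IsAdmissibleKernel (K : ℝ → ℝ) : Prop where
  memL2loc : ∀ T : ℝ, MemLp K 2 (volume.restrict (Ioc 0 T))
  nonneg : ∀ t, 0 < t → 0 ≤ K t
  antitone : AntitoneOn K (Ioi 0)
  ne_zero : ∃ t, 0 < t ∧ K t ≠ 0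
  contDiff : ContDiffOn ℝ 1 K (Ioi 0)
  firstKind : ∃ L : Measure ℝ, IsResolventFirstKind K L ∧
    ∀ t, 0 ≤ t → AntitoneOn (fun s => L (Icc s (s + t))) (Ici 0)

/-- `R ∈ L¹_loc(ℝ₊)` and `K * R = R * K = K - R` almost everywhere on `ℝ₊`. -/
structure IsResolventSecondKind (K R : ℝ → ℝ) : Prop where
  locallyIntegrable : LocallyIntegrableOn R (Ici 0)
  conv_left : ∀ᵐ t ∂(volume.restrict (Ioi (0 : ℝ))), conv K R t = K t - R t
  conv_right : ∀ᵐ t ∂(volume.restrict (Ioi (0 : ℝ))), conv R K t = K t - R t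

/-- The resolvent of the second kind of `K`, which is unique up to null sets. -/
def resolventSecondKind (K : ℝ → ℝ) : ℝ → ℝ :=
  Classical.epsilon (IsResolventSecondKind K)

open Classical in
/-- The canonical resolvent `E_{lam,K}` of `K` with parameter `lam`: it is `-lam⁻¹ R_{-lam K}` for
`lam ≠ 0`, and `E_{0,K} = K`. -/
def canonicalResolvent (lam : ℝ) (K : ℝ → ℝ) : ℝ → ℝ :=
  if lam = 0 then K else fun t => -lam⁻¹ * resolventSecondKind (fun s => -lam * K s) t

/-- The weighted sum of exponentials `∑ⱼ mⱼ exp (-xⱼ t)`. -/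
def expKernel {n : ℕ} (m x : Fin n → ℝ) (t : ℝ) : ℝ :=
  ∑ j, m j * Real.exp (-x j * t)

/-- A jump measure: a nonnegative measure on `ℝ₊` without mass at `0` and with `∫ z² ν(dz) < ∞`,
seen as a measure on `ℝ` carried by `(0, ∞)`. -/
structure IsJumpMeasure (ν : Measure ℝ) : Prop where
  support : ν (Iic 0) = 0
  integrable_sq : Integrable (fun z : ℝ => z ^ 2) ν

/-- `F(u,v) = (u² - u)/2 + (b + ρ √c u) v + c v²/2
  + ∫ [exp ((v - Λ u) z) - u (exp (-Λ z) - 1) - 1 - v z] ν(dz)`. -/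
def F (ρ b c Λ : ℝ) (ν : Measure ℝ) (u v : ℂ) : ℂ :=
  (1 / 2) * (u ^ 2 - u) + (b + ρ * Real.sqrt c * u) * v + (c / 2) * v ^ 2
    + ∫ z : ℝ, (Complex.exp ((v - Λ * u) * z) - u * (Complex.exp (-Λ * z) - 1) - 1 - v * z) ∂ν

/-- `G(u) = b u + c u²/2 + ∫ [exp (u z) - 1 - u z] ν(dz)`. -/
def G (b c : ℝ) (ν : Measure ℝ) (u : ℂ) : ℂ :=
  b * u + (c / 2) * u ^ 2 + ∫ z : ℝ, (Complex.exp (u * z) - 1 - u * z) ∂ν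

/-- `ψ` is a continuous `ℂ₋`-valued solution on `ℝ₊` of `ψ = k * F(w, ψ(·))`. -/
structure IsPsi (ρ b c Λ : ℝ) (ν : Measure ℝ) (k : ℝ → ℝ) (w : ℂ) (ψ : ℝ → ℂ) : Prop where
  continuousOn : ContinuousOn ψ (Ici 0)
  re_nonpos : ∀ t, 0 ≤ t → (ψ t).re ≤ 0
  eq : ∀ t, 0 ≤ t → ψ t = conv k (fun s => F ρ b c Λ ν w (ψ s)) t

/-- `c₁ = -(1/2 + ∫ (exp (-Λ z) - 1 + Λ z) ν(dz))`. -/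
def cOne (Λ : ℝ) (ν : Measure ℝ) : ℝ :=
  -(1 / 2 + ∫ z : ℝ, (Real.exp (-Λ * z) - 1 + Λ * z) ∂ν)

open Classical in
/-- `h(t) = -10⁴ (2/δ) c₁ [1 + b (E_{b,K} * 1)(δ - t)] 1_{t ≤ δ}`, for `t ≥ 0`. -/
def h (b Λ : ℝ) (ν : Measure ℝ) (δ : ℝ) (K : ℝ → ℝ) (t : ℝ) : ℝ :=
  if t ≤ δ then
    -10 ^ 4 * (2 / δ) * cOne Λ ν
      * (1 + b * conv (canonicalResolvent b K) (fun _ => (1 : ℝ)) (δ - t))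
  else 0

/-- `φ` is a continuous `ℂ₋`-valued solution on `ℝ₊` of
`φ = ∫₀^∞ w h(s) k(s + ·) ds + k * G(φ(·))`. Here `h` is built from the original kernel `K`, also when
`k` is an approximation of `K`. -/
structure IsPhi (b c Λ : ℝ) (ν : Measure ℝ) (δ : ℝ) (K k : ℝ → ℝ) (w : ℂ) (φ : ℝ → ℂ) :
    Prop where
  continuousOn : ContinuousOn φ (Ici 0)
  re_nonpos : ∀ t, 0 ≤ t → (φ t).re ≤ 0
  eq : ∀ t, 0 ≤ t → φ t =
    (∫ s in Ioi (0 : ℝ), (w * (h b Λ ν δ K s : ℂ)) * (k (s + t) : ℂ))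
      + conv k (fun s => G b c ν (φ s)) t

end

end RoughHawkesHeston

namespace RoughHawkesHeston

open scoped Topology

/-! Write `Q` for `1 + |Im w|²` in (i) and for `1 + ‖w‖²` in (ii). `F` and `G` grow quadratically in
the unknown. Once both solutions are bounded by `D * Q` with `D` independent of `n`, the
nonlinearity is `O(Q)`-Lipschitz along them and is itself `O(Q²)`. The difference of the two
solutions then satisfies a linear Volterra inequality with kernel `K` and forcing `O(Q²)` times an
`L¹` distance of the kernels. Gronwall's inequality in resolvent form adds a factor `O(Q)` times the
integral of `E_{CQ,K}` (`norm_sub_le_of_volterra`, `norm_sub_le_of_weights`), and `Q³` is comparable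
to the sixth power.

The substance is the uniform a priori bound. On the left half plane the coefficients are
dissipative: `Re (conj v * F(w,v)) ≤ lam ‖v‖² + ‖F(w,0)‖ ‖v‖` with `lam = b + ρ⁺√c`. For an ODE this
would bound the modulus through its derivative. For a Volterra equation the derivative test is
replaced by `max_principle`: if `k * g` has a nonnegative maximum over `[0, t]` at `t`, then `g t ≥
0`. It follows from `L * (k * g) = 1 * g` and the monotonicity of the increments of the resolvent of
the first kind `L`. Applied to the solution rotated by a phase, it yields `norm_le_of_neg` (for `lam
< 0`, a bound that does not see the kernel) and `norm_le_of_nonneg` (for `lam ≥ 0`, a bound by the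
integrated resolvent of `k`).

These bounds are needed for sums of exponentials as well, whose resolvent of the first kind is
computed in `expKernel_isMonotoneKernel`. In (ii), a shift of time by `δ` turns the forcing into
part of a convolution, so the same bounds apply on `[0, T + δ]`; `intResolvent_add_le` brings the
resolvent back to `[0, max T δ]`. -/

/-- A nonnegative nonincreasing locally integrable kernel with a nonnegative resolvent of the first
kind whose increments are nonincreasing. -/
structure IsMonotoneKernel (k : ℝ → ℝ) : Prop where
  nonneg : ∀ t, 0 < t → 0 ≤ k t
  antitone : AntitoneOn k (Ioi 0)
  integrableOn : ∀ T : ℝ, IntegrableOn k (Ioc 0 T)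
  firstKind : ∃ L : Measure ℝ, IsResolventFirstKind k L ∧
    ∀ t, 0 ≤ t → AntitoneOn (fun s => L (Icc s (s + t))) (Ici 0)

/-- Bounded measurable functions on `(0, T]`. -/
structure BddMeasOn {E : Type*} [NormedAddCommGroup E] (g : ℝ → E) (T : ℝ) : Prop where
  aesm : AEStronglyMeasurable g (volume.restrict (Ioc 0 T))
  bdd : ∃ B, ∀ t ∈ Ioc 0 T, ‖g t‖ ≤ B

/-! ### Convolution with bounded measurable functions. -/

section Conv

namespace BddMeasOn

variable {E : Type*} [NormedAddCommGroup E] {f g : ℝ → E} {T S : ℝ}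

theorem mono (hg : BddMeasOn g T) (h : S ≤ T) : BddMeasOn g S :=
  ⟨hg.aesm.mono_measure (Measure.restrict_mono (Ioc_subset_Ioc_right h) le_rfl),
    hg.bdd.imp fun _ hB t ht => hB t ⟨ht.1, ht.2.trans h⟩⟩

theorem of_continuousOn (hg : ContinuousOn g (Icc 0 T)) : BddMeasOn g T := by
  refine ⟨(hg.mono Ioc_subset_Icc_self).aestronglyMeasurable measurableSet_Ioc, ?_⟩
  obtain ⟨B, hB⟩ := isCompact_Icc.exists_bound_of_continuousOn hg
  exact ⟨B, fun t ht => hB t (Ioc_subset_Icc_self ht)⟩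

theorem const (a : E) : BddMeasOn (fun _ => a) T :=
  ⟨aestronglyMeasurable_const, ‖a‖, fun _ _ => le_rfl⟩

theorem add (hf : BddMeasOn f T) (hg : BddMeasOn g T) : BddMeasOn (fun t => f t + g t) T := by
  obtain ⟨A, hA⟩ := hf.bdd
  obtain ⟨B, hB⟩ := hg.bdd
  exact ⟨hf.aesm.add hg.aesm, A + B, fun t ht =>
    (norm_add_le _ _).trans (add_le_add (hA t ht) (hB t ht))⟩

theorem sub (hf : BddMeasOn f T) (hg : BddMeasOn g T) : BddMeasOn (fun t => f t - g t) T := by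
  obtain ⟨A, hA⟩ := hf.bdd
  obtain ⟨B, hB⟩ := hg.bdd
  exact ⟨hf.aesm.sub hg.aesm, A + B, fun t ht =>
    (norm_sub_le _ _).trans (add_le_add (hA t ht) (hB t ht))⟩

theorem clm [NormedSpace ℝ E] {F : Type*} [NormedAddCommGroup F] [NormedSpace ℝ F] (hf : BddMeasOn f T)
    (A : E →L[ℝ] F) : BddMeasOn (fun t => A (f t)) T := by
  obtain ⟨B, hB⟩ := hf.bdd
  exact ⟨A.continuous.comp_aestronglyMeasurable hf.aesm, ‖A‖ * B, fun t ht =>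
    (A.le_opNorm _).trans (mul_le_mul_of_nonneg_left (hB t ht) (norm_nonneg _))⟩

theorem norm (hf : BddMeasOn f T) : BddMeasOn (fun t => ‖f t‖) T := by
  obtain ⟨B, hB⟩ := hf.bdd
  exact ⟨hf.aesm.norm, B, fun t ht => by simpa using hB t ht⟩

theorem const_mul {f : ℝ → ℝ} (hf : BddMeasOn f T) (a : ℝ) : BddMeasOn (fun t => a * f t) T :=
  hf.clm (a • ContinuousLinearMap.id ℝ ℝ)

end BddMeasOn

theorem intervalIntegrable_comp_sub {E : Type*} [NormedAddCommGroup E] {k : ℝ → E} {t : ℝ} (ht : 0 ≤ t)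
    (hk : IntegrableOn k (Ioc 0 t)) : IntervalIntegrable (fun s => k (t - s)) volume 0 t := by
  have h := ((intervalIntegrable_iff_integrableOn_Ioc_of_le ht).2 hk).comp_sub_left t
  simpa using h.symm

theorem integrableOn_comp_sub {E : Type*} [NormedAddCommGroup E] {k : ℝ → E} {t : ℝ} (ht : 0 ≤ t)
    (hk : IntegrableOn k (Ioc 0 t)) : IntegrableOn (fun s => k (t - s)) (Ioc 0 t) :=
  (intervalIntegrable_iff_integrableOn_Ioc_of_le ht).1 (intervalIntegrable_comp_sub ht hk)

variable {E : Type*} [NormedAddCommGroup E] [NormedSpace ℝ E]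

theorem convIntegrable {k : ℝ → ℝ} {g : ℝ → E} {t : ℝ} (ht : 0 ≤ t)
    (hk : IntegrableOn k (Ioc 0 t)) (hg : BddMeasOn g t) :
    IntervalIntegrable (fun s => k (t - s) • g s) volume 0 t := by
  obtain ⟨B, hB⟩ := hg.bdd
  rw [intervalIntegrable_iff_integrableOn_Ioc_of_le ht]
  exact (integrableOn_comp_sub ht hk).smul_bdd B hg.aesm
    ((ae_restrict_iff' measurableSet_Ioc).2 (ae_of_all _ hB))

theorem conv_swap (k : ℝ → ℝ) (g : ℝ → E) (t : ℝ) :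
    conv k g t = ∫ s in (0 : ℝ)..t, k s • g (t - s) := by
  have := intervalIntegral.integral_comp_sub_left (a := 0) (b := t)
    (fun s => k s • g (t - s)) t
  simp only [sub_sub_cancel, sub_zero, sub_self] at this
  exact this

theorem conv_comm (k g : ℝ → ℝ) (t : ℝ) : conv k g t = conv g k t := by
  rw [conv_swap]
  simp [conv, mul_comm]

theorem conv_zero (k : ℝ → ℝ) (g : ℝ → E) : conv k g 0 = 0 := by simp [conv]

theorem conv_one (k : ℝ → ℝ) (t : ℝ) : conv k (fun _ => (1 : ℝ)) t = ∫ s in (0 : ℝ)..t, k s := by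
  rw [conv_swap]; simp

theorem conv_congr {k : ℝ → ℝ} {f g : ℝ → E} {t : ℝ} (ht : 0 ≤ t)
    (h : ∀ s ∈ Ioc 0 t, f s = g s) : conv k f t = conv k g t := by
  refine intervalIntegral.integral_congr_ae (ae_of_all _ fun s hs => ?_)
  rw [uIoc_of_le ht] at hs
  rw [h s hs]

variable {k : ℝ → ℝ} {f g : ℝ → E} {t : ℝ}

theorem conv_add (ht : 0 ≤ t) (hk : IntegrableOn k (Ioc 0 t)) (hf : BddMeasOn f t)
    (hg : BddMeasOn g t) : conv k (fun s => f s + g s) t = conv k f t + conv k g t := by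
  simp only [conv, smul_add]
  exact intervalIntegral.integral_add (convIntegrable ht hk hf) (convIntegrable ht hk hg)

theorem conv_sub (ht : 0 ≤ t) (hk : IntegrableOn k (Ioc 0 t)) (hf : BddMeasOn f t)
    (hg : BddMeasOn g t) : conv k (fun s => f s - g s) t = conv k f t - conv k g t := by
  simp only [conv, smul_sub]
  exact intervalIntegral.integral_sub (convIntegrable ht hk hf) (convIntegrable ht hk hg)

theorem conv_const_mul (k f : ℝ → ℝ) (a t : ℝ) :
    conv k (fun s => a * f s) t = a * conv k f t := by
  simp only [conv, smul_eq_mul, ← intervalIntegral.integral_const_mul]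
  congr 1; ext s; ring

theorem conv_clm {F : Type*} [NormedAddCommGroup F] [NormedSpace ℝ F] [CompleteSpace E]
    [CompleteSpace F] (ht : 0 ≤ t)
    (hk : IntegrableOn k (Ioc 0 t)) (hf : BddMeasOn f t) (A : E →L[ℝ] F) :
    conv k (fun s => A (f s)) t = A (conv k f t) := by
  rw [conv, conv, ← ContinuousLinearMap.intervalIntegral_comp_comm _ (convIntegrable ht hk hf)]
  simp

theorem conv_mono {f g : ℝ → ℝ} (ht : 0 ≤ t) (hk : IntegrableOn k (Ioc 0 t))
    (h0 : ∀ s, 0 < s → 0 ≤ k s)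
    (hf : BddMeasOn f t) (hg : BddMeasOn g t) (h : ∀ s ∈ Ioo 0 t, f s ≤ g s) :
    conv k f t ≤ conv k g t :=
  intervalIntegral.integral_mono_on_of_le_Ioo ht (convIntegrable ht hk hf)
    (convIntegrable ht hk hg) fun s hs =>
      mul_le_mul_of_nonneg_left (h s hs) (h0 _ (by linarith [hs.2]))

theorem conv_nonneg {f : ℝ → ℝ} (ht : 0 ≤ t) (h0 : ∀ s, 0 < s → 0 ≤ k s)
    (h : ∀ s ∈ Ioo 0 t, 0 ≤ f s) : 0 ≤ conv k f t := by
  rw [conv, intervalIntegral.integral_of_le ht, integral_Ioc_eq_integral_Ioo]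
  exact setIntegral_nonneg measurableSet_Ioo fun s hs =>
    mul_nonneg (h0 _ (by linarith [hs.2])) (h s hs)

theorem norm_conv_le (ht : 0 ≤ t) (hk : IntegrableOn k (Ioc 0 t))
    (h0 : ∀ s, 0 < s → 0 ≤ k s) (hf : BddMeasOn f t) :
    ‖conv k f t‖ ≤ conv k (fun s => ‖f s‖) t := by
  refine intervalIntegral.norm_integral_le_of_norm_le ht ?_ (convIntegrable ht hk hf.norm)
  filter_upwards [compl_mem_ae_iff.2 (measure_singleton t)] with s hst hs
  rw [norm_smul, Real.norm_of_nonneg (h0 _ (sub_pos.2 (lt_of_le_of_ne hs.2 hst))), smul_eq_mul]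

theorem norm_conv_le_const {B : ℝ} (ht : 0 ≤ t) (hk : IntegrableOn k (Ioc 0 t))
    (hf : ∀ s ∈ Ioc 0 t, ‖f s‖ ≤ B) :
    ‖conv k f t‖ ≤ (∫ s in (0 : ℝ)..t, |k s|) * B := by
  have h1 : (∫ s in (0 : ℝ)..t, |k s|) * B = ∫ s in (0 : ℝ)..t, |k (t - s)| * B := by
    rw [intervalIntegral.integral_mul_const,
      intervalIntegral.integral_comp_sub_left (fun s => |k s|) t]
    simp
  rw [h1, conv]
  refine intervalIntegral.norm_integral_le_of_norm_le ht (ae_of_all _ fun s hs => ?_)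
    ((intervalIntegrable_comp_sub ht hk).abs.mul_const B)
  rw [norm_smul, Real.norm_eq_abs]
  exact mul_le_mul_of_nonneg_left (hf s hs) (abs_nonneg _)

end Conv

end RoughHawkesHeston

/-! ### The resolvent of the first kind: associativity and shifts. -/

namespace RoughHawkesHeston

open scoped Topology

namespace IsMonotoneKernel

variable {k : ℝ → ℝ}

/-- Superlevel sets at levels `c ≥ 0` are intervals. Measurability up to Lebesgue null sets would
not suffice, because the kernel is also integrated against `L`, which may be singular. -/
theorem measurable_indicator (hk : IsMonotoneKernel k) : Measurable ((Ioi 0).indicator k) := by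
  refine measurable_of_Ioi fun c => ?_
  rcases lt_or_ge c 0 with hc | hc
  · convert MeasurableSet.univ
    ext t
    simp only [mem_preimage, mem_Ioi, mem_univ, iff_true]
    by_cases ht : 0 < t
    · rw [indicator_of_mem (mem_Ioi.2 ht)]; exact hc.trans_le (hk.nonneg t ht)
    · rw [indicator_of_notMem (by simpa using ht)]; exact hc
  · refine OrdConnected.measurableSet ⟨fun x hx y hy z hz => ?_⟩
    have pos : ∀ x, x ∈ (Ioi 0).indicator k ⁻¹' Ioi c → 0 < x := fun x hx => by
      by_contra h
      simp only [mem_preimage, mem_Ioi] at hx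
      rw [indicator_of_notMem (by simpa using h)] at hx
      exact absurd hx (not_lt.2 hc)
    have hx0 := pos x hx
    have hy0 := pos y hy
    have hz0 : 0 < z := hx0.trans_le hz.1
    simp only [mem_preimage, mem_Ioi] at hy ⊢
    rw [indicator_of_mem (mem_Ioi.2 hy0)] at hy
    rw [indicator_of_mem (mem_Ioi.2 hz0)]
    exact hy.trans_le (hk.antitone hz0 hy0 hz.2)

theorem indicator_nonneg (hk : IsMonotoneKernel k) (t : ℝ) : 0 ≤ (Ioi 0).indicator k t :=
  Set.indicator_nonneg (fun t ht => hk.nonneg t ht) t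

end IsMonotoneKernel

/-- With the kernel extended by zero the domain of integration no longer depends on `s`, as Fubini's
theorem requires. -/
theorem setIntegral_indicator_sub {k g : ℝ → ℝ} {s t : ℝ} (hs : s ∈ Icc 0 t) :
    ∫ r in Ioc 0 t, (Ioi 0).indicator k (t - s - r) * g r = conv k g (t - s) := by
  have h0 : (0 : ℝ) ≤ t - s := sub_nonneg.2 hs.2
  rw [conv, intervalIntegral.integral_of_le h0,
    integral_Ioc_eq_integral_Ioo (f := fun r => k (t - s - r) • g r),
    ← integral_indicator measurableSet_Ioc, ← integral_indicator measurableSet_Ioo]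
  congr 1
  ext r
  by_cases hr : r ∈ Ioo 0 (t - s)
  · rw [indicator_of_mem hr, indicator_of_mem (s := Ioc 0 t) ⟨hr.1, by linarith [hr.2, hs.1]⟩,
      indicator_of_mem (s := Ioi 0) (mem_Ioi.2 (sub_pos.2 hr.2)), smul_eq_mul]
  · rw [indicator_of_notMem hr]
    by_cases hr' : r ∈ Ioc 0 t
    · rw [indicator_of_mem hr', indicator_of_notMem, zero_mul]
      simp only [mem_Ioi, sub_pos, not_lt]
      by_contra h
      exact hr ⟨hr'.1, not_le.1 h⟩
    · rw [indicator_of_notMem hr']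

theorem countable_atoms (L : Measure ℝ) [SFinite L] : {s : ℝ | 0 < L {s}}.Countable :=
  Measure.countable_meas_pos_of_disjoint_iUnion (fun s => measurableSet_singleton s)
    fun _ _ h => Set.disjoint_singleton.2 h

/-- The two integrands differ only at `s = t - r`, where the value of `k` at `0` is discarded. This
matters only if `L` has an atom there, which happens for countably many `r`. -/
theorem IsResolventFirstKind.ae_integral_sub {k : ℝ → ℝ} {L : Measure ℝ}
    (hL : IsResolventFirstKind k L) (t : ℝ) :
    ∀ᵐ r, r ∈ Ioo 0 t → ∫ s in Icc 0 t, (Ioi 0).indicator k (t - s - r) ∂L = 1 := by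
  have := hL.locallyFinite
  have h1 := (ae_restrict_iff' measurableSet_Ioi).1 hL.conv_eq_one
  have h2 : ∀ᵐ x, L {x} = 0 := by
    have : ∀ᵐ x, x ∉ {s : ℝ | 0 < L {s}} := (countable_atoms L).ae_notMem _
    filter_upwards [this] with x hx
    simpa using hx
  have qmp := (Measure.measurePreserving_sub_left volume t).quasiMeasurePreserving
  filter_upwards [qmp.ae h1, qmp.ae h2] with r hr1 hr2 hr
  rw [← hr1 (sub_pos.2 hr.2), ← integral_indicator measurableSet_Icc,
    ← integral_indicator measurableSet_Icc]
  refine integral_congr_ae ?_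
  filter_upwards [compl_mem_ae_iff.2 hr2] with s hs
  by_cases h : s ∈ Icc 0 (t - r)
  · have : s < t - r := lt_of_le_of_ne h.2 hs
    rw [indicator_of_mem h, indicator_of_mem (s := Icc 0 t) ⟨h.1, by linarith [hr.1]⟩,
      indicator_of_mem (mem_Ioi.2 (by linarith))]
    congr 1; ring
  · rw [indicator_of_notMem h]
    by_cases h' : s ∈ Icc 0 t
    · rw [indicator_of_mem h', indicator_of_notMem]
      simp only [mem_Ioi, not_lt]
      by_contra h''
      exact h ⟨h'.1, by linarith⟩
    · rw [indicator_of_notMem h']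

/-- Associativity `L * (k * g) = (L * k) * g = 1 * g`. -/
theorem IsMonotoneKernel.integral_firstKind {k : ℝ → ℝ} (hk : IsMonotoneKernel k) {L : Measure ℝ}
    (hL : IsResolventFirstKind k L) {g : ℝ → ℝ} {t : ℝ} (ht : 0 ≤ t) (hg : BddMeasOn g t) :
    IntegrableOn (fun s => conv k g (t - s)) (Icc 0 t) L ∧
    ∫ s in Icc 0 t, conv k g (t - s) ∂L = ∫ r in (0 : ℝ)..t, g r := by
  have := hL.locallyFinite
  obtain ⟨B, hB⟩ := hg.bdd
  have hB' : ∀ᵐ r ∂(volume.restrict (Ioc 0 t)), ‖g r‖ ≤ B :=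
    (ae_restrict_iff' measurableSet_Ioc).2 (ae_of_all _ hB)
  set f : ℝ → ℝ → ℝ := fun s r => (Ioi 0).indicator k (t - s - r) * g r with hf
  have hmeas : Measurable fun p : ℝ × ℝ => (Ioi 0).indicator k (t - p.1 - p.2) :=
    hk.measurable_indicator.comp ((measurable_const.sub measurable_fst).sub measurable_snd)
  have hI : ∀ s ∈ Icc 0 t, IntegrableOn (fun r => (Ioi 0).indicator k (t - s - r)) (Ioc 0 t) ∧
      ∫ r in Ioc 0 t, (Ioi 0).indicator k (t - s - r) ≤ ∫ r in Ioc 0 t, k r := by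
    intro s hs
    have e : ∀ r, (Ioi 0).indicator k (t - s - r) = (Ioi 0).indicator k (t - s - r) * 1 := by simp
    constructor
    · have : IntegrableOn (fun r => (Ioi 0).indicator k (t - s - r)) (Ioc (-s) (t-s)) := by
        have h1 : IntervalIntegrable ((Ioi 0).indicator k) volume 0 t := by
          rw [intervalIntegrable_iff_integrableOn_Ioc_of_le ht]
          exact (hk.integrableOn t).indicator measurableSet_Ioi
        have h2 := (h1.comp_sub_left (t - s)).symm
        rwa [intervalIntegrable_iff_integrableOn_Ioc_of_le (by linarith),
          show t - s - t = -s by ring, sub_zero] at h2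
      have h3 : IntegrableOn (fun r => (Ioi 0).indicator k (t - s - r)) (Ioi (t - s)) := by
        refine (integrableOn_zero).congr_fun (fun r hr => ?_) measurableSet_Ioi
        rw [indicator_of_notMem]
        simp only [mem_Ioi, not_lt] at hr ⊢
        linarith
      refine (this.union h3).mono_set fun r hr => ?_
      rcases le_or_gt r (t - s) with h | h
      · exact Or.inl ⟨by linarith [hr.1, hs.1], h⟩
      · exact Or.inr h
    · rw [integral_congr_ae (ae_of_all _ e), setIntegral_indicator_sub hs, conv_one,
        intervalIntegral.integral_of_le (sub_nonneg.2 hs.2)]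
      refine setIntegral_mono_set (hk.integrableOn t) ?_
        (Ioc_subset_Ioc_right (by linarith [hs.1])).eventuallyLE
      exact (ae_restrict_iff' measurableSet_Ioc).2 (ae_of_all _ fun r hr => hk.nonneg r hr.1)
  -- Integrability on the product holds because `g` is bounded and the `k`-mass of every section is
  -- at most the mass of `k` on `(0, t]`, while `L` is finite on `[0, t]`.
  have hint : Integrable (Function.uncurry f) ((L.restrict (Icc 0 t)).prod
      (volume.restrict (Ioc 0 t))) := by
    have hm : AEStronglyMeasurable (Function.uncurry f) ((L.restrict (Icc 0 t)).prod
        (volume.restrict (Ioc 0 t))) :=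
      hmeas.aestronglyMeasurable.mul hg.aesm.comp_snd
    rw [integrable_prod_iff hm]
    constructor
    · refine (ae_restrict_iff' measurableSet_Icc).2 (ae_of_all _ fun s hs => ?_)
      exact (hI s hs).1.mul_bdd hg.aesm hB'
    · have hfin : IsFiniteMeasure (L.restrict (Icc 0 t)) :=
        ⟨by simpa using isCompact_Icc.measure_lt_top⟩
      refine Integrable.of_bound hm.norm.integral_prod_right' ((∫ r in Ioc 0 t, k r) * B) ?_
      refine (ae_restrict_iff' measurableSet_Icc).2 (ae_of_all _ fun s hs => ?_)
      rw [Real.norm_of_nonneg (integral_nonneg fun r => norm_nonneg _)]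
      have hB0 : ∀ᵐ r ∂(volume.restrict (Ioc 0 t)), 0 ≤ B := hB'.mono fun r hr =>
        (norm_nonneg _).trans hr
      calc ∫ r in Ioc 0 t, ‖Function.uncurry f (s, r)‖
          ≤ ∫ r in Ioc 0 t, (Ioi 0).indicator k (t - s - r) * B := by
            refine integral_mono_ae ((hI s hs).1.mul_bdd hg.aesm hB').norm
              ((hI s hs).1.mul_const B) ?_
            filter_upwards [hB'] with r hr
            simp only [hf, Function.uncurry, norm_mul]
            rw [Real.norm_of_nonneg (hk.indicator_nonneg _)]
            exact mul_le_mul_of_nonneg_left hr (hk.indicator_nonneg _)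
        _ = (∫ r in Ioc 0 t, (Ioi 0).indicator k (t - s - r)) * B := integral_mul_const _ _
        _ ≤ (∫ r in Ioc 0 t, k r) * B := by
            -- The bound `B` is known to be nonnegative only if `(0, t]` is nonempty.
            rcases ht.eq_or_lt with h0 | h0
            · simp [← h0]
            · have : 0 ≤ B := (norm_nonneg _).trans (hB t ⟨h0, le_rfl⟩)
              exact mul_le_mul_of_nonneg_right (hI s hs).2 this
  have e1 : ∀ s ∈ Icc 0 t, ∫ r in Ioc 0 t, f s r = conv k g (t - s) :=
    fun s hs => setIntegral_indicator_sub hs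
  constructor
  · exact hint.integral_prod_left.congr
      ((ae_restrict_iff' measurableSet_Icc).2 (ae_of_all _ e1))
  · rw [← setIntegral_congr_fun measurableSet_Icc e1, integral_integral_swap hint,
      intervalIntegral.integral_of_le ht, integral_Ioc_eq_integral_Ioo,
      integral_Ioc_eq_integral_Ioo]
    refine integral_congr_ae ((ae_restrict_iff' measurableSet_Ioo).2 ?_)
    filter_upwards [hL.ae_integral_sub t] with r hr hr'
    simp only [hf]
    rw [integral_mul_const, hr hr', one_mul]

/-- Let `μ` be the part of `L` on `[h, ∞)` moved to the left by `h`. Nonincreasing increments say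
that `μ ≤ L` on small closed intervals around every point; a covering argument extends this to all
sets. -/
theorem IsResolventFirstKind.integral_shift_le {k : ℝ → ℝ} {L : Measure ℝ}
    (hL : IsResolventFirstKind k L)
    (hm : ∀ t, 0 ≤ t → AntitoneOn (fun s => L (Icc s (s + t))) (Ici 0))
    {f : ℝ → ℝ} {h t : ℝ} (hh : 0 ≤ h)
    (hf : ∀ s ∈ Icc 0 (t - h), 0 ≤ f s) (hfi : IntegrableOn f (Icc 0 (t - h)) L) :
    ∫ s in Icc h t, f (s - h) ∂L ≤ ∫ s in Icc 0 (t - h), f s ∂L := by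
  have := hL.locallyFinite
  have emb : MeasurableEmbedding fun s : ℝ => s - h := measurableEmbedding_subRight h
  set μ : Measure ℝ := (L.restrict (Ici h)).map (fun s => s - h) with hμ
  have hμapp : ∀ A : Set ℝ, μ A = L ((fun s => s - h) ⁻¹' A ∩ Ici h) := fun A => by
    rw [hμ, emb.map_apply, Measure.restrict_apply' measurableSet_Ici]
  have hsf : SFinite μ := by rw [hμ]; infer_instance
  have hle : μ ≤ L := by
    refine Measure.le_iff'.2 fun A => ?_
    -- By Besicovitch differentiation it is enough to compare the two measures on arbitrarily small
    -- closed balls around each point.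
    refine (Besicovitch.vitaliFamily μ).measure_le_of_frequently_le L
      Measure.AbsolutelyContinuous.rfl A fun x _ => ?_
    refine (Besicovitch.tendsto_filterAt μ x).frequently (Eventually.frequently ?_)
    -- Balls around `x < 0` miss the support of `μ`; a ball around `0` is first cut down to `[0,
    -- r]`, since increments are compared only from nonnegative starting points.
    rcases lt_trichotomy x 0 with hx | hx | hx
    · filter_upwards [Ioo_mem_nhdsGT (neg_pos.2 hx)] with r hr
      rw [hμapp, Real.closedBall_eq_Icc]
      refine le_of_eq_of_le ?_ zero_le
      convert measure_empty (μ := L)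
      ext s
      simp only [mem_inter_iff, mem_preimage, mem_Icc, mem_Ici, mem_empty_iff_false, iff_false]
      rintro ⟨⟨-, h1⟩, h2⟩
      linarith [hr.2]
    · filter_upwards [self_mem_nhdsWithin] with r hr
      have hr' : (0 : ℝ) < r := hr
      rw [hμapp, Real.closedBall_eq_Icc, hx]
      calc L ((fun s => s - h) ⁻¹' Icc (0 - r) (0 + r) ∩ Ici h) ≤ L (Icc h (h + r)) := by
            refine measure_mono fun s hs => ?_
            simp only [mem_inter_iff, mem_preimage, mem_Icc, mem_Ici] at hs ⊢
            constructor <;> linarith [hs.1.2, hs.2]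
        _ ≤ L (Icc 0 (0 + r)) := hm r hr'.le (mem_Ici.2 le_rfl) (mem_Ici.2 hh) hh
        _ ≤ _ := measure_mono (Icc_subset_Icc_left (by linarith))
    · filter_upwards [Ioo_mem_nhdsGT hx] with r hr
      rw [hμapp, Real.closedBall_eq_Icc]
      have hxr : 0 ≤ x - r := by linarith [hr.2]
      have := hm (2 * r) (by linarith [hr.1]) (mem_Ici.2 hxr)
        (mem_Ici.2 (add_nonneg hxr hh)) (by linarith)
      simp only at this
      rw [show x - r + 2 * r = x + r by ring] at this
      refine le_trans (measure_mono fun s hs => ?_) this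
      simp only [mem_inter_iff, mem_preimage, mem_Icc, mem_Ici] at hs ⊢
      constructor <;> linarith [hs.1.1, hs.1.2]
  have e : ∫ s in Icc h t, f (s - h) ∂L = ∫ s in Icc 0 (t - h), f s ∂μ := by
    rw [hμ, emb.setIntegral_map, Measure.restrict_restrict (by measurability)]
    congr 2
    ext s
    simp only [mem_inter_iff, mem_preimage, mem_Icc, mem_Ici]
    constructor
    · rintro ⟨h1, h2⟩; exact ⟨⟨by linarith, by linarith⟩, h1⟩
    · rintro ⟨⟨h1, h2⟩, h3⟩; exact ⟨h3, by linarith⟩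
  rw [e]
  exact integral_mono_measure (Measure.restrict_mono le_rfl hle)
    ((ae_restrict_iff' measurableSet_Icc).2 (ae_of_all _ hf)) hfi

end RoughHawkesHeston

/-! ### The maximum principle. -/

namespace RoughHawkesHeston

open scoped Topology

/-- The interval is open at `0` because `L` may have an atom there, as it does for sums of
exponentials. -/
theorem tendsto_measureReal_Ioo_zero (L : Measure ℝ) [IsLocallyFiniteMeasure L] :
    Tendsto (fun h => L.real (Ioo 0 h)) (𝓝[>] 0) (𝓝 0) := by
  have h := tendsto_measure_biInter_gt (μ := L) (s := fun h : ℝ => Ioo 0 h) (a := 0)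
    (fun _ _ => measurableSet_Ioo.nullMeasurableSet)
    (fun _ _ _ hij => Ioo_subset_Ioo_right hij)
    ⟨1, one_pos, (lt_of_le_of_lt (measure_mono Ioo_subset_Icc_self)
      isCompact_Icc.measure_lt_top).ne⟩
  have e : ⋂ r : ℝ, ⋂ (_ : r > 0), Ioo 0 r = (∅ : Set ℝ) := by
    ext x
    simp only [mem_iInter, mem_Ioo, mem_empty_iff_false, iff_false]
    intro hx
    have h1 := (hx 1 one_pos).1
    linarith [(hx x h1).2]
  rw [e, measure_empty] at h
  have := (ENNReal.tendsto_toReal ENNReal.zero_ne_top).comp h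
  simpa [Measure.real, Function.comp_def] using this

namespace IsMonotoneKernel

variable {k : ℝ → ℝ}

theorem intervalIntegrable (hk : IsMonotoneKernel k) {a b : ℝ} (ha : 0 ≤ a) (hb : 0 ≤ b) :
    IntervalIntegrable k volume a b := by
  have h : ∀ x, 0 ≤ x → IntervalIntegrable k volume 0 x := fun x hx =>
    (intervalIntegrable_iff_integrableOn_Ioc_of_le hx).2 (hk.integrableOn x)
  exact (h a ha).symm.trans (h b hb)

theorem integral_nonneg (hk : IsMonotoneKernel k) {a b : ℝ} (ha : 0 ≤ a) (hab : a ≤ b) :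
    0 ≤ ∫ s in a..b, k s := by
  rw [intervalIntegral.integral_of_le hab]
  exact setIntegral_nonneg measurableSet_Ioc fun s hs => hk.nonneg s (ha.trans_lt hs.1)

theorem integral_mono_right (hk : IsMonotoneKernel k) {a b : ℝ} (ha : 0 ≤ a) (hab : a ≤ b) :
    ∫ s in (0 : ℝ)..a, k s ≤ ∫ s in (0 : ℝ)..b, k s := by
  rw [← intervalIntegral.integral_add_adjacent_intervals (hk.intervalIntegrable le_rfl ha)
    (hk.intervalIntegrable ha (ha.trans hab))]
  linarith [hk.integral_nonneg ha hab]

theorem integral_le_mul (hk : IsMonotoneKernel k) {a b c : ℝ} (hc : 0 < c) (hca : c ≤ a)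
    (hab : a ≤ b) : ∫ s in a..b, k s ≤ (b - a) * k c := by
  have h := intervalIntegral.integral_mono_on_of_le_Ioo hab
    (hk.intervalIntegrable (hc.le.trans hca) ((hc.le.trans hca).trans hab))
    (intervalIntegrable_const (c := k c)) (fun s hs => hk.antitone (mem_Ioi.2 hc)
      (mem_Ioi.2 (by linarith [hs.1])) (by linarith [hs.1]))
  simpa using h

/-- One step of the discretised equation `L * v = 1 * g` at a maximum of `v = k * g`. -/
theorem integral_step (hk : IsMonotoneKernel k) {L : Measure ℝ} (hL : IsResolventFirstKind k L)
    (hm : ∀ t, 0 ≤ t → AntitoneOn (fun s => L (Icc s (s + t))) (Ici 0)) {g : ℝ → ℝ} {t h : ℝ}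
    (hg : BddMeasOn g t) (hh : 0 ≤ h) (hht : h ≤ t)
    (hmax : ∀ s ∈ Icc 0 t, conv k g s ≤ conv k g t) (h0 : 0 ≤ conv k g t) :
    -∫ s in Ico 0 h, (conv k g t - conv k g (t - s)) ∂L ≤ ∫ s in (t - h)..t, g s := by
  have := hL.locallyFinite
  have ht : 0 ≤ t := hh.trans hht
  have hth : 0 ≤ t - h := sub_nonneg.2 hht
  obtain ⟨iA, eA⟩ := hk.integral_firstKind hL ht hg
  obtain ⟨iB, eB⟩ := hk.integral_firstKind hL hth (hg.mono (by linarith))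
  set v := conv k g with hv
  have fin : ∀ b : ℝ, L (Icc 0 b) ≠ ⊤ := fun b => isCompact_Icc.measure_lt_top.ne
  have cst : ∀ b : ℝ, Integrable (fun _ : ℝ => v t) (L.restrict (Icc 0 b)) := fun b =>
    integrableOn_const (fin b)
  have jA : IntegrableOn (fun s => v t - v (t - s)) (Icc 0 t) L := (cst t).sub iA
  have jB : IntegrableOn (fun s => v t - v (t - h - s)) (Icc 0 (t - h)) L :=
    (cst _).sub iB
  have fA : ∫ s in Icc 0 t, (v t - v (t - s)) ∂L = L.real (Icc 0 t) * v t - ∫ s in (0:ℝ)..t, g s := by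
    rw [integral_sub (cst t) iA, eA, setIntegral_const, smul_eq_mul]
  have fB : ∫ s in Icc 0 (t - h), (v t - v (t - h - s)) ∂L
      = L.real (Icc 0 (t - h)) * v t - ∫ s in (0:ℝ)..(t - h), g s := by
    rw [integral_sub (cst _) iB, eB, setIntegral_const, smul_eq_mul]
  -- The integrand is nonnegative because `v t` is the maximum, so the comparison of `L` with its
  -- shift applies.
  have hs := hL.integral_shift_le hm hh (t := t) (f := fun s => v t - v (t - h - s))
    (fun s hs => sub_nonneg.2 (hmax _ ⟨by linarith [hs.2], by linarith [hs.1]⟩)) jB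
  simp only [sub_sub_sub_cancel_right] at hs
  rw [fB] at hs
  have hU : Ico 0 h ∪ Icc h t = Icc 0 t := Ico_union_Icc_eq_Icc hh hht
  rw [← hU, setIntegral_union _ measurableSet_Icc (jA.mono_set (hU ▸ subset_union_left))
    (jA.mono_set (hU ▸ subset_union_right)), hU] at fA
  · have hint : IntervalIntegrable g volume 0 t := by
      rw [intervalIntegrable_iff_integrableOn_Ioc_of_le ht]
      obtain ⟨B, hB⟩ := hg.bdd
      exact Integrable.of_bound hg.aesm B
        ((ae_restrict_iff' measurableSet_Ioc).2 (ae_of_all _ hB))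
    have hadj := intervalIntegral.integral_add_adjacent_intervals
      (hint.mono_set (uIcc_subset_uIcc left_mem_uIcc (by rw [uIcc_of_le ht]; exact ⟨hth, by linarith⟩)))
      (hint.mono_set (uIcc_subset_uIcc (a₁ := t - h) (b₁ := t)
        (by rw [uIcc_of_le ht]; exact ⟨hth, by linarith⟩) right_mem_uIcc))
    -- Subtracting the identities at `t` and `t - h` leaves `v t` times the `L`-mass gained, which
    -- is nonnegative and can be dropped.
    have hLm : L.real (Icc 0 (t - h)) ≤ L.real (Icc 0 t) :=
      measureReal_mono (Icc_subset_Icc_right (by linarith)) (fin t)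
    nlinarith [mul_le_mul_of_nonneg_right hLm h0]
  · exact Set.disjoint_left.2 fun x hx hx' => absurd hx.2 (not_lt.2 hx'.1)

/-- With `g = 1` on `[0, 2h]` the identity `L * (k * g) = 1 * g` has total `2h`, and for `s ≤ h` the
inner integral contains that over `[0, h]`. Thus an error `ε * ∫₀ʰ k`, integrated against `L` over
`[0, h]`, is `O(ε h)`. -/
theorem measure_mul_integral_le (hk : IsMonotoneKernel k) {L : Measure ℝ}
    (hL : IsResolventFirstKind k L) {h : ℝ} (hh : 0 ≤ h) :
    L.real (Icc 0 h) * ∫ s in (0 : ℝ)..h, k s ≤ 2 * h := by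
  have := hL.locallyFinite
  have fin : ∀ b : ℝ, L (Icc 0 b) ≠ ⊤ := fun b => isCompact_Icc.measure_lt_top.ne
  obtain ⟨i1, e1⟩ := hk.integral_firstKind hL (t := 2 * h) (by linarith) (BddMeasOn.const (1 : ℝ))
  simp only [conv_one] at i1 e1
  have e2 : ∫ r in (0 : ℝ)..(2 * h), (1 : ℝ) = 2 * h := by simp
  rw [e2] at e1
  rw [← e1, ← smul_eq_mul, ← setIntegral_const]
  refine (setIntegral_mono_on (integrableOn_const (fin h))
    (i1.mono_set (Icc_subset_Icc_right (by linarith))) measurableSet_Icc fun s hs =>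
      hk.integral_mono_right hh (by linarith [hs.2])).trans ?_
  refine setIntegral_mono_set i1 ?_ (Icc_subset_Icc_right (by linarith)).eventuallyLE
  exact (ae_restrict_iff' measurableSet_Icc).2 (ae_of_all _ fun s hs =>
    hk.integral_nonneg le_rfl (by linarith [hs.2]))

/-- The increment is the integral of `k u * g (t - u)` over `(0, s)` minus that of `(k (u - s) - k
u) * g (t - u)` over `(s, t)`. For `u < r` the factor `g` is within `ε` of `g t`, and the two
`k`-masses cancel up to the integral of `k` over `(r - s, r)`. This integral also dominates the mass
beyond `r`, where only `|g| ≤ B` is used, and it is at most `s * k (r / 2)`. -/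
theorem conv_sub_conv_le (hk : IsMonotoneKernel k) {g : ℝ → ℝ} {t r s ε B : ℝ}
    (hg : BddMeasOn g t) (hB : ∀ u ∈ Ioc 0 t, |g u| ≤ B) (hε : 0 ≤ ε)
    (hgε : ∀ u ∈ Icc (t - r) t, |g u - g t| ≤ ε) (hrt : r ≤ t) (hs : 0 < s) (hsr : s ≤ r / 2) :
    conv k g t - conv k g (t - s) ≤ 2 * ε * (∫ u in (0 : ℝ)..s, k u) + 2 * B * k (r / 2) * s := by
  have hr : 0 < r := by linarith
  have ht : 0 < t := by linarith
  have hts : 0 ≤ t - s := by linarith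
  have i1 : IntervalIntegrable (fun u => k u * g (t - u)) volume 0 t := by
    simpa using ((convIntegrable ht.le (hk.integrableOn t) hg).comp_sub_left t).symm
  have i2 : IntervalIntegrable (fun u => k (u - s) * g (t - u)) volume s t := by
    have := ((convIntegrable hts (hk.integrableOn _) (hg.mono (by linarith : t - s ≤ t))).comp_sub_left
      (t - s)).symm.comp_sub_right s
    simpa using this
  have i3 : IntervalIntegrable (fun u => k (u - s)) volume s t := by
    simpa using (hk.intervalIntegrable le_rfl hts).comp_sub_right s
  have e1 : conv k g t = (∫ u in (0:ℝ)..s, k u * g (t - u)) + ∫ u in s..t, k u * g (t - u) := by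
    rw [conv_swap, ← intervalIntegral.integral_add_adjacent_intervals (a := 0) (b := s) (c := t)]
    · simp
    · exact i1.mono_set (uIcc_subset_uIcc left_mem_uIcc (by rw [uIcc_of_le ht.le]; constructor <;> linarith))
    · exact i1.mono_set (uIcc_subset_uIcc (by rw [uIcc_of_le ht.le]; constructor <;> linarith) right_mem_uIcc)
  have e2 : conv k g (t - s) = ∫ u in s..t, k (u - s) * g (t - u) := by
    have := intervalIntegral.integral_comp_sub_right (a := s) (b := t)
      (fun u => k u * g (t - s - u)) s
    rw [conv_swap]
    simp only [sub_self, sub_sub_sub_cancel_right, smul_eq_mul] at this ⊢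
    exact this.symm
  have i1s : IntervalIntegrable (fun u => k u * g (t - u)) volume s t :=
    i1.mono_set (uIcc_subset_uIcc (by rw [uIcc_of_le ht.le]; constructor <;> linarith) right_mem_uIcc)
  have i4 : IntervalIntegrable (fun u => (k (u - s) - k u) * g (t - u)) volume s t := by
    simpa only [sub_mul] using i2.sub i1s
  have ikt := hk.intervalIntegrable hs.le ht.le
  have i5 : IntervalIntegrable (fun u => k (u - s) - k u) volume s t := i3.sub ikt
  have sub1 : uIcc s r ⊆ uIcc s t := uIcc_subset_uIcc left_mem_uIcc
    (by rw [uIcc_of_le (by linarith)]; constructor <;> linarith)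
  have sub2 : uIcc r t ⊆ uIcc s t := uIcc_subset_uIcc
    (by rw [uIcc_of_le (by linarith)]; constructor <;> linarith) right_mem_uIcc
  have e3 : (∫ u in s..t, k (u - s) * g (t - u)) - ∫ u in s..t, k u * g (t - u)
      = (∫ u in s..r, (k (u - s) - k u) * g (t - u))
        + ∫ u in r..t, (k (u - s) - k u) * g (t - u) := by
    rw [intervalIntegral.integral_add_adjacent_intervals (i4.mono_set sub1) (i4.mono_set sub2),
      ← intervalIntegral.integral_sub i2 i1s]
    congr 1; ext u; ring
  have hd : ∀ u, s < u → 0 ≤ k (u - s) - k u := fun u hu => sub_nonneg.2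
    (hk.antitone (mem_Ioi.2 (sub_pos.2 hu)) (mem_Ioi.2 (hs.trans hu)) (by linarith))
  have T1 : ∫ u in (0:ℝ)..s, k u * g (t - u) ≤ (∫ u in (0:ℝ)..s, k u) * (g t + ε) := by
    rw [← intervalIntegral.integral_mul_const]
    refine intervalIntegral.integral_mono_on_of_le_Ioo hs.le
      (i1.mono_set (uIcc_subset_uIcc left_mem_uIcc (by rw [uIcc_of_le ht.le]; constructor <;> linarith)))
      ((hk.intervalIntegrable le_rfl hs.le).mul_const _) fun u hu => ?_
    refine mul_le_mul_of_nonneg_left ?_ (hk.nonneg u hu.1)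
    linarith [(abs_le.1 (hgε (t - u) ⟨by linarith [hu.2], by linarith [hu.1]⟩)).2]
  have T2 : (∫ u in s..r, (k (u - s) - k u)) * (g t - ε)
      ≤ ∫ u in s..r, (k (u - s) - k u) * g (t - u) := by
    rw [← intervalIntegral.integral_mul_const]
    refine intervalIntegral.integral_mono_on_of_le_Ioo (by linarith)
      ((i5.mono_set sub1).mul_const _) (i4.mono_set sub1) fun u hu => ?_
    refine mul_le_mul_of_nonneg_left ?_ (hd u hu.1)
    linarith [(abs_le.1 (hgε (t - u) ⟨by linarith [hu.2], by linarith [hu.1]⟩)).1]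
  have T3 : (∫ u in r..t, (k (u - s) - k u)) * (-B)
      ≤ ∫ u in r..t, (k (u - s) - k u) * g (t - u) := by
    rw [← intervalIntegral.integral_mul_const]
    refine intervalIntegral.integral_mono_on_of_le_Ioo hrt
      ((i5.mono_set sub2).mul_const _) (i4.mono_set sub2) fun u hu => ?_
    refine mul_le_mul_of_nonneg_left ?_ (hd u (by linarith [hu.1]))
    exact (abs_le.1 (hB (t - u) ⟨by linarith [hu.2], by linarith [hu.1]⟩)).1
  have D2 : ∫ u in s..r, (k (u - s) - k u) = (∫ u in (0:ℝ)..s, k u) - ∫ u in (r - s)..r, k u := by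
    rw [intervalIntegral.integral_sub (i3.mono_set sub1) (ikt.mono_set sub1),
      intervalIntegral.integral_comp_sub_right, sub_self]
    have a1 := intervalIntegral.integral_add_adjacent_intervals
      (hk.intervalIntegrable le_rfl hs.le) (hk.intervalIntegrable hs.le hr.le)
    have a2 := intervalIntegral.integral_add_adjacent_intervals
      (hk.intervalIntegrable le_rfl (by linarith : 0 ≤ r - s))
      (hk.intervalIntegrable (by linarith : 0 ≤ r - s) hr.le)
    linarith
  have D3 : ∫ u in r..t, (k (u - s) - k u) = (∫ u in (r - s)..r, k u) - ∫ u in (t - s)..t, k u := by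
    rw [intervalIntegral.integral_sub (i3.mono_set sub2) (ikt.mono_set sub2),
      intervalIntegral.integral_comp_sub_right]
    have a1 := intervalIntegral.integral_add_adjacent_intervals
      (hk.intervalIntegrable (by linarith : 0 ≤ r - s) hr.le) (hk.intervalIntegrable hr.le ht.le)
    have a2 := intervalIntegral.integral_add_adjacent_intervals
      (hk.intervalIntegrable (by linarith : 0 ≤ r - s) hts) (hk.intervalIntegrable hts ht.le)
    linarith
  have hJ : ∫ u in (r - s)..r, k u ≤ s * k (r / 2) := by
    have := hk.integral_le_mul (a := r - s) (b := r) (c := r / 2) (by linarith) (by linarith) (by linarith)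
    simpa using this
  have hJ0 := hk.integral_nonneg (a := r - s) (b := r) (by linarith) (by linarith)
  have hJ'0 := hk.integral_nonneg (a := t - s) (b := t) hts (by linarith)
  have hγ := (abs_le.1 (hB t ⟨ht, le_rfl⟩)).2
  have hB0 : 0 ≤ B := (abs_nonneg _).trans (hB t ⟨ht, le_rfl⟩)
  rw [D2] at T2
  rw [D3] at T3
  generalize (∫ u in (r - s)..r, k u) = J at *
  generalize (∫ u in (t - s)..t, k u) = J' at *
  generalize (∫ u in (0:ℝ)..s, k u) = I at *
  nlinarith [mul_nonneg hε hJ0, mul_nonneg hB0 hJ'0, mul_le_mul_of_nonneg_left hJ hB0,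
    mul_le_mul_of_nonneg_right hγ hJ0]

/-- The maximum principle: if `k * g` attains a nonnegative maximum over `[0, t]` at the right end
point, then `g t` is nonnegative. -/
theorem max_principle (hk : IsMonotoneKernel k) {g : ℝ → ℝ} {t : ℝ} (ht : 0 < t)
    (hg : BddMeasOn g t) (hc : ContinuousWithinAt g (Iic t) t)
    (hmax : ∀ s ∈ Icc 0 t, conv k g s ≤ conv k g t) (h0 : 0 ≤ conv k g t) : 0 ≤ g t := by
  obtain ⟨L, hL, hm⟩ := hk.firstKind
  have := hL.locallyFinite
  obtain ⟨B, hB⟩ := hg.bdd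
  have hB0 : 0 ≤ B := (norm_nonneg _).trans (hB t ⟨ht, le_rfl⟩)
  -- Of the `6 * ε`, four come from `ε * ∫ k` against `L`, one from the mass of `L` on `(0, h)`, and
  -- one from the oscillation of `g` on `[t - h, t]`. All three are multiplied by `h`, which
  -- cancels.
  have key : ∀ ε > 0, -(6 * ε) ≤ g t := by
    intro ε hε
    obtain ⟨r', hr', hr'g⟩ := Metric.continuousWithinAt_iff.1 hc ε hε
    set r := min (r' / 2) t with hr
    have hr0 : 0 < r := lt_min (by linarith) ht
    have hrt : r ≤ t := min_le_right _ _
    have hgε : ∀ u ∈ Icc (t - r) t, |g u - g t| ≤ ε := fun u hu => by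
      refine (hr'g hu.2 ?_).le
      rw [Real.dist_eq, abs_lt]
      have := min_le_left (r' / 2) t
      constructor <;> linarith [hu.1, hu.2]
    set C := 2 * B * k (r / 2) with hC
    have hC0 : 0 ≤ C := mul_nonneg (by linarith) (hk.nonneg _ (by linarith))
    have hev : ∀ᶠ h in 𝓝[>] (0:ℝ), C * L.real (Ioo 0 h) ≤ ε := by
      have := (tendsto_measureReal_Ioo_zero L).const_mul C
      rw [mul_zero] at this
      exact this.eventually_le_const hε
    obtain ⟨h, hh1, hh2⟩ := (hev.and (Ioo_mem_nhdsGT (by linarith : 0 < r / 2))).exists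
    have hh0 : 0 < h := hh2.1
    have hstep := hk.integral_step hL hm hg hh0.le (by linarith [hh2.2]) hmax h0
    have hup : ∫ s in (t - h)..t, g s ≤ h * (g t + ε) := by
      have hint : IntervalIntegrable g volume (t - h) t := by
        rw [intervalIntegrable_iff_integrableOn_Ioc_of_le (by linarith)]
        have : Ioc (t - h) t ⊆ Ioc 0 t := Ioc_subset_Ioc_left (by linarith [hh2.2])
        exact Integrable.of_bound (hg.aesm.mono_measure (Measure.restrict_mono this le_rfl)) B
          ((ae_restrict_iff' measurableSet_Ioc).2 (ae_of_all _ fun s hs => hB s (this hs)))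
      have := intervalIntegral.integral_mono_on (by linarith) hint
        (intervalIntegrable_const (c := g t + ε)) (fun u hu => by
          linarith [(abs_le.1 (hgε u ⟨by linarith [hu.1, hh2.2], hu.2⟩)).2])
      rwa [intervalIntegral.integral_const, smul_eq_mul, sub_sub_cancel] at this
    have hI : ∫ s in Ico 0 h, (conv k g t - conv k g (t - s)) ∂L ≤ 4 * ε * h + ε * h := by
      have fin : L (Ico 0 h) ≠ ⊤ :=
        (lt_of_le_of_lt (measure_mono Ico_subset_Icc_self) isCompact_Icc.measure_lt_top).ne
      have cst : ∀ c : ℝ, Integrable (fun _ : ℝ => c) (L.restrict (Ico 0 h)) := fun _ =>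
        integrableOn_const fin
      have hi : IntegrableOn (fun s => conv k g t - conv k g (t - s)) (Ico 0 h) L := by
        refine (cst _).sub ((hk.integral_firstKind hL ht.le hg).1.mono_set ?_)
        exact fun s hs => ⟨hs.1, by linarith [hs.2, hh2.2]⟩
      -- The term `C * h` is needed only off `s = 0`, where the increment vanishes. A possible atom
      -- of `L` at `0` therefore does not multiply it, and `L (0, h) → 0` makes its contribution
      -- small.
      have hj : IntegrableOn (fun s => 2 * ε * (∫ u in (0:ℝ)..h, k u)
          + (Ioo 0 h).indicator (fun _ => C * h) s) (Ico 0 h) L :=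
        (cst _).add ((cst _).indicator measurableSet_Ioo)
      refine (setIntegral_mono_on hi hj measurableSet_Ico fun s hs => ?_).trans ?_
      · rcases hs.1.eq_or_lt with h' | h'
        · rw [← h']
          simp only [sub_zero, sub_self, lt_self_iff_false, mem_Ioo, false_and,
            not_false_eq_true, indicator_of_notMem, add_zero]
          exact mul_nonneg (by linarith) (hk.integral_nonneg le_rfl hh0.le)
        · rw [indicator_of_mem (s := Ioo 0 h) ⟨h', hs.2⟩]
          refine (hk.conv_sub_conv_le hg hB hε.le hgε hrt h' (by linarith [hs.2, hh2.2])).trans ?_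
          exact add_le_add (mul_le_mul_of_nonneg_left (hk.integral_mono_right h'.le hs.2.le)
            (by linarith)) (mul_le_mul_of_nonneg_left hs.2.le hC0)
      · rw [integral_add (cst _) ((cst _).indicator measurableSet_Ioo), setIntegral_const,
          setIntegral_indicator measurableSet_Ioo, setIntegral_const,
          inter_eq_self_of_subset_right Ioo_subset_Ico_self, smul_eq_mul, smul_eq_mul]
        have hm1 : L.real (Ico 0 h) ≤ L.real (Icc 0 h) :=
          measureReal_mono Ico_subset_Icc_self isCompact_Icc.measure_lt_top.ne
        have hk0 := hk.integral_nonneg le_rfl hh0.le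
        have h1 := mul_le_mul_of_nonneg_right hm1 hk0
        have h2 := hk.measure_mul_integral_le hL hh0.le
        nlinarith [mul_le_mul_of_nonneg_right hh1 hh0.le,
          mul_le_mul_of_nonneg_left (h1.trans h2) hε.le]
    have : h * (-(6 * ε)) ≤ h * g t := by nlinarith
    exact le_of_mul_le_mul_left this hh0
  by_contra hneg
  have := key (-(g t) / 12) (by linarith)
  linarith

end IsMonotoneKernel

end RoughHawkesHeston

/-! ### Gronwall's inequality and a priori bounds for dissipative equations. -/

namespace RoughHawkesHeston

open scoped Topology ComplexConjugate

/-- An exponential weight makes the mass of a kernel less than one, both for Gronwall's inequality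
and for the construction of resolvents. -/
theorem tendsto_integral_exp_mul {S : Set ℝ} (hS : MeasurableSet S) (hS0 : S ⊆ Ioi 0) {f : ℝ → ℝ}
    (hf : IntegrableOn f S) :
    Tendsto (fun n : ℕ => ∫ s in S, Real.exp (-n * s) * f s) atTop (𝓝 0) := by
  have h := tendsto_integral_of_dominated_convergence (μ := volume.restrict S)
    (F := fun (n : ℕ) s => Real.exp (-n * s) * f s) (f := fun _ => 0) (fun s => ‖f s‖)
    (fun n => (by fun_prop : Continuous fun s : ℝ => Real.exp (-n * s)).aestronglyMeasurable.mul
      hf.aestronglyMeasurable) hf.norm ?_ ?_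
  · simpa using h
  · intro n
    refine (ae_restrict_iff' hS).2 (ae_of_all _ fun s hs => ?_)
    rw [norm_mul, Real.norm_of_nonneg (Real.exp_pos _).le]
    refine mul_le_of_le_one_left (norm_nonneg _) (Real.exp_le_one_iff.2 ?_)
    have : 0 < s := hS0 hs
    have : (0 : ℝ) ≤ n * s := by positivity
    linarith
  · refine (ae_restrict_iff' hS).2 (ae_of_all _ fun s hs => ?_)
    have hs0 : 0 < s := hS0 hs
    rw [← zero_mul (f s)]
    refine Tendsto.mul_const _ (Real.tendsto_exp_atBot.comp ?_)
    simp only [neg_mul]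
    exact tendsto_neg_atTop_atBot.comp (tendsto_natCast_atTop_atTop.atTop_mul_const hs0)

/-- Gronwall's inequality for convolution with a nonnegative integrable kernel. -/
theorem gronwall_conv {k u : ℝ → ℝ} {T : ℝ} (hk : IntegrableOn k (Ioc 0 T))
    (h0 : ∀ s, 0 < s → 0 ≤ k s) (hu : ContinuousOn u (Icc 0 T))
    (h : ∀ t ∈ Icc 0 T, u t ≤ conv k u t) : ∀ t ∈ Icc 0 T, u t ≤ 0 := by
  intro t ht
  have hT : 0 ≤ T := ht.1.trans ht.2
  -- The weighted function `exp (-n s) * u s` satisfies the inequality with the weighted kernel,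
  -- whose mass is below one; a positive maximum would be at most that mass times itself.
  obtain ⟨n, hn⟩ := ((tendsto_integral_exp_mul measurableSet_Ioc
    (fun s hs => hs.1) hk).eventually_lt_const one_pos).exists
  have hki : IntegrableOn (fun s => Real.exp (-n * s) * k s) (Ioc 0 T) :=
    hk.continuousOn_mul_of_subset (K := Icc 0 T) (by fun_prop) isCompact_Icc measurableSet_Ioc
      Ioc_subset_Icc_self
  obtain ⟨τ, hτ, hmax⟩ := isCompact_Icc.exists_isMaxOn (nonempty_Icc.2 hT)
    ((by fun_prop : ContinuousOn (fun s : ℝ => Real.exp (-n * s)) (Icc 0 T)).mul hu)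
  set θ : ℝ → ℝ := fun s => Real.exp (-n * s) * u s with hθ
  have hle : θ τ ≤ 0 := by
    by_contra hpos
    push Not at hpos
    have hτT : Ioc 0 τ ⊆ Ioc 0 T := Ioc_subset_Ioc_right hτ.2
    have e1 : θ τ ≤ ∫ s in (0 : ℝ)..τ, (Real.exp (-n * (τ - s)) * k (τ - s)) * θ s := by
      calc θ τ ≤ Real.exp (-n * τ) * conv k u τ :=
            mul_le_mul_of_nonneg_left (h τ hτ) (Real.exp_pos _).le
        _ = _ := by
            rw [conv, ← intervalIntegral.integral_const_mul]
            congr 1; ext s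
            have : Real.exp (-n * τ) = Real.exp (-n * (τ - s)) * Real.exp (-n * s) := by
              rw [← Real.exp_add]; congr 1; ring
            rw [this, smul_eq_mul, hθ]; ring
    have e2 : ∫ s in (0 : ℝ)..τ, (Real.exp (-n * (τ - s)) * k (τ - s)) * θ s
        ≤ ∫ s in (0 : ℝ)..τ, (Real.exp (-n * (τ - s)) * k (τ - s)) * θ τ := by
      refine conv_mono (k := fun s => Real.exp (-n * s) * k s) (g := fun _ => θ τ) hτ.1
        (hki.mono_set hτT) (fun s hs => mul_nonneg (Real.exp_pos _).le (h0 s hs))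
        (BddMeasOn.of_continuousOn ?_) (BddMeasOn.const _)
        fun s hs => hmax ⟨hs.1.le, hs.2.le.trans hτ.2⟩
      exact ((by fun_prop : ContinuousOn (fun s : ℝ => Real.exp (-n * s)) (Icc 0 T)).mul hu).mono
        (Icc_subset_Icc_right hτ.2)
    have e3 : ∫ s in (0 : ℝ)..τ, (Real.exp (-n * (τ - s)) * k (τ - s)) * θ τ
        ≤ (∫ s in Ioc 0 T, Real.exp (-n * s) * k s) * θ τ := by
      rw [intervalIntegral.integral_mul_const,
        intervalIntegral.integral_comp_sub_left (fun s => Real.exp (-n * s) * k s), sub_self,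
        sub_zero, intervalIntegral.integral_of_le hτ.1]
      refine mul_le_mul_of_nonneg_right (setIntegral_mono_set hki ?_ hτT.eventuallyLE) hpos.le
      exact (ae_restrict_iff' measurableSet_Ioc).2 (ae_of_all _ fun s hs =>
        mul_nonneg (Real.exp_pos _).le (h0 s hs.1))
    nlinarith
  have : Real.exp (-n * t) * u t ≤ 0 := (hmax ht).trans hle
  exact nonpos_of_mul_nonpos_right this (Real.exp_pos _)

/-- The kernel may be unbounded at `0`, so `t` is moved into `g` and into an indicator. The
indicator is discontinuous only at `s = t`, a null set, and dominated convergence applies. -/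
theorem continuousOn_conv {E : Type*} [NormedAddCommGroup E] [NormedSpace ℝ E] {k : ℝ → ℝ}
    {g : ℝ → E} {T : ℝ} (hk : IntegrableOn k (Ioc 0 T)) (hg : ContinuousOn g (Icc 0 T)) :
    ContinuousOn (conv k g) (Icc 0 T) := by
  obtain ⟨B, hB⟩ := isCompact_Icc.exists_bound_of_continuousOn hg
  have e : ∀ t ∈ Icc 0 T, conv k g t
      = ∫ s in Ioc 0 T, (Iic t).indicator (fun s => k s • g (t - s)) s := by
    intro t ht
    rw [conv_swap, intervalIntegral.integral_of_le ht.1, setIntegral_indicator measurableSet_Iic,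
      Ioc_inter_Iic, min_eq_right ht.2]
  refine ContinuousOn.congr (fun t ht => ?_) e
  refine continuousWithinAt_of_dominated (bound := fun s => ‖k s‖ * B) ?_ ?_
    (hk.norm.mul_const B) ?_
  · filter_upwards [self_mem_nhdsWithin] with x hx
    rw [aestronglyMeasurable_indicator_iff measurableSet_Iic,
      Measure.restrict_restrict measurableSet_Iic, inter_comm, Ioc_inter_Iic, min_eq_right hx.2]
    have hg' : BddMeasOn g x :=
      BddMeasOn.of_continuousOn (hg.mono (Icc_subset_Icc_right hx.2))
    have := (convIntegrable hx.1 (hk.mono_set (Ioc_subset_Ioc_right hx.2)) hg').comp_sub_left x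
    simp only [sub_sub_cancel, sub_zero, sub_self] at this
    exact ((intervalIntegrable_iff_integrableOn_Ioc_of_le hx.1).1 this.symm).aestronglyMeasurable
  · filter_upwards [self_mem_nhdsWithin] with x hx
    refine (ae_restrict_iff' measurableSet_Ioc).2 (ae_of_all _ fun s hs => ?_)
    by_cases h : s ∈ Iic x
    · rw [indicator_of_mem h, norm_smul]
      exact mul_le_mul_of_nonneg_left (hB _ ⟨sub_nonneg.2 h, by linarith [hs.1, hx.2]⟩)
        (norm_nonneg _)
    · rw [indicator_of_notMem h, norm_zero]
      exact mul_nonneg (norm_nonneg _) ((norm_nonneg _).trans (hB t ht))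
  · refine (ae_restrict_iff' measurableSet_Ioc).2 ?_
    filter_upwards [compl_mem_ae_iff.2 (measure_singleton t)] with s hst hs
    rcases lt_or_gt_of_ne (show s ≠ t from hst) with h | h
    · have hc : ContinuousWithinAt (fun x => k s • g (x - s)) (Icc s T) t := by
        refine ContinuousWithinAt.const_smul ?_ _
        exact ContinuousWithinAt.comp (f := fun x : ℝ => x - s) (t := Icc 0 T)
          (hg (t - s) ⟨by linarith, by linarith [ht.2, hs.1]⟩)
          (continuousWithinAt_id.sub continuousWithinAt_const)
          fun x hx => ⟨by linarith [hx.1], by linarith [hx.2, hs.1]⟩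
      have hc' : ContinuousWithinAt (fun x => k s • g (x - s)) (Icc 0 T) t := by
        refine hc.mono_of_mem_nhdsWithin ?_
        filter_upwards [self_mem_nhdsWithin, mem_nhdsWithin_of_mem_nhds (Ioi_mem_nhds h)] with x h1 h2
        exact ⟨h2.le, h1.2⟩
      refine hc'.congr_of_eventuallyEq ?_ (by rw [indicator_of_mem (mem_Iic.2 h.le)])
      filter_upwards [mem_nhdsWithin_of_mem_nhds (Ioi_mem_nhds h)] with x h2
      rw [indicator_of_mem (mem_Iic.2 h2.le)]
    · refine (continuousWithinAt_const (b := (0 : E))).congr_of_eventuallyEq ?_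
        (by rw [indicator_of_notMem (by simpa using h)])
      filter_upwards [mem_nhdsWithin_of_mem_nhds (Iio_mem_nhds h)] with x h2
      rw [indicator_of_notMem (by simpa using h2)]

section Comparison

variable {k : ℝ → ℝ} {T lam a : ℝ} {χ g : ℝ → ℂ}

theorem conv_re_mul {η : ℂ} {t : ℝ} (ht : 0 ≤ t) (hk : IntegrableOn k (Ioc 0 t))
    (hg : BddMeasOn g t) :
    conv k (fun s => (η * g s).re) t = (η * conv k g t).re := by
  have := conv_clm ht hk hg (Complex.reCLM.comp (ContinuousLinearMap.mul ℝ ℂ η))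
  simpa using this

theorem BddMeasOn.re_mul {t : ℝ} (hg : BddMeasOn g t) (η : ℂ) :
    BddMeasOn (fun s => (η * g s).re) t := by
  simpa using hg.clm (Complex.reCLM.comp (ContinuousLinearMap.mul ℝ ℂ η))

/-- The factor `conj z / ‖z‖` rotates `z` onto the positive real axis; it turns a maximum of the
modulus into a maximum of a real part. -/
theorem phase_mul (z w : ℂ) :
    ((conj z / ‖z‖) * w).re = (conj z * w).re / ‖z‖ := by
  rw [div_mul_eq_mul_div, Complex.div_ofReal_re]

theorem phase_mul_self {z : ℂ} (hz : z ≠ 0) : ((conj z / ‖z‖) * z).re = ‖z‖ := by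
  have : ‖z‖ ≠ 0 := norm_ne_zero_iff.2 hz
  rw [phase_mul, mul_comm, Complex.mul_conj, Complex.ofReal_re, Complex.normSq_eq_norm_sq]
  field_simp

theorem phase_mul_le {z : ℂ} (hz : z ≠ 0) (w : ℂ) : ((conj z / ‖z‖) * w).re ≤ ‖w‖ := by
  have : ‖z‖ ≠ 0 := norm_ne_zero_iff.2 hz
  refine (Complex.re_le_norm _).trans_eq ?_
  rw [norm_mul, norm_div, RCLike.norm_conj, Complex.norm_real, norm_norm, div_self this, one_mul]

/-- A priori bound for dissipative Volterra equations with negative rate. -/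
theorem IsMonotoneKernel.norm_le_of_neg (hk : IsMonotoneKernel k) (hlam : lam < 0) (ha : 0 ≤ a)
    (hχ : ContinuousOn χ (Icc 0 T)) (hg : BddMeasOn g T)
    (hgc : ∀ t ∈ Ioc 0 T, ContinuousWithinAt g (Iic t) t)
    (heq : ∀ t ∈ Icc 0 T, χ t = conv k g t)
    (hd : ∀ t ∈ Ioc 0 T, (conj (χ t) * g t).re ≤ lam * ‖χ t‖ ^ 2 + a * ‖χ t‖) :
    ∀ t ∈ Icc 0 T, ‖χ t‖ ≤ a / (-lam) := by
  intro t ht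
  have hT : 0 ≤ T := ht.1.trans ht.2
  obtain ⟨τ, hτ, hmax⟩ := isCompact_Icc.exists_isMaxOn (nonempty_Icc.2 hT) hχ.norm
  refine (hmax ht).trans ?_
  simp only
  by_cases hz : χ τ = 0
  · rw [hz, norm_zero]
    exact div_nonneg ha (by linarith)
  have hn : 0 < ‖χ τ‖ := norm_pos_iff.2 hz
  have hτ0 : 0 < τ := by
    refine lt_of_le_of_ne hτ.1 fun h => hz ?_
    rw [heq τ hτ, ← h, conv_zero]
  -- Since `Re (η χ) ≤ ‖χ‖ ≤ ‖χ τ‖ = Re (η χ τ)`, the real function `Re (η χ)` has its maximum over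
  -- `[0, τ]` at `τ`. The maximum principle then gives `0 ≤ lam ‖χ τ‖ + a`.
  set η := conj (χ τ) / ‖χ τ‖ with hη
  have hgτ := hg.mono hτ.2
  have hconv : ∀ s ∈ Icc 0 τ, conv k (fun s => (η * g s).re) s = (η * χ s).re := fun s hs => by
    rw [conv_re_mul hs.1 (hk.integrableOn s) (hgτ.mono hs.2), heq s ⟨hs.1, hs.2.trans hτ.2⟩]
  have hmp := hk.max_principle hτ0 (hgτ.re_mul η)
    (Complex.continuous_re.continuousAt.comp_continuousWithinAt
      ((hgc τ ⟨hτ0, hτ.2⟩).const_mul η)) (fun s hs => ?_) ?_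
  · rw [hη, phase_mul] at hmp
    have h1 := (hmp.trans (div_le_div_of_nonneg_right (hd τ ⟨hτ0, hτ.2⟩) hn.le))
    have h2 : 0 ≤ lam * ‖χ τ‖ ^ 2 + a * ‖χ τ‖ := by
      by_contra hneg
      exact absurd h1 (not_le.2 (div_neg_of_neg_of_pos (not_le.1 hneg) hn))
    rw [le_div_iff₀ (by linarith)]
    nlinarith
  · rw [hconv s hs, hconv τ ⟨hτ0.le, le_rfl⟩, phase_mul_self hz]
    exact (phase_mul_le hz _).trans (hmax ⟨hs.1, hs.2.trans hτ.2⟩)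
  · rw [hconv τ ⟨hτ0.le, le_rfl⟩, phase_mul_self hz]
    exact hn.le

/-- A priori bound for dissipative Volterra equations in terms of the integrated resolvent `e`. -/
theorem IsMonotoneKernel.norm_le_of_nonneg (hk : IsMonotoneKernel k) (hlam : 0 ≤ lam) (ha : 0 < a)
    {e : ℝ → ℝ} (he : ContinuousOn e (Icc 0 T)) (he0 : ∀ t ∈ Icc 0 T, 0 ≤ e t)
    (hee : ∀ t ∈ Icc 0 T, e t = conv k (fun s => 1 + lam * e s) t)
    (hχ : ContinuousOn χ (Icc 0 T)) (hg : BddMeasOn g T)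
    (hgc : ∀ t ∈ Ioc 0 T, ContinuousWithinAt g (Iic t) t)
    (heq : ∀ t ∈ Icc 0 T, χ t = conv k g t)
    (hd : ∀ t ∈ Ioc 0 T, (conj (χ t) * g t).re ≤ lam * ‖χ t‖ ^ 2 + a * ‖χ t‖) :
    ∀ t ∈ Icc 0 T, ‖χ t‖ ≤ a * e t := by
  intro t ht
  have hT : 0 ≤ T := ht.1.trans ht.2
  have key : ∀ ε > 0, ‖χ t‖ ≤ ε + (ε * lam + a) * e t := by
    intro ε hε
    have hα : 0 < ε * lam + a := by positivity
    -- The barrier `l` solves `l = ε + k * (lam l + a)`, the extremal equation started at `ε`. The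
    -- summand `ε` keeps it positive at `0`, where `e` vanishes, so that `‖χ‖ / l` makes sense.
    set l : ℝ → ℝ := fun s => ε + (ε * lam + a) * e s with hl
    have hlpos : ∀ s ∈ Icc 0 T, 0 < l s := fun s hs =>
      add_pos_of_pos_of_nonneg hε (mul_nonneg hα.le (he0 s hs))
    obtain ⟨τ, hτ, hmax⟩ := isCompact_Icc.exists_isMaxOn (nonempty_Icc.2 hT)
      (hχ.norm.div (continuousOn_const.add (continuousOn_const.mul he))
        fun s hs => (hlpos s hs).ne')
    set θ := ‖χ τ‖ / l τ with hθ
    have hθmax : ∀ s ∈ Icc 0 T, ‖χ s‖ ≤ θ * l s := fun s hs =>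
      (div_le_iff₀ (hlpos s hs)).1 (hmax hs)
    have hθτ : ‖χ τ‖ = θ * l τ := (div_mul_cancel₀ _ (hlpos τ hτ).ne').symm
    suffices hθ1 : θ ≤ 1 from
      (hθmax t ht).trans (mul_le_of_le_one_left (hlpos t ht).le hθ1)
    by_contra hθ1
    push Not at hθ1
    have hn : 0 < ‖χ τ‖ := by rw [hθτ]; exact mul_pos (by linarith) (hlpos τ hτ)
    have hz : χ τ ≠ 0 := norm_pos_iff.1 hn
    have hτ0 : 0 < τ := by
      refine lt_of_le_of_ne hτ.1 fun h => hz ?_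
      rw [heq τ hτ, ← h, conv_zero]
    set η := conj (χ τ) / ‖χ τ‖ with hη
    have hgτ := hg.mono hτ.2
    have heτ : BddMeasOn (fun s => (θ * (ε * lam + a)) * (1 + lam * e s)) τ :=
      BddMeasOn.of_continuousOn (continuousOn_const.mul (continuousOn_const.add
        (continuousOn_const.mul (he.mono (Icc_subset_Icc_right hτ.2)))))
    have hconv : ∀ s ∈ Icc 0 τ,
        conv k (fun s => (η * g s).re - (θ * (ε * lam + a)) * (1 + lam * e s)) s
          = (η * χ s).re - θ * (ε * lam + a) * e s := fun s hs => by
      have hsT : s ∈ Icc 0 T := ⟨hs.1, hs.2.trans hτ.2⟩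
      rw [conv_sub hs.1 (hk.integrableOn s) ((hgτ.mono hs.2).re_mul η) (heτ.mono hs.2),
        conv_re_mul hs.1 (hk.integrableOn s) (hgτ.mono hs.2), heq s hsT, conv_const_mul,
        ← hee s hsT]
    -- The principle is applied to `Re (η χ) - θ (l - ε)`, which is maximal at `τ` with value `θ ε ≥
    -- 0`. Its integrand at `τ` is at most `(1 - θ) a`, which is negative for `θ > 1`.
    have hmp := hk.max_principle hτ0 ((hgτ.re_mul η).sub heτ) ?_ (fun s hs => ?_) ?_
    · rw [hη, phase_mul] at hmp
      have h1 : (conj (χ τ) * g τ).re / ‖χ τ‖ ≤ lam * ‖χ τ‖ + a := by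
        rw [div_le_iff₀ hn]
        nlinarith [hd τ ⟨hτ0, hτ.2⟩]
      have h2 : θ * (ε * lam + a) * (1 + lam * e τ) = lam * ‖χ τ‖ + θ * a := by
        rw [hθτ, hl]; ring
      nlinarith
    · refine (Complex.continuous_re.continuousAt.comp_continuousWithinAt
        ((hgc τ ⟨hτ0, hτ.2⟩).const_mul η)).sub (continuousWithinAt_const.mul
          (continuousWithinAt_const.add (continuousWithinAt_const.mul ?_)))
      refine (he τ hτ).mono_of_mem_nhdsWithin ?_
      filter_upwards [self_mem_nhdsWithin, mem_nhdsWithin_of_mem_nhds (Ioi_mem_nhds hτ0)]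
        with x h1 h2 using ⟨le_of_lt h2, le_trans h1 hτ.2⟩
    · rw [hconv s hs, hconv τ ⟨hτ0.le, le_rfl⟩, phase_mul_self hz]
      have h1 := (phase_mul_le hz (χ s)).trans (hθmax s ⟨hs.1, hs.2.trans hτ.2⟩)
      simp only [hl] at h1 hθτ
      nlinarith
    · rw [hconv τ ⟨hτ0.le, le_rfl⟩, phase_mul_self hz, hθτ]
      simp only [hl]
      nlinarith
  have hlim : Tendsto (fun ε : ℝ => ε + (ε * lam + a) * e t) (𝓝[>] 0) (𝓝 (a * e t)) := by
    have : Continuous fun ε : ℝ => ε + (ε * lam + a) * e t := by fun_prop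
    have h := (this.tendsto 0).mono_left (nhdsWithin_le_nhds (s := Ioi 0))
    simpa using h
  exact ge_of_tendsto hlim (by filter_upwards [self_mem_nhdsWithin] with ε hε using key ε hε)

end Comparison

end RoughHawkesHeston

/-! ### Resolvents of the second kind and the integrated canonical resolvent. -/

namespace RoughHawkesHeston

open scoped Topology Convolution

theorem integral_norm_convolution_le {f g : ℝ → ℝ} (hf : Integrable f) (hg : Integrable g) :
    ∫ x, ‖(f ⋆[ContinuousLinearMap.lsmul ℝ ℝ] g) x‖ ≤ (∫ x, ‖f x‖) * ∫ x, ‖g x‖ := by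
  have h := integral_convolution (μ := volume) (ν := volume) (ContinuousLinearMap.lsmul ℝ ℝ)
    hf.norm hg.norm
  rw [show (∫ x, ‖f x‖) * ∫ x, ‖g x‖
    = (ContinuousLinearMap.lsmul ℝ ℝ) (∫ x, ‖f x‖) (∫ x, ‖g x‖) from rfl, ← h]
  refine integral_mono (hf.integrable_convolution _ hg).norm
    (hf.norm.integrable_convolution _ hg.norm) fun x => ?_
  simp only [convolution_def]
  refine (norm_integral_le_integral_norm _).trans_eq ?_
  congr 1; ext t
  simp [norm_mul]

/-- A Volterra equation of the second kind in `L¹(ℝ₊)` with a kernel of norm less than one. -/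
theorem exists_volterra_fixedPoint {κ : ℝ → ℝ} (hκ : Integrable κ) (hq : ∫ x, ‖κ x‖ < 1) :
    ∃ f : ℝ → ℝ, Integrable f ∧
      ∀ᵐ x, f x = κ x - (κ ⋆[ContinuousLinearMap.lsmul ℝ ℝ] ((Ioi 0).indicator f)) x := by
  have hind : ∀ f : Lp ℝ 1 (volume : Measure ℝ), Integrable ((Ioi 0).indicator f) := fun f =>
    (L1.integrable_coeFn f).indicator measurableSet_Ioi
  have hint : ∀ f : Lp ℝ 1 (volume : Measure ℝ), Integrable (fun x =>
      κ x - (κ ⋆[ContinuousLinearMap.lsmul ℝ ℝ] ((Ioi 0).indicator f)) x) := fun f =>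
    hκ.sub (hκ.integrable_convolution _ (hind f))
  set Φ : Lp ℝ 1 (volume : Measure ℝ) → Lp ℝ 1 (volume : Measure ℝ) :=
    fun f => (hint f).toL1 _ with hΦ
  have hq0 : 0 ≤ ∫ x, ‖κ x‖ := integral_nonneg fun _ => norm_nonneg _
  have hcon : ContractingWith ⟨∫ x, ‖κ x‖, hq0⟩ Φ := by
    refine ⟨hq, LipschitzWith.of_dist_le_mul fun f g => ?_⟩
    rw [dist_eq_norm, dist_eq_norm, hΦ, ← Integrable.toL1_sub, L1.norm_of_fun_eq_integral_norm]
    have e1 : ∀ᵐ x, ‖((fun x => κ x - (κ ⋆[ContinuousLinearMap.lsmul ℝ ℝ] ((Ioi 0).indicator f)) x)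
        - fun x => κ x - (κ ⋆[ContinuousLinearMap.lsmul ℝ ℝ] ((Ioi 0).indicator g)) x) x‖
        = ‖(κ ⋆[ContinuousLinearMap.lsmul ℝ ℝ]
            ((Ioi 0).indicator f - (Ioi 0).indicator g)) x‖ := by
      filter_upwards [hκ.ae_convolution_exists (ContinuousLinearMap.lsmul ℝ ℝ) (hind f),
        hκ.ae_convolution_exists (ContinuousLinearMap.lsmul ℝ ℝ) (hind g)] with x hf hg
      have : (κ ⋆[ContinuousLinearMap.lsmul ℝ ℝ] ((Ioi 0).indicator f - (Ioi 0).indicator g)) x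
          = (κ ⋆[ContinuousLinearMap.lsmul ℝ ℝ] ((Ioi 0).indicator f)) x
            - (κ ⋆[ContinuousLinearMap.lsmul ℝ ℝ] ((Ioi 0).indicator g)) x := by
        simp only [convolution_def, map_sub, Pi.sub_apply]
        exact integral_sub hf hg
      rw [this, Pi.sub_apply, ← norm_neg]
      congr 1; ring
    rw [integral_congr_ae e1]
    refine (integral_norm_convolution_le hκ ((hind f).sub (hind g))).trans ?_
    refine mul_le_mul_of_nonneg_left ?_ hq0
    rw [L1.norm_eq_integral_norm]
    refine integral_mono_ae ((hind f).sub (hind g)).norm (L1.integrable_coeFn _).norm ?_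
    filter_upwards [Lp.coeFn_sub f g] with x hx
    rw [hx, Pi.sub_apply, Pi.sub_apply]
    by_cases h : x ∈ Ioi (0 : ℝ)
    · rw [indicator_of_mem h, indicator_of_mem h]
    · rw [indicator_of_notMem h, indicator_of_notMem h]; simp
  refine ⟨hcon.fixedPoint, L1.integrable_coeFn _, ?_⟩
  have h1 := hcon.fixedPoint_isFixedPt
  have h2 : Φ hcon.fixedPoint =ᵐ[volume] _ := (hint hcon.fixedPoint).coeFn_toL1
  rw [h1] at h2
  exact h2

/-- Multiplication by `exp (-n s)` commutes with convolution, so the weighted equation is solved in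
`L¹` by contraction and the weight is then removed. -/
theorem exists_resolventSecondKind {k : ℝ → ℝ} (n : ℕ)
    (hk : IntegrableOn (fun s => Real.exp (-n * s) * k s) (Ioi 0))
    (hq : ∫ s in Ioi (0 : ℝ), ‖Real.exp (-n * s) * k s‖ < 1) :
    ∃ R, IsResolventSecondKind k R := by
  set κ : ℝ → ℝ := (Ioi 0).indicator (fun s => Real.exp (-n * s) * k s) with hκdef
  have hκ : Integrable κ := (integrable_indicator_iff measurableSet_Ioi).2 hk
  have hq' : ∫ x, ‖κ x‖ < 1 := by
    simp only [hκdef, norm_indicator_eq_indicator_norm]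
    rwa [integral_indicator measurableSet_Ioi]
  obtain ⟨f, hf, hfe⟩ := exists_volterra_fixedPoint hκ hq'
  set R : ℝ → ℝ := fun s => Real.exp (n * s) * f s with hR
  have hconv : ∀ᵐ t ∂(volume.restrict (Ioi (0 : ℝ))), conv k R t = k t - R t := by
    refine (ae_restrict_iff' measurableSet_Ioi).2 ?_
    filter_upwards [hfe] with t ht ht0
    have e1 : (κ ⋆[ContinuousLinearMap.lsmul ℝ ℝ] ((Ioi 0).indicator f)) t
        = Real.exp (-n * t) * conv k R t := by
      rw [conv_swap, ← intervalIntegral.integral_const_mul, hκdef,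
        ← posConvolution_eq_convolution_indicator (fun s => Real.exp (-n * s) * k s) f
          (ContinuousLinearMap.lsmul ℝ ℝ) volume, posConvolution, indicator_of_mem ht0]
      congr 1; ext s
      have : Real.exp (-n * t) * Real.exp (n * (t - s)) = Real.exp (-n * s) := by
        rw [← Real.exp_add]; congr 1; ring
      simp only [ContinuousLinearMap.lsmul_apply, smul_eq_mul, hR]
      rw [← this]; ring
    rw [e1, hκdef, indicator_of_mem ht0] at ht
    have h2 : Real.exp (n * t) * Real.exp (-n * t) = 1 := by
      rw [← Real.exp_add]; simp
    have : R t = (Real.exp (n * t) * Real.exp (-n * t)) * (k t - conv k R t) := by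
      rw [hR]; simp only; rw [ht]; ring
    rw [h2] at this
    linarith
  refine ⟨R, ?_, hconv, ?_⟩
  · exact (LocallyIntegrableOn.continuousOn_mul (s := univ)
      (by simpa using hf.locallyIntegrable.locallyIntegrableOn univ)
      (by fun_prop) isOpen_univ.isLocallyClosed).mono_set (subset_univ _)
  · simpa only [conv_comm R k] using hconv

/-- The kernel is integrable near `0` and bounded by `k 1` beyond `1`. One factor `exp (-s)` makes
it integrable on the half line, and a further `exp (-n s)` makes the norm less than one. -/
theorem IsMonotoneKernel.exists_resolvent {k : ℝ → ℝ} (hk : IsMonotoneKernel k) (lam : ℝ) :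
    ∃ R, IsResolventSecondKind (fun s => -lam * k s) R := by
  have h1 : IntegrableOn (fun s => Real.exp (-s) * k s) (Ioi 0) := by
    rw [← Ioc_union_Ioi_eq_Ioi zero_le_one]
    refine IntegrableOn.union ?_ ?_
    · exact (hk.integrableOn 1).continuousOn_mul_of_subset (K := Icc 0 1) (by fun_prop)
        isCompact_Icc measurableSet_Ioc Ioc_subset_Icc_self
    · have hm : AEStronglyMeasurable k (volume.restrict (Ioi 1)) :=
        ((hk.measurable_indicator.aestronglyMeasurable (μ := volume.restrict (Ioi 1)))).congr
          ((ae_restrict_iff' measurableSet_Ioi).2 (ae_of_all _ fun s hs =>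
            indicator_of_mem (mem_Ioi.2 (one_pos.trans hs)) k))
      refine (integrableOn_exp_neg_Ioi 1).mul_bdd (c := k 1) hm ?_
      refine (ae_restrict_iff' measurableSet_Ioi).2 (ae_of_all _ fun s hs => ?_)
      have hs0 : 0 < s := one_pos.trans hs
      rw [Real.norm_of_nonneg (hk.nonneg s hs0)]
      exact hk.antitone (mem_Ioi.2 one_pos) hs0 (le_of_lt hs)
  have h2 : IntegrableOn (fun s => |lam| * (Real.exp (-s) * k s)) (Ioi 0) := h1.const_mul _
  obtain ⟨n, hn⟩ := ((tendsto_integral_exp_mul measurableSet_Ioi subset_rfl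
    h2).eventually_lt_const one_pos).exists
  have e : ∀ s ∈ Ioi (0 : ℝ), Real.exp (-n * s) * (|lam| * (Real.exp (-s) * k s))
      = ‖Real.exp (-(n + 1 : ℕ) * s) * (-lam * k s)‖ := fun s hs => by
    rw [norm_mul, norm_mul, Real.norm_of_nonneg (Real.exp_pos _).le, norm_neg, Real.norm_eq_abs,
      Real.norm_of_nonneg (hk.nonneg s hs)]
    have : Real.exp (-(n + 1 : ℕ) * s) = Real.exp (-n * s) * Real.exp (-s) := by
      rw [← Real.exp_add]; congr 1; push_cast; ring
    rw [this]; ring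
  refine exists_resolventSecondKind (n + 1) ?_ ?_
  · refine Integrable.congr (f := fun s => Real.exp (-n * s) * (-lam * (Real.exp (-s) * k s)))
      ?_ (ae_of_all _ fun s => ?_)
    · refine (h1.const_mul (-lam)).bdd_mul (c := 1) (by fun_prop) ?_
      refine (ae_restrict_iff' measurableSet_Ioi).2 (ae_of_all _ fun s hs => ?_)
      rw [Real.norm_of_nonneg (Real.exp_pos _).le]
      refine Real.exp_le_one_iff.2 ?_
      have : (0 : ℝ) ≤ n * s := mul_nonneg n.cast_nonneg (le_of_lt hs)
      linarith
    · have : Real.exp (-(n + 1 : ℕ) * s) = Real.exp (-n * s) * Real.exp (-s) := by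
        rw [← Real.exp_add]; congr 1; push_cast; ring
      simp only [this]; ring
  · rwa [← setIntegral_congr_fun measurableSet_Ioi e]

theorem IsResolventSecondKind.integrableOn {k R : ℝ → ℝ} (h : IsResolventSecondKind k R) (T : ℝ) :
    IntegrableOn R (Ioc 0 T) :=
  (h.locallyIntegrable.integrableOn_compact_subset Icc_subset_Ici_self
    isCompact_Icc).mono_set Ioc_subset_Icc_self

/-- `1 * (k * R) = k * (1 * R)`. -/
theorem integral_conv {k R : ℝ → ℝ} {t : ℝ} (ht : 0 ≤ t) (hk : IntegrableOn k (Ioc 0 t))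
    (hR : IntegrableOn R (Ioc 0 t)) :
    IntervalIntegrable (conv k R) volume 0 t ∧
    ∫ x in (0 : ℝ)..t, conv k R x = conv k (fun x => ∫ s in (0 : ℝ)..x, R s) t := by
  set k' := (Ioc 0 t).indicator k with hk'
  set R' := (Ioc 0 t).indicator R with hR'
  have ik : Integrable k' := (integrable_indicator_iff measurableSet_Ioc).2 hk
  have iR : Integrable R' := (integrable_indicator_iff measurableSet_Ioc).2 hR
  have hint : Integrable (Function.uncurry fun x s => k' s * R' (x - s))
      ((volume.restrict (Ioc 0 t)).prod volume) := by
    have := ik.convolution_integrand (μ := volume) (ContinuousLinearMap.lsmul ℝ ℝ) iR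
    refine Integrable.mono_measure this ?_
    exact Measure.prod_mono Measure.restrict_le_self le_rfl
  have e1 : ∀ x ∈ Ioc 0 t, ∫ s, k' s * R' (x - s) = conv k R x := fun x hx => by
    rw [conv_swap, intervalIntegral.integral_of_le hx.1.le, integral_Ioc_eq_integral_Ioo,
      ← integral_indicator measurableSet_Ioo]
    congr 1; ext s
    by_cases hs : s ∈ Ioo 0 x
    · rw [indicator_of_mem hs, hk', hR', indicator_of_mem (s := Ioc 0 t) ⟨hs.1, by linarith [hs.2, hx.2]⟩,
        indicator_of_mem (s := Ioc 0 t) ⟨by linarith [hs.2], by linarith [hs.1, hx.2]⟩, smul_eq_mul]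
    · rw [indicator_of_notMem hs]
      by_cases h1 : 0 < s
      · rw [hR', indicator_of_notMem, mul_zero]
        exact fun h => hs ⟨h1, by linarith [h.1]⟩
      · rw [hk', indicator_of_notMem, zero_mul]
        exact fun h => h1 h.1
  have e2 : ∀ s, ∫ x in Ioc 0 t, k' s * R' (x - s)
      = (Ioc 0 t).indicator (fun s => k s * ∫ r in (0 : ℝ)..(t - s), R r) s := fun s => by
    rw [integral_const_mul]
    by_cases hs : s ∈ Ioc 0 t
    · rw [indicator_of_mem hs, hk', indicator_of_mem hs,
        ← intervalIntegral.integral_of_le ht, intervalIntegral.integral_comp_sub_right]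
      congr 1
      rw [intervalIntegral.integral_of_le (by linarith),
        intervalIntegral.integral_of_le (by linarith [hs.2]), hR',
        setIntegral_indicator measurableSet_Ioc]
      congr 2
      ext x
      simp only [mem_inter_iff, mem_Ioc]
      constructor
      · rintro ⟨⟨h1, h2⟩, h3, h4⟩; exact ⟨h3, by linarith⟩
      · rintro ⟨h1, h2⟩; exact ⟨⟨by linarith [hs.1], by linarith⟩, h1, by linarith [hs.1]⟩
    · rw [indicator_of_notMem hs, hk', indicator_of_notMem hs, zero_mul]
  constructor
  · rw [intervalIntegrable_iff_integrableOn_Ioc_of_le ht]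
    exact hint.integral_prod_left.congr
      ((ae_restrict_iff' measurableSet_Ioc).2 (ae_of_all _ e1))
  · rw [intervalIntegral.integral_of_le ht, ← setIntegral_congr_fun measurableSet_Ioc e1,
      integral_integral_swap hint, integral_congr_ae (ae_of_all _ e2),
      integral_indicator measurableSet_Ioc, conv_swap, intervalIntegral.integral_of_le ht]
    rfl

/-- The integrated canonical resolvent `E_{lam,k} * 1`. -/
noncomputable def intResolvent (lam : ℝ) (k : ℝ → ℝ) (t : ℝ) : ℝ :=
  ∫ s in (0 : ℝ)..t, canonicalResolvent lam k s

namespace IsMonotoneKernel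

variable {k : ℝ → ℝ}

theorem resolvent_spec (hk : IsMonotoneKernel k) (lam : ℝ) :
    IsResolventSecondKind (fun s => -lam * k s) (resolventSecondKind fun s => -lam * k s) :=
  Classical.epsilon_spec (hk.exists_resolvent lam)

theorem integrableOn_canonicalResolvent (hk : IsMonotoneKernel k) (lam T : ℝ) :
    IntegrableOn (canonicalResolvent lam k) (Ioc 0 T) := by
  unfold canonicalResolvent
  split_ifs with h
  · exact hk.integrableOn T
  · exact ((hk.resolvent_spec lam).integrableOn T).const_mul _

/-- Dividing the resolvent equation of `-lam * k` by `-lam` brings the cases `lam = 0` and `lam ≠ 0`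
under one equation. -/
theorem canonicalResolvent_ae_eq (hk : IsMonotoneKernel k) (lam : ℝ) :
    ∀ᵐ t ∂(volume.restrict (Ioi (0 : ℝ))), canonicalResolvent lam k t
      = k t + lam * conv k (canonicalResolvent lam k) t := by
  by_cases h : lam = 0
  · refine ae_of_all _ fun t => ?_
    rw [canonicalResolvent, if_pos h, h]; ring
  · filter_upwards [(hk.resolvent_spec lam).conv_left] with t ht
    rw [canonicalResolvent, if_neg h]
    set R := resolventSecondKind fun s => -lam * k s
    have e1 : conv (fun s => -lam * k s) R t = -lam * conv k R t := by
      rw [conv_comm, conv_const_mul, conv_comm]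
    rw [e1] at ht
    rw [conv_const_mul]
    field_simp
    linarith

theorem continuousOn_intResolvent (hk : IsMonotoneKernel k) (lam T : ℝ) :
    ContinuousOn (intResolvent lam k) (Icc 0 T) := by
  rcases le_or_gt 0 T with hT | hT
  · have h := (intervalIntegrable_iff_integrableOn_Ioc_of_le hT).2
      (hk.integrableOn_canonicalResolvent lam T)
    have := intervalIntegral.continuousOn_primitive_interval' h left_mem_uIcc
    rwa [uIcc_of_le hT] at this
  · rw [Icc_eq_empty (not_le.2 hT)]
    exact continuousOn_empty _

/-- The resolvent is determined only up to null sets. Its primitive is continuous and satisfies an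
equation at every point, and the later comparisons rest on this equation. -/
theorem intResolvent_eq_conv (hk : IsMonotoneKernel k) (lam : ℝ) {t : ℝ} (ht : 0 ≤ t) :
    intResolvent lam k t = conv k (fun s => 1 + lam * intResolvent lam k s) t := by
  have hE := hk.integrableOn_canonicalResolvent lam t
  obtain ⟨i1, e1⟩ := integral_conv ht (hk.integrableOn t) hE
  have hb : BddMeasOn (intResolvent lam k) t :=
    BddMeasOn.of_continuousOn (hk.continuousOn_intResolvent lam t)
  rw [conv_add ht (hk.integrableOn t) (BddMeasOn.const 1) (hb.const_mul lam), conv_one,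
    conv_const_mul, intResolvent]
  have e2 : ∫ s in (0 : ℝ)..t, canonicalResolvent lam k s
      = ∫ s in (0 : ℝ)..t, (k s + lam * conv k (canonicalResolvent lam k) s) := by
    rw [intervalIntegral.integral_of_le ht, intervalIntegral.integral_of_le ht]
    exact integral_congr_ae
      (ae_restrict_of_ae_restrict_of_subset Ioc_subset_Ioi_self (hk.canonicalResolvent_ae_eq lam))
  rw [e2, intervalIntegral.integral_add (hk.intervalIntegrable le_rfl ht) (i1.const_mul lam),
    intervalIntegral.integral_const_mul, e1]
  rfl

theorem gronwall (hk : IsMonotoneKernel k) {lam T : ℝ} {u : ℝ → ℝ} (hlam : 0 ≤ lam)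
    (hu : ContinuousOn u (Icc 0 T)) (h : ∀ t ∈ Icc 0 T, u t ≤ lam * conv k u t) :
    ∀ t ∈ Icc 0 T, u t ≤ 0 := by
  refine gronwall_conv (k := fun s => lam * k s) ((hk.integrableOn T).const_mul lam)
    (fun s hs => mul_nonneg hlam (hk.nonneg s hs)) hu fun t ht => (h t ht).trans_eq ?_
  rw [conv_comm (fun s => lam * k s) u, conv_const_mul, conv_comm]

theorem bddMeasOn_intResolvent (hk : IsMonotoneKernel k) (lam T : ℝ) :
    BddMeasOn (intResolvent lam k) T :=
  BddMeasOn.of_continuousOn (hk.continuousOn_intResolvent lam T)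

theorem intResolvent_eq_add (hk : IsMonotoneKernel k) (lam : ℝ) {t : ℝ} (ht : 0 ≤ t) :
    intResolvent lam k t = (∫ s in (0 : ℝ)..t, k s) + lam * conv k (intResolvent lam k) t := by
  rw [hk.intResolvent_eq_conv lam ht, conv_add ht (hk.integrableOn t) (BddMeasOn.const 1)
    ((hk.bddMeasOn_intResolvent lam t).const_mul lam), conv_one, conv_const_mul]

/-- Gronwall's inequality for `-e`, where `e` is the integrated resolvent: the forcing `∫ k` in its
equation is nonnegative. Monotonicity in the parameter and in time follow the same scheme. -/
theorem intResolvent_nonneg (hk : IsMonotoneKernel k) {lam t : ℝ} (hlam : 0 ≤ lam) (ht : 0 ≤ t) :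
    0 ≤ intResolvent lam k t := by
  have := hk.gronwall (T := t) (u := fun s => -1 * intResolvent lam k s) hlam
    ((hk.continuousOn_intResolvent lam t).const_smul (-1 : ℝ)) (fun s hs => ?_) t ⟨ht, le_rfl⟩
  · linarith
  · rw [conv_const_mul, hk.intResolvent_eq_add lam hs.1]
    have := hk.integral_nonneg le_rfl hs.1
    linarith

theorem integral_le_intResolvent (hk : IsMonotoneKernel k) {lam t : ℝ} (hlam : 0 ≤ lam)
    (ht : 0 ≤ t) : ∫ s in (0 : ℝ)..t, k s ≤ intResolvent lam k t := by
  rw [hk.intResolvent_eq_add lam ht]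
  have : 0 ≤ conv k (intResolvent lam k) t := conv_nonneg ht hk.nonneg fun s hs =>
    hk.intResolvent_nonneg hlam hs.1.le
  have := mul_nonneg hlam this
  linarith

theorem intResolvent_mono_param (hk : IsMonotoneKernel k) {lam lam' t : ℝ} (hlam : 0 ≤ lam)
    (h : lam ≤ lam') (ht : 0 ≤ t) : intResolvent lam k t ≤ intResolvent lam' k t := by
  have := hk.gronwall (T := t) (u := fun s => intResolvent lam k s - intResolvent lam' k s) hlam
    ((hk.continuousOn_intResolvent lam t).sub (hk.continuousOn_intResolvent lam' t))
    (fun s hs => ?_) t ⟨ht, le_rfl⟩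
  · linarith
  · rw [conv_sub hs.1 (hk.integrableOn s) (hk.bddMeasOn_intResolvent lam s)
      (hk.bddMeasOn_intResolvent lam' s), hk.intResolvent_eq_add lam hs.1,
      hk.intResolvent_eq_add lam' hs.1]
    have : 0 ≤ conv k (intResolvent lam' k) s := conv_nonneg hs.1 hk.nonneg fun s hs =>
      hk.intResolvent_nonneg (hlam.trans h) hs.1.le
    nlinarith

theorem conv_shift_le (hk : IsMonotoneKernel k) {f : ℝ → ℝ} {t d : ℝ} (ht : 0 ≤ t) (hd : 0 ≤ d)
    (hf : ContinuousOn f (Icc 0 (t + d))) (hf0 : ∀ s, 0 ≤ s → 0 ≤ f s) :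
    conv k (fun s => f (s + d)) t ≤ conv k f (t + d) := by
  have htd : 0 ≤ t + d := add_nonneg ht hd
  have i1 : IntervalIntegrable (fun s => k s • f (t + d - s)) volume 0 (t + d) := by
    have := (convIntegrable htd (hk.integrableOn _) (BddMeasOn.of_continuousOn hf)).comp_sub_left
      (t + d)
    simpa using this.symm
  rw [conv_swap, conv_swap]
  simp only [sub_add_eq_add_sub]
  refine intervalIntegral.integral_mono_interval le_rfl ht (by linarith) ?_ i1
  refine (ae_restrict_iff' measurableSet_Ioc).2 (ae_of_all _ fun s hs => ?_)
  exact mul_nonneg (hk.nonneg s hs.1) (hf0 _ (by linarith [hs.2]))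

/-- Gronwall's inequality is applied to `e r - e (r + d)`; no information on the sign of the
resolvent itself is needed. -/
theorem intResolvent_mono (hk : IsMonotoneKernel k) {lam s t : ℝ} (hlam : 0 ≤ lam) (hs : 0 ≤ s)
    (hst : s ≤ t) : intResolvent lam k s ≤ intResolvent lam k t := by
  set d := t - s with hd
  have hd0 : 0 ≤ d := sub_nonneg.2 hst
  have hcont : ∀ x, ContinuousOn (fun r => intResolvent lam k (r + d)) (Icc 0 x) := fun x =>
    (hk.continuousOn_intResolvent lam (x + d)).comp (by fun_prop)
      fun r hr => ⟨by linarith [hr.1], by linarith [hr.2]⟩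
  have := hk.gronwall (T := s) (u := fun r => intResolvent lam k r - intResolvent lam k (r + d))
    hlam ((hk.continuousOn_intResolvent lam s).sub (hcont s)) (fun x hx => ?_) s ⟨hs, le_rfl⟩
  · rw [show s + d = t by simp [hd]] at this
    linarith
  · rw [conv_sub hx.1 (hk.integrableOn x) (hk.bddMeasOn_intResolvent lam x)
      (BddMeasOn.of_continuousOn (hcont x)), hk.intResolvent_eq_add lam hx.1,
      hk.intResolvent_eq_add lam (add_nonneg hx.1 hd0)]
    have h1 := hk.conv_shift_le hx.1 hd0 (hk.continuousOn_intResolvent lam (x + d))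
      fun r hr => hk.intResolvent_nonneg hlam hr
    have h2 := hk.integral_mono_right hx.1 (by linarith : x ≤ x + d)
    have h3 := mul_le_mul_of_nonneg_left h1 hlam
    rw [mul_sub]
    linarith

end IsMonotoneKernel

end RoughHawkesHeston

/-! ### Sums of exponentials are monotone kernels. -/

namespace RoughHawkesHeston

open scoped Topology RealInnerProductSpace

theorem IsAdmissibleKernel.isMonotoneKernel {K : ℝ → ℝ} (hK : IsAdmissibleKernel K) :
    IsMonotoneKernel K where
  nonneg := hK.nonneg
  antitone := hK.antitone
  integrableOn T := (hK.memL2loc T).integrable one_le_two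
  firstKind := hK.firstKind

/-- The final estimate has the integral of a resolvent as a factor, with no additive constant;
positive mass of `K` is what lets this factor absorb the constant. -/
theorem IsAdmissibleKernel.integral_pos {K : ℝ → ℝ} (hK : IsAdmissibleKernel K) {T : ℝ}
    (hT : 0 < T) : 0 < ∫ s in (0 : ℝ)..T, K s := by
  have hm := hK.isMonotoneKernel
  obtain ⟨t, ht, hne⟩ := hK.ne_zero
  have hKt : 0 < K t := lt_of_le_of_ne (hK.nonneg t ht) hne.symm
  have h0 : 0 < min t T := lt_min ht hT
  refine lt_of_lt_of_le ?_ (hm.integral_mono_right h0.le (min_le_right t T))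
  have := intervalIntegral.integral_mono_on_of_le_Ioo h0.le
    (intervalIntegrable_const (c := K t)) (hm.intervalIntegrable le_rfl h0.le)
    (fun s hs => hK.antitone hs.1 ht (hs.2.le.trans (min_le_left t T)))
  refine lt_of_lt_of_le ?_ this
  simp only [intervalIntegral.integral_const, sub_zero, smul_eq_mul]
  positivity

/-- A resolvent of the first kind with an atom at the origin and a nonincreasing density. -/
theorem isMonotoneKernel_of_density {k l : ℝ → ℝ} {m : ℝ} (h0 : ∀ t, 0 < t → 0 ≤ k t)
    (hk : AntitoneOn k (Ioi 0)) (hki : ∀ T, IntegrableOn k (Ioc 0 T)) (hm : 0 ≤ m)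
    (hl : Continuous l) (hl0 : ∀ t, 0 ≤ l t) (hla : Antitone l)
    (hkl : ∀ t, 0 < t → m * k t + conv k l t = 1) : IsMonotoneKernel k := by
  set D : Measure ℝ := (volume.withDensity fun t => ENNReal.ofReal (l t)).restrict (Ici 0) with hD
  have hloc : IsLocallyFiniteMeasure (volume.withDensity fun t => ENNReal.ofReal (l t)) :=
    IsLocallyFiniteMeasure.withDensity_ofReal hl
  have hlocD : IsLocallyFiniteMeasure D := by rw [hD]; infer_instance
  have hDI : ∀ s t, 0 ≤ s → D (Icc s (s + t))
      = ∫⁻ x in Icc 0 t, ENNReal.ofReal (l (x + s)) := fun s t hs => by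
    have hsub : Icc s (s + t) ⊆ Ici 0 := fun x hx => hs.trans hx.1
    rw [hD, Measure.restrict_apply measurableSet_Icc, inter_eq_self_of_subset_left hsub, withDensity_apply _ measurableSet_Icc,
      ← lintegral_indicator measurableSet_Icc, ← lintegral_indicator measurableSet_Icc,
      ← lintegral_add_right_eq_self _ s]
    congr 1; ext x
    simp only [indicator, mem_Icc]
    congr 1
    simp only [eq_iff_iff]
    constructor <;> rintro ⟨h1, h2⟩ <;> constructor <;> linarith
  refine ⟨h0, hk, hki, ENNReal.ofReal m • Measure.dirac 0 + D, ⟨?_, ?_, ?_⟩, fun t ht => ?_⟩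
  · refine ⟨fun x => ?_⟩
    obtain ⟨s, hs, hs'⟩ := D.finiteAt_nhds x
    refine ⟨s, hs, ?_⟩
    rw [Measure.add_apply, Measure.smul_apply, smul_eq_mul]
    exact ENNReal.add_lt_top.2 ⟨ENNReal.mul_lt_top ENNReal.ofReal_lt_top (measure_lt_top _ _), hs'⟩
  · rw [Measure.add_apply, Measure.smul_apply, smul_eq_mul, Measure.dirac_apply' _ measurableSet_Iio,
      indicator_of_notMem (by simp), hD, Measure.restrict_apply measurableSet_Iio,
      show Iio (0 : ℝ) ∩ Ici 0 = ∅ from by ext x; simp]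
    simp
  · refine (ae_restrict_iff' measurableSet_Ioi).2 (ae_of_all _ fun t ht => ?_)
    have ht0 : (0 : ℝ) < t := ht
    have hr : (ENNReal.ofReal m • Measure.dirac (0 : ℝ)).restrict (Icc 0 t)
        = ENNReal.ofReal m • Measure.dirac 0 := by
      rw [Measure.restrict_smul, restrict_dirac' measurableSet_Icc, if_pos ⟨le_rfl, ht0.le⟩]
    have hDr : D.restrict (Icc 0 t)
        = (volume.withDensity fun t => ENNReal.ofReal (l t)).restrict (Icc 0 t) := by
      rw [hD, Measure.restrict_restrict measurableSet_Icc,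
        inter_eq_self_of_subset_left Icc_subset_Ici_self]
    have hmeas : Measurable fun t => ENNReal.ofReal (l t) := hl.measurable.ennreal_ofReal
    have hci : IntegrableOn (fun s => k (t - s) * l s) (Icc 0 t) := by
      rw [integrableOn_Icc_iff_integrableOn_Ioc]
      exact (intervalIntegrable_iff_integrableOn_Ioc_of_le ht0.le).1
        (convIntegrable ht0.le (hki t) (BddMeasOn.of_continuousOn hl.continuousOn))
    have hi : Integrable (fun s => k (t - s)) (D.restrict (Icc 0 t)) := by
      rw [hDr, restrict_withDensity measurableSet_Icc,
        integrable_withDensity_iff_integrable_smul' hmeas (ae_of_all _ fun _ => ENNReal.ofReal_lt_top)]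
      refine hci.congr (ae_of_all _ fun s => ?_)
      simp only [ENNReal.toReal_ofReal (hl0 s), smul_eq_mul, mul_comm]
    rw [Measure.restrict_add, integral_add_measure _ hi, hr, integral_smul_measure, integral_dirac,
      hDr, setIntegral_withDensity_eq_setIntegral_toReal_smul hmeas
        (ae_of_all _ fun _ => ENNReal.ofReal_lt_top) _ measurableSet_Icc, ← hkl t ht0, sub_zero,
      ENNReal.toReal_ofReal hm, smul_eq_mul, conv, intervalIntegral.integral_of_le ht0.le,
      integral_Icc_eq_integral_Ioc]
    · congr 2; ext s
      rw [ENNReal.toReal_ofReal (hl0 s), smul_eq_mul, smul_eq_mul, mul_comm]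
    · rw [hr]
      exact (integrable_dirac (by simp)).smul_measure ENNReal.ofReal_ne_top
  · intro s hs s' hs' hss
    simp only [Measure.add_apply, Measure.smul_apply, smul_eq_mul]
    refine add_le_add (mul_le_mul_right ?_ _) ?_
    · rw [Measure.dirac_apply' _ measurableSet_Icc, Measure.dirac_apply' _ measurableSet_Icc]
      -- The later window contains the atom at `0` only if `s' = 0`, and then `s = 0` too.
      by_cases h : (0 : ℝ) ∈ Icc s' (s' + t)
      · have hs0 : (0 : ℝ) ≤ s := hs
        have : s = 0 := le_antisymm (hss.trans h.1) hs0
        rw [indicator_of_mem h, indicator_of_mem (by rw [this]; exact ⟨le_rfl, by linarith⟩)]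
      · rw [indicator_of_notMem h]
        exact zero_le
    · rw [hDI s t hs, hDI s' t hs']
      exact lintegral_mono fun x => ENNReal.ofReal_le_ofReal (hla (by linarith))

section Semigroup

variable {E : Type*} [NormedAddCommGroup E] [InnerProductSpace ℝ E] [CompleteSpace E]
  (B : E →L[ℝ] E) (u : E)

theorem hasDerivAt_exp_apply (t : ℝ) :
    HasDerivAt (fun t : ℝ => NormedSpace.exp (t • B) u) (B (NormedSpace.exp (t • B) u)) t := by
  have h := (hasDerivAt_exp_smul_const' (𝕂 := ℝ) B t).clm_apply (hasDerivAt_const t u)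
  simpa using h

/-- `exp (t B)` is the square of the self-adjoint operator `exp ((t / 2) B)`. The quadratic form is
thus nonnegative, and it decreases in `t` when `B ≤ 0`. -/
theorem inner_exp_apply (hB : IsSelfAdjoint B) (t : ℝ) :
    ⟪u, NormedSpace.exp (t • B) u⟫ = ‖NormedSpace.exp ((t / 2) • B) u‖ ^ 2 := by
  have hP : IsSelfAdjoint (NormedSpace.exp ((t / 2) • B)) :=
    ((IsSelfAdjoint.all (t / 2)).smul hB).exp
  have e : NormedSpace.exp (t • B) = NormedSpace.exp ((t / 2) • B) * NormedSpace.exp ((t / 2) • B) := by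
    let _ : NormedAlgebra ℚ (E →L[ℝ] E) := NormedAlgebra.restrictScalars ℚ ℝ _
    rw [← NormedSpace.exp_add_of_commute (Commute.refl _), ← add_smul, add_halves]
  rw [e, mul_apply_eq_comp, ← real_inner_self_eq_norm_sq,
    ← ContinuousLinearMap.adjoint_inner_left, ContinuousLinearMap.isSelfAdjoint_iff'.1 hP]

theorem antitone_inner_exp (hB : IsSelfAdjoint B) (hneg : ∀ y, ⟪y, B y⟫ ≤ 0) :
    Antitone fun t : ℝ => ⟪u, NormedSpace.exp (t • B) u⟫ := by
  have h : Antitone fun t : ℝ => ‖NormedSpace.exp (t • B) u‖ ^ 2 := by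
    refine antitone_of_hasDerivAt_nonpos (fun t => (hasDerivAt_exp_apply B u t).norm_sq)
      fun t => ?_
    simp only [Pi.zero_apply]
    linarith [hneg (NormedSpace.exp (t • B) u)]
  intro s t hst
  simp only [inner_exp_apply B u hB]
  exact h (by linarith)

end Semigroup

/-- Let `M = ∑ mⱼ`, `uⱼ = √(mⱼ xⱼ)` and let `X` be the diagonal matrix of the `xⱼ`. The Laplace
transform of `L` should be `1 / (z k̂(z)) = 1 / (M - uᵀ (z + X)⁻¹ u)`. By the Sherman–Morrison
formula this equals `M⁻¹ + M⁻² uᵀ (z - B)⁻¹ u` with `B = -X + M⁻¹ u uᵀ`. This suggests an atom `M⁻¹`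
at `0` and the density `l t = M⁻² ⟪u, exp (t B) u⟫`; the proof verifies the resolvent identity
directly. -/
theorem expKernel_isMonotoneKernel {n : ℕ} (hn : 1 ≤ n) {m x : Fin n → ℝ} (hm : ∀ j, 0 < m j)
    (hx : ∀ j, 0 < x j) : IsMonotoneKernel (expKernel m x) := by
  have hne : Nonempty (Fin n) := ⟨⟨0, hn⟩⟩
  set M := ∑ j, m j with hM
  have hM0 : 0 < M := Finset.sum_pos (fun j _ => hm j) Finset.univ_nonempty
  set u : EuclideanSpace ℝ (Fin n) := WithLp.toLp 2 fun j => Real.sqrt (m j * x j) with hu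
  have hu0 : ∀ j, 0 < u j := fun j => Real.sqrt_pos.2 (mul_pos (hm j) (hx j))
  have husq : ∀ j, u j * u j = m j * x j := fun j =>
    Real.mul_self_sqrt (mul_pos (hm j) (hx j)).le
  set B : EuclideanSpace ℝ (Fin n) →L[ℝ] EuclideanSpace ℝ (Fin n) :=
    Matrix.toEuclideanCLM (𝕜 := ℝ)
      (Matrix.diagonal (fun j => -x j) + M⁻¹ • Matrix.vecMulVec u.ofLp u.ofLp) with hBdef
  have hBapp : ∀ y j, B y j = -x j * y j + M⁻¹ * ((∑ i, u i * y i) * u j) := fun y j => by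
    rw [hBdef, Matrix.ofLp_toEuclideanCLM, Matrix.add_mulVec, Pi.add_apply,
      Matrix.mulVec_diagonal, Matrix.smul_mulVec, Pi.smul_apply, Matrix.vecMulVec_mulVec]
    simp [dotProduct, mul_comm (u.ofLp j)]
  have hBsa : IsSelfAdjoint B := by
    have : IsSelfAdjoint (Matrix.diagonal (fun j => -x j) + M⁻¹ • Matrix.vecMulVec u.ofLp u.ofLp) := by
      rw [isSelfAdjoint_iff, Matrix.star_eq_conjTranspose]
      ext i j
      simp only [Matrix.conjTranspose_apply, Matrix.add_apply, Matrix.smul_apply,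
        Matrix.vecMulVec_apply, star_trivial, Matrix.diagonal_apply, mul_comm (u j)]
      congr 1
      by_cases h : i = j
      · simp [h]
      · simp [h, Ne.symm h]
    exact this.map (Matrix.toEuclideanCLM (n := Fin n) (𝕜 := ℝ))
  have hinner : ∀ y z : EuclideanSpace ℝ (Fin n), ⟪y, z⟫ = ∑ i, y i * z i := fun y z => by
    rw [PiLp.inner_apply]
    exact Finset.sum_congr rfl fun i _ => by simp [mul_comm]
  -- This is Cauchy–Schwarz for `√mᵢ` and `√xᵢ yᵢ`.
  have hneg : ∀ y, ⟪y, B y⟫ ≤ 0 := fun y => by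
    have e : ⟪y, B y⟫ = M⁻¹ * (∑ i, u i * y i) ^ 2 - ∑ i, x i * y i ^ 2 := by
      rw [hinner, sq, Finset.sum_mul, Finset.mul_sum, ← Finset.sum_sub_distrib]
      refine Finset.sum_congr rfl fun i _ => ?_
      rw [hBapp]; ring
    have cs := Finset.sum_mul_sq_le_sq_mul_sq Finset.univ (fun i => Real.sqrt (m i))
      (fun i => Real.sqrt (x i) * y i)
    have e1 : ∀ i, Real.sqrt (m i) * (Real.sqrt (x i) * y i) = u i * y i := fun i => by
      rw [← mul_assoc, ← Real.sqrt_mul (hm i).le]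
    have e2 : ∀ i, (Real.sqrt (x i) * y i) ^ 2 = x i * y i ^ 2 := fun i => by
      rw [mul_pow, Real.sq_sqrt (hx i).le]
    simp only [e1, e2, Real.sq_sqrt (hm _).le] at cs
    rw [e, sub_nonpos, inv_mul_le_iff₀ hM0]
    exact cs
  set Y : ℝ → EuclideanSpace ℝ (Fin n) := fun t => NormedSpace.exp (t • B) u with hY
  have hYd : ∀ t, HasDerivAt Y (B (Y t)) t := hasDerivAt_exp_apply B u
  have hYj : ∀ j t, HasDerivAt (fun t => Y t j) (B (Y t) j) t := fun j t =>
    (EuclideanSpace.proj (𝕜 := ℝ) j).hasFDerivAt.comp_hasDerivAt t (hYd t)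
  have hY0 : Y 0 = u := by
    have h0 : (0 : ℝ) • B = 0 := zero_smul ℝ B
    simp only [hY]
    rw [h0, NormedSpace.exp_zero]
    rfl
  set l : ℝ → ℝ := fun t => (M ^ 2)⁻¹ * ⟪u, Y t⟫ with hl
  have hYc : Continuous Y := continuous_iff_continuousAt.2 fun t => (hYd t).continuousAt
  have hlc : Continuous l := continuous_const.mul (continuous_const.inner hYc)
  have hkc : Continuous (expKernel m x) := by unfold expKernel; fun_prop
  -- A conserved quantity of `Y' = B Y`, because `mⱼ xⱼ / uⱼ = uⱼ` and `∑ mⱼ = M`.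
  have hD : ∀ t, ∑ j, m j * (Y t j / u j) = M := by
    have hd : ∀ t, HasDerivAt (fun t => ∑ j, m j * (Y t j / u j)) 0 t := fun t => by
      have h := HasDerivAt.fun_sum (u := Finset.univ)
        fun j _ => ((hYj j t).div_const (u j)).const_mul (m j)
      refine h.congr_deriv ?_
      have : ∀ j, m j * (B (Y t) j / u j)
          = M⁻¹ * (∑ i, u i * Y t i) * m j - u j * Y t j := fun j => by
        have huj := (hu0 j).ne'
        rw [hBapp]
        field_simp
        linear_combination Y t j * M * husq j
      simp only [this]
      rw [Finset.sum_sub_distrib, ← Finset.mul_sum, ← hM]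
      field_simp
      ring
    intro t
    have h1 := is_const_of_deriv_eq_zero (fun t => (hd t).differentiableAt)
      (fun t => (hd t).deriv) t 0
    rw [h1, hY0]
    exact Finset.sum_congr rfl fun j _ => by rw [div_self (hu0 j).ne', mul_one]
  refine isMonotoneKernel_of_density (l := l) (m := M⁻¹) (fun t _ => ?_) (fun s _ t _ hst => ?_)
    (fun T => ?_) (inv_pos.2 hM0).le hlc (fun t => ?_) ?_ fun t ht => ?_
  · exact Finset.sum_nonneg fun j _ => mul_nonneg (hm j).le (Real.exp_pos _).le
  · refine Finset.sum_le_sum fun j _ => mul_le_mul_of_nonneg_left (Real.exp_le_exp.2 ?_) (hm j).le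
    nlinarith [hx j]
  · exact (hkc.integrableOn_Icc).mono_set Ioc_subset_Icc_self
  · simp only [hl, hY]
    rw [inner_exp_apply B u hBsa]
    positivity
  · exact (antitone_inner_exp B u hBsa hneg).const_mul (by positivity)
  -- `S` is a primitive of `k (t - s) * l s`: differentiating the exponential cancels the diagonal
  -- part of `B` and leaves the rank-one part. The conserved quantity gives `S t = 1`, and `S 0` is
  -- the contribution of the atom.
  · set S : ℝ → ℝ := fun s => ∑ j, m j * (Real.exp (-x j * (t - s)) * (M⁻¹ * (Y s j / u j))) with hS
    have hSd : ∀ s, HasDerivAt S (expKernel m x (t - s) • l s) s := fun s => by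
      have hexp : ∀ j, HasDerivAt (fun s => Real.exp (-x j * (t - s)))
          (Real.exp (-x j * (t - s)) * x j) s := fun j => by
        have := (((hasDerivAt_id s).const_sub t).const_mul (-x j)).exp
        simpa using this
      have h := HasDerivAt.fun_sum (u := Finset.univ) fun j _ =>
        ((hexp j).mul (((hYj j s).div_const (u j)).const_mul M⁻¹)).const_mul (m j)
      refine HasDerivAt.congr_deriv (f := S) h ?_
      symm
      rw [smul_eq_mul, show expKernel m x (t - s) = ∑ j, m j * Real.exp (-x j * (t - s)) from rfl,
        Finset.sum_mul]
      refine Finset.sum_congr rfl fun j _ => ?_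
      have huj := (hu0 j).ne'
      rw [hBapp, show l s = (M ^ 2)⁻¹ * ⟪u, Y s⟫ from rfl, hinner]
      field_simp
      ring
    have hint : conv (expKernel m x) l t = S t - S 0 :=
      intervalIntegral.integral_eq_sub_of_hasDerivAt (fun s _ => hSd s)
        (Continuous.intervalIntegrable
          ((hkc.comp (continuous_const.sub continuous_id)).smul hlc) _ _)
    have hSt : S t = 1 := by
      have : S t = M⁻¹ * ∑ j, m j * (Y t j / u j) := by
        rw [hS, Finset.mul_sum]
        exact Finset.sum_congr rfl fun j _ => by simp; ring
      rw [this, hD, inv_mul_cancel₀ hM0.ne']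
    have hS0 : S 0 = M⁻¹ * expKernel m x t := by
      rw [hS, expKernel, Finset.mul_sum]
      refine Finset.sum_congr rfl fun j _ => ?_
      rw [hY0, div_self (hu0 j).ne', sub_zero]; ring
    rw [hint, hSt, hS0]; ring

end RoughHawkesHeston

/-! ### Lipschitz and dissipativity estimates for the coefficients. -/

namespace RoughHawkesHeston

open scoped Topology ComplexConjugate

theorem norm_exp_sub_exp_le {p q : ℂ} (hp : p.re ≤ 0) (hq : q.re ≤ 0) :
    ‖Complex.exp p - Complex.exp q‖ ≤ ‖p - q‖ := by
  have h := (convex_halfSpace_re_le 0).norm_image_sub_le_of_norm_hasDerivWithin_le (C := 1)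
    (fun z _ => (Complex.hasDerivAt_exp z).hasDerivWithinAt)
    (fun z (hz : z.re ≤ 0) => by
      rw [Complex.norm_exp]; exact Real.exp_le_one_iff.2 hz) hq hp
  simpa using h

/-- Mean value inequality for `exp z - z`, whose derivative is at most `‖z‖` on the left half plane,
on its convex intersection with a ball. -/
theorem norm_exp_sub_id_sub_le {p q : ℂ} (hp : p.re ≤ 0) (hq : q.re ≤ 0) :
    ‖Complex.exp p - Complex.exp q - (p - q)‖ ≤ (‖p‖ + ‖q‖) * ‖p - q‖ := by
  have hconv : Convex ℝ ({z : ℂ | z.re ≤ 0} ∩ Metric.closedBall 0 (‖p‖ + ‖q‖)) :=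
    (convex_halfSpace_re_le 0).inter (convex_closedBall 0 _)
  have h := hconv.norm_image_sub_le_of_norm_hasDerivWithin_le (C := ‖p‖ + ‖q‖)
    (f := fun z => Complex.exp z - z) (f' := fun z => Complex.exp z - 1) (x := q) (y := p)
    (fun z _ => ((Complex.hasDerivAt_exp z).sub (hasDerivAt_id z)).hasDerivWithinAt)
    (fun z hz => ?_) ⟨hq, by simp⟩ ⟨hp, by simp⟩
  · calc _ = ‖Complex.exp p - p - (Complex.exp q - q)‖ := by congr 1; ring
      _ ≤ _ := h
  · have := norm_exp_sub_exp_le (p := z) (q := 0) hz.1 (by simp)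
    rw [Complex.exp_zero, sub_zero] at this
    exact this.trans (by simpa using hz.2)

/-- The compensated exponential `∫ (exp (p z) - 1 - p z) ν(dz)`. -/
noncomputable def levyExp (ν : Measure ℝ) (p : ℂ) : ℂ :=
  ∫ z : ℝ, (Complex.exp (p * z) - 1 - p * z) ∂ν

namespace IsJumpMeasure

variable {ν : Measure ℝ}

theorem ae_pos (hν : IsJumpMeasure ν) : ∀ᵐ z ∂ν, 0 < z := by
  have := compl_mem_ae_iff.2 hν.support
  filter_upwards [this] with z hz
  simpa using hz

theorem re_mul_nonpos {p : ℂ} (hp : p.re ≤ 0) {z : ℝ} (hz : 0 < z) : (p * z).re ≤ 0 := by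
  simpa using mul_nonpos_of_nonpos_of_nonneg hp hz.le

theorem ae_norm_sub_le (hν : IsJumpMeasure ν) {p q : ℂ} (hp : p.re ≤ 0) (hq : q.re ≤ 0) :
    ∀ᵐ z : ℝ ∂ν, ‖(Complex.exp (p * z) - 1 - p * z) - (Complex.exp (q * z) - 1 - q * z)‖
      ≤ ((‖p‖ + ‖q‖) * ‖p - q‖) * z ^ 2 := by
  filter_upwards [hν.ae_pos] with z hz
  have h := norm_exp_sub_id_sub_le (re_mul_nonpos hp hz) (re_mul_nonpos hq hz)
  have e : (Complex.exp (p * z) - 1 - p * z) - (Complex.exp (q * z) - 1 - q * z)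
      = Complex.exp (p * z) - Complex.exp (q * z) - (p * z - q * z) := by ring
  rw [e]
  refine h.trans_eq ?_
  rw [← sub_mul, norm_mul, norm_mul, norm_mul, Complex.norm_real, Real.norm_of_nonneg hz.le]
  ring

theorem integrable_levyExp (hν : IsJumpMeasure ν) {p : ℂ} (hp : p.re ≤ 0) :
    Integrable (fun z : ℝ => Complex.exp (p * z) - 1 - p * z) ν := by
  refine Integrable.mono' (hν.integrable_sq.const_mul (‖p‖ * ‖p‖)) ?_ ?_
  · exact (by fun_prop : Continuous fun z : ℝ => Complex.exp (p * z) - 1 - p * z).aestronglyMeasurable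
  · filter_upwards [hν.ae_norm_sub_le hp (q := 0) (by simp)] with z hz
    simpa using hz

theorem levyExp_zero (ν : Measure ℝ) : levyExp ν 0 = 0 := by simp [levyExp]

theorem norm_levyExp_sub_le (hν : IsJumpMeasure ν) {p q : ℂ} (hp : p.re ≤ 0) (hq : q.re ≤ 0) :
    ‖levyExp ν p - levyExp ν q‖ ≤ (∫ z, z ^ 2 ∂ν) * (‖p‖ + ‖q‖) * ‖p - q‖ := by
  rw [levyExp, levyExp, ← integral_sub (hν.integrable_levyExp hp) (hν.integrable_levyExp hq)]
  refine (norm_integral_le_of_norm_le (hν.integrable_sq.const_mul _)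
    (hν.ae_norm_sub_le hp hq)).trans_eq ?_
  rw [integral_const_mul]; ring

theorem norm_levyExp_le (hν : IsJumpMeasure ν) {p : ℂ} (hp : p.re ≤ 0) :
    ‖levyExp ν p‖ ≤ (∫ z, z ^ 2 ∂ν) * ‖p‖ ^ 2 := by
  have := hν.norm_levyExp_sub_le hp (q := 0) (by simp)
  simp only [levyExp_zero, sub_zero, norm_zero, add_zero] at this
  linarith [this, sq ‖p‖, mul_assoc (∫ z, z ^ 2 ∂ν) ‖p‖ ‖p‖]

/-- Since `exp` is 1-Lipschitz on the left half plane, the exponentials contribute at most `‖p - q‖²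
z` for each jump size `z`, which is exactly what the compensator removes. -/
theorem re_levyExp_sub_le (hν : IsJumpMeasure ν) {p q : ℂ} (hp : p.re ≤ 0) (hq : q.re ≤ 0) :
    (conj (p - q) * (levyExp ν p - levyExp ν q)).re ≤ 0 := by
  rw [levyExp, levyExp, ← integral_sub (hν.integrable_levyExp hp) (hν.integrable_levyExp hq),
    ← integral_const_mul]
  have hi := ((hν.integrable_levyExp hp).sub (hν.integrable_levyExp hq)).const_mul (conj (p - q))
  have := integral_re hi
  simp only [RCLike.re_to_complex, Pi.sub_apply] at this
  rw [← this]
  refine integral_nonpos_of_ae ?_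
  filter_upwards [hν.ae_pos] with z hz
  have h := norm_exp_sub_exp_le (re_mul_nonpos hp hz) (re_mul_nonpos hq hz)
  rw [← sub_mul, norm_mul, Complex.norm_real, Real.norm_of_nonneg hz.le] at h
  have e : conj (p - q) * ((Complex.exp (p * z) - 1 - p * z) - (Complex.exp (q * z) - 1 - q * z))
      = conj (p - q) * (Complex.exp (p * z) - Complex.exp (q * z))
        - (((p - q) * conj (p - q)) * z) := by ring
  rw [e, Complex.mul_conj, Complex.sub_re, ← Complex.ofReal_mul, Complex.ofReal_re,
    Complex.normSq_eq_norm_sq]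
  have h2 := Complex.re_le_norm (conj (p - q) * (Complex.exp (p * z) - Complex.exp (q * z)))
  rw [norm_mul, RCLike.norm_conj] at h2
  have h3 := mul_le_mul_of_nonneg_left h (norm_nonneg (p - q))
  simp only [Pi.zero_apply]
  nlinarith

end IsJumpMeasure

section Coefficients

variable {ν : Measure ℝ} {ρ b c Λ : ℝ}

/-- The jump integrand splits into two compensated exponentials, each integrable on its own, since
the compensators combine to `v z`. -/
theorem F_eq (hν : IsJumpMeasure ν) (hΛ : 0 ≤ Λ) {u v : ℂ} (hu : 0 ≤ u.re) (hv : v.re ≤ 0) :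
    F ρ b c Λ ν u v = (1 / 2) * (u ^ 2 - u) + (b + ρ * Real.sqrt c * u) * v + (c / 2) * v ^ 2
      + (levyExp ν (v - Λ * u) - u * levyExp ν (-Λ)) := by
  have h1 : (v - Λ * u).re ≤ 0 := by
    simp only [Complex.sub_re, Complex.mul_re, Complex.ofReal_re, Complex.ofReal_im, zero_mul,
      sub_zero]
    nlinarith [mul_nonneg hΛ hu]
  have h2 : (-(Λ : ℂ)).re ≤ 0 := by simpa using hΛ
  rw [F, levyExp, levyExp, ← integral_const_mul, ← integral_sub (hν.integrable_levyExp h1)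
    ((hν.integrable_levyExp h2).const_mul u)]
  congr 2; ext z; ring

theorem re_sub_mul_nonpos (hΛ : 0 ≤ Λ) {u v : ℂ} (hu : 0 ≤ u.re) (hv : v.re ≤ 0) :
    (v - Λ * u).re ≤ 0 := by
  simp only [Complex.sub_re, Complex.mul_re, Complex.ofReal_re, Complex.ofReal_im, zero_mul,
    sub_zero]
  nlinarith [mul_nonneg hΛ hu]

theorem norm_F_sub_le (hν : IsJumpMeasure ν) (hc : 0 ≤ c) (hΛ : 0 ≤ Λ) {u v v' : ℂ}
    (hu : 0 ≤ u.re) (hv : v.re ≤ 0) (hv' : v'.re ≤ 0) :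
    ‖F ρ b c Λ ν u v - F ρ b c Λ ν u v'‖ ≤ (|b| + |ρ| * Real.sqrt c * ‖u‖
      + (c / 2 + ∫ z, z ^ 2 ∂ν) * (‖v‖ + ‖v'‖) + 2 * (∫ z, z ^ 2 ∂ν) * Λ * ‖u‖) * ‖v - v'‖ := by
  have hM : 0 ≤ ∫ z, z ^ 2 ∂ν := integral_nonneg fun z => sq_nonneg z
  rw [F_eq hν hΛ hu hv, F_eq hν hΛ hu hv']
  have e : ∀ A J J' : ℂ, (A + (b + ρ * Real.sqrt c * u) * v + (c / 2) * v ^ 2 + (J - u * levyExp ν (-Λ)))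
      - (A + (b + ρ * Real.sqrt c * u) * v' + (c / 2) * v' ^ 2 + (J' - u * levyExp ν (-Λ)))
      = (b + ρ * Real.sqrt c * u) * (v - v') + (c / 2) * (v + v') * (v - v') + (J - J') := by
    intros; ring
  rw [e]
  have h1 : ‖((b : ℂ) + ρ * Real.sqrt c * u) * (v - v')‖
      ≤ (|b| + |ρ| * Real.sqrt c * ‖u‖) * ‖v - v'‖ := by
    rw [norm_mul]
    refine mul_le_mul_of_nonneg_right ((norm_add_le _ _).trans ?_) (norm_nonneg _)
    rw [norm_mul, norm_mul, Complex.norm_real, Complex.norm_real, Complex.norm_real,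
      Real.norm_of_nonneg (Real.sqrt_nonneg c), Real.norm_eq_abs, Real.norm_eq_abs]
  have h2 : ‖((c : ℂ) / 2) * (v + v') * (v - v')‖ ≤ c / 2 * (‖v‖ + ‖v'‖) * ‖v - v'‖ := by
    rw [norm_mul, norm_mul, norm_div, Complex.norm_real, Real.norm_of_nonneg hc,
      show ‖(2 : ℂ)‖ = 2 by simp]
    gcongr
    exact norm_add_le _ _
  have h3 : ‖levyExp ν (v - Λ * u) - levyExp ν (v' - Λ * u)‖
      ≤ (∫ z, z ^ 2 ∂ν) * (‖v‖ + ‖v'‖ + 2 * Λ * ‖u‖) * ‖v - v'‖ := by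
    refine (hν.norm_levyExp_sub_le (re_sub_mul_nonpos hΛ hu hv)
      (re_sub_mul_nonpos hΛ hu hv')).trans ?_
    rw [sub_sub_sub_cancel_right]
    refine mul_le_mul_of_nonneg_right (mul_le_mul_of_nonneg_left ?_ hM) (norm_nonneg _)
    have e1 : ‖(Λ : ℂ) * u‖ = Λ * ‖u‖ := by
      rw [norm_mul, Complex.norm_real, Real.norm_of_nonneg hΛ]
    have := norm_sub_le v (Λ * u)
    have := norm_sub_le v' (Λ * u)
    linarith
  refine (norm_add₃_le).trans ((add_le_add_three h1 h2 h3).trans_eq ?_)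
  ring

/-- After subtraction of `F(u, 0)`, the quadratic term contributes `Re v ≤ 0`, the jump part is
dissipative, and `0 ≤ Re u ≤ 1` bounds the correlation term by the positive part of `ρ`. -/
theorem re_conj_mul_F_le (hν : IsJumpMeasure ν) (hc : 0 ≤ c) (hΛ : 0 ≤ Λ) {u v : ℂ}
    (hu : 0 ≤ u.re) (hu1 : u.re ≤ 1) (hv : v.re ≤ 0) :
    (conj v * F ρ b c Λ ν u v).re
      ≤ (b + max ρ 0 * Real.sqrt c) * ‖v‖ ^ 2 + ‖F ρ b c Λ ν u 0‖ * ‖v‖ := by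
  have hJ := hν.re_levyExp_sub_le (re_sub_mul_nonpos hΛ hu hv)
    (re_sub_mul_nonpos hΛ hu (v := 0) le_rfl)
  rw [sub_sub_sub_cancel_right, sub_zero] at hJ
  have e : conj v * F ρ b c Λ ν u v
      = (b + ρ * Real.sqrt c * u + c / 2 * v) * (v * conj v)
        + conj v * (levyExp ν (v - Λ * u) - levyExp ν (0 - Λ * u)) + conj v * F ρ b c Λ ν u 0 := by
    rw [F_eq hν hΛ hu hv, F_eq hν hΛ hu (v := 0) le_rfl]
    ring
  have h0 : (conj v * F ρ b c Λ ν u 0).re ≤ ‖F ρ b c Λ ν u 0‖ * ‖v‖ := by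
    refine (Complex.re_le_norm _).trans_eq ?_
    rw [norm_mul, RCLike.norm_conj, mul_comm]
  have h1 : (((b : ℂ) + ρ * Real.sqrt c * u + c / 2 * v) * (v * conj v)).re
      ≤ (b + max ρ 0 * Real.sqrt c) * ‖v‖ ^ 2 := by
    rw [Complex.mul_conj, Complex.re_mul_ofReal, Complex.normSq_eq_norm_sq]
    refine mul_le_mul_of_nonneg_right ?_ (sq_nonneg _)
    have e1 : ((b : ℂ) + ρ * Real.sqrt c * u + c / 2 * v).re
        = b + ρ * Real.sqrt c * u.re + c / 2 * v.re := by
      have : ((b : ℂ) + ρ * Real.sqrt c * u + c / 2 * v)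
          = (b : ℂ) + ((ρ * Real.sqrt c : ℝ) : ℂ) * u + ((c / 2 : ℝ) : ℂ) * v := by push_cast; ring
      rw [this]
      simp only [Complex.add_re, Complex.re_ofReal_mul, Complex.ofReal_re]
    rw [e1]
    have h2 : ρ * Real.sqrt c * u.re ≤ max ρ 0 * Real.sqrt c := by
      calc ρ * Real.sqrt c * u.re ≤ (max ρ 0 * Real.sqrt c) * u.re :=
            mul_le_mul_of_nonneg_right
              (mul_le_mul_of_nonneg_right (le_max_left _ _) (Real.sqrt_nonneg _)) hu
        _ ≤ _ := mul_le_of_le_one_right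
              (mul_nonneg (le_max_right _ _) (Real.sqrt_nonneg _)) hu1
    nlinarith [mul_nonpos_of_nonneg_of_nonpos hc hv]
  rw [e, Complex.add_re, Complex.add_re]
  linarith

theorem norm_F_zero_le (hν : IsJumpMeasure ν) (hΛ : 0 ≤ Λ) {u : ℂ} (hu : 0 ≤ u.re) :
    ‖F ρ b c Λ ν u 0‖ ≤ (1 + (∫ z, z ^ 2 ∂ν) * Λ ^ 2) * (‖u‖ ^ 2 + ‖u‖) := by
  have h1 : ‖(1 / 2 : ℂ) * (u ^ 2 - u)‖ ≤ ‖u‖ ^ 2 + ‖u‖ := by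
    have := norm_sub_le (u ^ 2) u
    rw [norm_pow] at this
    rw [norm_mul, show ‖(1 / 2 : ℂ)‖ = 1 / 2 by simp]
    nlinarith [norm_nonneg (u ^ 2 - u)]
  have h2 := hν.norm_levyExp_le (re_sub_mul_nonpos hΛ hu (v := 0) le_rfl)
  rw [zero_sub, norm_neg, norm_mul, Complex.norm_real, Real.norm_of_nonneg hΛ] at h2
  have h3 := hν.norm_levyExp_le (p := -Λ) (by simpa using hΛ)
  rw [norm_neg, Complex.norm_real, Real.norm_of_nonneg hΛ] at h3
  have h4 : ‖u * levyExp ν (-Λ)‖ ≤ ‖u‖ * ((∫ z, z ^ 2 ∂ν) * Λ ^ 2) := by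
    rw [norm_mul]; exact mul_le_mul_of_nonneg_left h3 (norm_nonneg _)
  rw [F_eq hν hΛ hu (v := 0) le_rfl]
  simp only [mul_zero, add_zero, ne_eq, OfNat.ofNat_ne_zero, not_false_eq_true, zero_pow, zero_sub]
  refine (norm_add_le _ _).trans ?_
  have := norm_sub_le (levyExp ν (-(Λ * u))) (u * levyExp ν (-Λ))
  nlinarith

theorem norm_G_sub_le (hν : IsJumpMeasure ν) (hc : 0 ≤ c) {v v' : ℂ} (hv : v.re ≤ 0)
    (hv' : v'.re ≤ 0) :
    ‖G b c ν v - G b c ν v'‖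
      ≤ (|b| + (c / 2 + ∫ z, z ^ 2 ∂ν) * (‖v‖ + ‖v'‖)) * ‖v - v'‖ := by
  have e : G b c ν v - G b c ν v'
      = b * (v - v') + (c / 2) * (v + v') * (v - v') + (levyExp ν v - levyExp ν v') := by
    rw [G, G, levyExp, levyExp]; ring
  have h1 : ‖(b : ℂ) * (v - v')‖ = |b| * ‖v - v'‖ := by
    rw [norm_mul, Complex.norm_real, Real.norm_eq_abs]
  have h2 : ‖((c : ℂ) / 2) * (v + v') * (v - v')‖ ≤ c / 2 * (‖v‖ + ‖v'‖) * ‖v - v'‖ := by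
    rw [norm_mul, norm_mul, norm_div, Complex.norm_real, Real.norm_of_nonneg hc,
      show ‖(2 : ℂ)‖ = 2 by simp]
    gcongr
    exact norm_add_le _ _
  rw [e]
  refine (norm_add₃_le).trans ((add_le_add_three h1.le h2 (hν.norm_levyExp_sub_le hv hv')).trans_eq ?_)
  ring

theorem G_zero : G b c ν 0 = 0 := by simp [G]

theorem re_conj_mul_G_le (hν : IsJumpMeasure ν) (hc : 0 ≤ c) {v : ℂ} (hv : v.re ≤ 0) :
    (conj v * G b c ν v).re ≤ b * ‖v‖ ^ 2 := by
  have hJ := hν.re_levyExp_sub_le hv (q := 0) (by simp)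
  rw [sub_zero, IsJumpMeasure.levyExp_zero, sub_zero] at hJ
  have e : conj v * G b c ν v
      = ((b : ℂ) + ((c / 2 : ℝ) : ℂ) * v) * (v * conj v) + conj v * levyExp ν v := by
    rw [G, levyExp]; push_cast; ring
  rw [e, Complex.add_re, Complex.mul_conj, Complex.re_mul_ofReal, Complex.normSq_eq_norm_sq,
    Complex.add_re, Complex.re_ofReal_mul, Complex.ofReal_re]
  nlinarith [mul_nonneg (mul_nonneg hc (neg_nonneg.2 hv)) (sq_nonneg ‖v‖)]

end Coefficients

/-- Composition with a map that is Lipschitz on bounded subsets of the left half plane. -/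
theorem continuousOn_comp_of_lipschitz {H : ℂ → ℂ} {A B : ℝ}
    (hH : ∀ v v' : ℂ, v.re ≤ 0 → v'.re ≤ 0 → ‖H v - H v'‖ ≤ (A + B * (‖v‖ + ‖v'‖)) * ‖v - v'‖)
    {S : Set ℝ} {χ : ℝ → ℂ} (hχ : ContinuousOn χ S) (hre : ∀ t ∈ S, (χ t).re ≤ 0) :
    ContinuousOn (fun t => H (χ t)) S := by
  intro t ht
  have h1 : Tendsto (fun s => (A + B * (‖χ s‖ + ‖χ t‖)) * ‖χ s - χ t‖) (𝓝[S] t) (𝓝 0) := by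
    have h2 : ContinuousWithinAt (fun s => (A + B * (‖χ s‖ + ‖χ t‖)) * ‖χ s - χ t‖) S t :=
      (continuousWithinAt_const.add (continuousWithinAt_const.mul
        ((hχ t ht).norm.add continuousWithinAt_const))).mul
        ((hχ t ht).sub continuousWithinAt_const).norm
    have := h2.tendsto
    simpa using this
  rw [ContinuousWithinAt, tendsto_iff_norm_sub_tendsto_zero]
  refine squeeze_zero' (Eventually.of_forall fun _ => norm_nonneg _) ?_ h1
  filter_upwards [self_mem_nhdsWithin] with s hs using hH _ _ (hre s hs) (hre t ht)

end RoughHawkesHeston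

/-! ### Subadditivity of the integrated resolvent and stability of Volterra equations. -/

namespace RoughHawkesHeston

open scoped Topology ComplexConjugate

/-- A convolution restarted at time `s` sees its past through `k (t + r)`. This is the shape of the
forcing in the equation for `φ`. -/
theorem conv_add_time {E : Type*} [NormedAddCommGroup E] [NormedSpace ℝ E] {k : ℝ → ℝ}
    {f : ℝ → E} {s t : ℝ} (hs : 0 ≤ s) (ht : 0 ≤ t) (hk : IntegrableOn k (Ioc 0 (s + t)))
    (hf : BddMeasOn f (s + t)) :
    IntervalIntegrable (fun r => k (t + r) • f (s - r)) volume 0 s ∧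
    conv k f (s + t) = conv k (fun r => f (s + r)) t + ∫ r in (0 : ℝ)..s, k (t + r) • f (s - r) := by
  have hst : 0 ≤ s + t := add_nonneg hs ht
  have i : IntervalIntegrable (fun r => k r • f (s + t - r)) volume 0 (s + t) := by
    have := (convIntegrable hst hk hf).comp_sub_left (s + t)
    simpa using this.symm
  have hmem : t ∈ uIcc 0 (s + t) := by rw [uIcc_of_le hst]; exact ⟨ht, by linarith⟩
  have i1 := i.mono_set (uIcc_subset_uIcc left_mem_uIcc hmem)
  have i2 := i.mono_set (uIcc_subset_uIcc hmem right_mem_uIcc)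
  constructor
  · have := i2.comp_add_left t
    simp only [sub_self, add_sub_cancel_right] at this
    refine this.congr fun r _ => ?_
    congr 2; ring
  · rw [conv_swap, ← intervalIntegral.integral_add_adjacent_intervals i1 i2, conv_swap]
    congr 1
    · congr 1; ext r; congr 2; ring
    · have := intervalIntegral.integral_comp_add_left (a := 0) (b := s)
        (fun r => k r • f (s + t - r)) t
      rw [add_zero, add_comm t s] at this
      rw [← this]
      congr 1; ext r; congr 2; ring

namespace IsMonotoneKernel

variable {k : ℝ → ℝ}

theorem continuousOn_intResolvent_add (hk : IsMonotoneKernel k) (lam : ℝ) {s : ℝ} (hs : 0 ≤ s)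
    (t : ℝ) : ContinuousOn (fun r => intResolvent lam k (s + r)) (Icc 0 t) :=
  (hk.continuousOn_intResolvent lam (s + t)).comp (by fun_prop)
    fun r hr => ⟨by linarith [hr.1], by linarith [hr.2]⟩

/-- A comparison form of Gronwall's inequality, in terms of the integrated resolvent. -/
theorem le_of_le_conv (hk : IsMonotoneKernel k) {lam T f : ℝ} {u : ℝ → ℝ} (hlam : 0 ≤ lam)
    (hu : ContinuousOn u (Icc 0 T)) (h : ∀ t ∈ Icc 0 T, u t ≤ f + lam * conv k u t) :
    ∀ t ∈ Icc 0 T, u t ≤ f * (1 + lam * intResolvent lam k t) := by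
  intro t ht
  have hc : ContinuousOn (fun s => f * (1 + lam * intResolvent lam k s)) (Icc 0 T) :=
    continuousOn_const.mul (continuousOn_const.add
      (continuousOn_const.mul (hk.continuousOn_intResolvent lam T)))
  have := hk.gronwall (u := fun s => u s - f * (1 + lam * intResolvent lam k s)) hlam
    (hu.sub hc) (fun s hs => ?_) t ht
  · linarith
  · rw [conv_sub hs.1 (hk.integrableOn s)
      (BddMeasOn.of_continuousOn (hu.mono (Icc_subset_Icc_right hs.2)))
      (BddMeasOn.of_continuousOn (hc.mono (Icc_subset_Icc_right hs.2))), conv_const_mul,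
      ← hk.intResolvent_eq_conv lam hs.1]
    have := h s hs
    linarith

/-- In other words, `1 + lam * e` is submultiplicative. As `k` is nonincreasing, the contribution of
the past to `e (s + r)` is at most `e s`; Gronwall's inequality handles the rest. It extends bounds
on `[0, max T δ]` to `[0, T + δ]`. -/
theorem intResolvent_add_le (hk : IsMonotoneKernel k) {lam s t : ℝ} (hlam : 0 ≤ lam) (hs : 0 ≤ s)
    (ht : 0 ≤ t) : intResolvent lam k (s + t)
      ≤ intResolvent lam k s + (1 + lam * intResolvent lam k s) * intResolvent lam k t := by
  set e := intResolvent lam k with he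
  have hes : 0 ≤ e s := hk.intResolvent_nonneg hlam hs
  have hstep : ∀ r ∈ Icc 0 t, e (s + r) ≤ e s + conv k (fun x => 1 + lam * e (s + x)) r := by
    intro r hr
    have hsr : 0 ≤ s + r := add_nonneg hs hr.1
    have hb : BddMeasOn (fun x => 1 + lam * e x) (s + r) :=
      (BddMeasOn.const 1).add ((hk.bddMeasOn_intResolvent lam _).const_mul lam)
    obtain ⟨i1, e1⟩ := conv_add_time hs hr.1 (hk.integrableOn _) hb
    have i2 : IntervalIntegrable (fun x => k x • (1 + lam * e (s - x))) volume 0 s := by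
      have := (convIntegrable hs (hk.integrableOn s) (hb.mono (by linarith [hr.1]))).comp_sub_left s
      simpa using this.symm
    have h2 : ∫ x in (0 : ℝ)..s, k (r + x) • (1 + lam * e (s - x)) ≤ e s := by
      rw [he, hk.intResolvent_eq_conv lam hs, conv_swap]
      refine intervalIntegral.integral_mono_on_of_le_Ioo hs i1 i2 fun x hx => ?_
      have h3 : 0 ≤ 1 + lam * e (s - x) := by
        have := mul_nonneg hlam (hk.intResolvent_nonneg hlam (sub_nonneg.2 hx.2.le))
        linarith
      exact mul_le_mul_of_nonneg_right (hk.antitone hx.1 (mem_Ioi.2 (by linarith [hx.1, hr.1]))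
        (by linarith [hr.1])) h3
    have h4 : e (s + r) = conv k (fun x => 1 + lam * e x) (s + r) :=
      hk.intResolvent_eq_conv lam hsr
    rw [h4, e1]
    linarith
  have hcont : ∀ r, ContinuousOn (fun x => e (s + x)) (Icc 0 r) := fun r =>
    hk.continuousOn_intResolvent_add lam hs r
  have hc2 : ContinuousOn (fun r => (1 + lam * e s) * e r) (Icc 0 t) :=
    continuousOn_const.mul (hk.continuousOn_intResolvent lam t)
  have := hk.gronwall (T := t)
    (u := fun r => (e (s + r) - e s) - (1 + lam * e s) * e r) hlam
    (((hcont t).sub continuousOn_const).sub hc2) (fun r hr => ?_) t ⟨ht, le_rfl⟩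
  · linarith
  · have b1 : BddMeasOn (fun x => e (s + x)) r := BddMeasOn.of_continuousOn (hcont r)
    have b2 : BddMeasOn (fun x => (1 + lam * e s) * e x) r :=
      (hk.bddMeasOn_intResolvent lam r).const_mul _
    have hI := hk.integrableOn r
    have h1 := hstep r hr
    rw [conv_add hr.1 hI (BddMeasOn.const 1) (b1.const_mul lam), conv_one, conv_const_mul] at h1
    have c1 : conv k (fun _ => e s) r = e s * ∫ x in (0 : ℝ)..r, k x := by
      have := conv_const_mul k (fun _ => (1 : ℝ)) (e s) r
      simp only [mul_one] at this
      rw [this, conv_one]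
    rw [conv_sub hr.1 hI (b1.sub (BddMeasOn.const (e s))) b2, conv_const_mul,
      conv_sub hr.1 hI b1 (BddMeasOn.const (e s)), c1]
    have h2 : e r = _ := hk.intResolvent_eq_add lam hr.1
    rw [← he] at h2
    generalize conv k e r = X at *
    generalize conv k (fun x => e (s + x)) r = Z at *
    generalize (∫ x in (0 : ℝ)..r, k x) = I at *
    rw [h2]
    nlinarith

end IsMonotoneKernel

theorem conv_kernel_sub {E : Type*} [NormedAddCommGroup E] [NormedSpace ℝ E] {k k' : ℝ → ℝ}
    {f : ℝ → E} {t : ℝ} (ht : 0 ≤ t) (hk : IntegrableOn k (Ioc 0 t))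
    (hk' : IntegrableOn k' (Ioc 0 t)) (hf : BddMeasOn f t) :
    conv (fun s => k s - k' s) f t = conv k f t - conv k' f t := by
  simp only [conv, sub_smul]
  exact intervalIntegral.integral_sub (convIntegrable ht hk hf) (convIntegrable ht hk' hf)

/-- Stability of a Volterra equation under a perturbation of its kernel and of its forcing. -/
theorem norm_sub_le_of_volterra {K k : ℝ → ℝ} (hK : IsMonotoneKernel K) (hk : IsMonotoneKernel k)
    {T ℓ A P : ℝ} {χ χ' p p' g g' : ℝ → ℂ} (hℓ : 0 ≤ ℓ)
    (hχ : ContinuousOn χ (Icc 0 T)) (hχ' : ContinuousOn χ' (Icc 0 T))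
    (hg : ContinuousOn g (Icc 0 T)) (hg' : ContinuousOn g' (Icc 0 T))
    (heq : ∀ t ∈ Icc 0 T, χ t = p t + conv K g t) (heq' : ∀ t ∈ Icc 0 T, χ' t = p' t + conv k g' t)
    (hp : ∀ t ∈ Icc 0 T, ‖p t - p' t‖ ≤ P) (hA : ∀ t ∈ Icc 0 T, ‖g' t‖ ≤ A)
    (hgg : ∀ t ∈ Icc 0 T, ‖g t - g' t‖ ≤ ℓ * ‖χ t - χ' t‖) :
    ∀ t ∈ Icc 0 T, ‖χ t - χ' t‖
      ≤ (P + (∫ s in (0 : ℝ)..T, |k s - K s|) * A) * (1 + ℓ * intResolvent ℓ K t) := by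
  refine hK.le_of_le_conv hℓ (hχ.sub hχ').norm fun t ht => ?_
  have hT : 0 ≤ T := ht.1.trans ht.2
  have hsub : Icc 0 t ⊆ Icc 0 T := Icc_subset_Icc_right ht.2
  have bg := BddMeasOn.of_continuousOn (hg.mono hsub)
  have bg' := BddMeasOn.of_continuousOn (hg'.mono hsub)
  have hA0 : 0 ≤ A := (norm_nonneg _).trans (hA t ht)
  -- The difference of the nonlinearities is paired with `K`, so the Gronwall factor involves the
  -- resolvent of `K` alone, and the kernel error meets only `g'`.
  have e : χ t - χ' t = (p t - p' t) + conv K (fun s => g s - g' s) t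
      - conv (fun s => k s - K s) g' t := by
    rw [heq t ht, heq' t ht, conv_sub ht.1 (hK.integrableOn t) bg bg',
      conv_kernel_sub ht.1 (hk.integrableOn t) (hK.integrableOn t) bg']
    ring
  have h1 : ‖conv K (fun s => g s - g' s) t‖ ≤ ℓ * conv K (fun s => ‖χ s - χ' s‖) t := by
    rw [← conv_const_mul]
    refine (norm_conv_le ht.1 (hK.integrableOn t) hK.nonneg (bg.sub bg')).trans ?_
    exact conv_mono ht.1 (hK.integrableOn t) hK.nonneg (bg.sub bg').norm
      (BddMeasOn.of_continuousOn (continuousOn_const.mul ((hχ.sub hχ').norm.mono hsub)))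
      fun s hs => hgg s ⟨hs.1.le, hs.2.le.trans ht.2⟩
  have hI : ∀ x, 0 ≤ x → IntervalIntegrable (fun s => |k s - K s|) volume 0 x := fun x hx =>
    ((hk.intervalIntegrable le_rfl hx).sub (hK.intervalIntegrable le_rfl hx)).abs
  have h2 : ‖conv (fun s => k s - K s) g' t‖ ≤ (∫ s in (0 : ℝ)..T, |k s - K s|) * A := by
    refine (norm_conv_le_const ht.1 ((hk.integrableOn t).sub (hK.integrableOn t))
      fun s hs => hA s ⟨hs.1.le, hs.2.trans ht.2⟩).trans (mul_le_mul_of_nonneg_right ?_ hA0)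
    exact intervalIntegral.integral_mono_interval le_rfl ht.1 ht.2
      (ae_of_all _ fun s => abs_nonneg _) (hI T hT)
  rw [e]
  refine (norm_sub_le _ _).trans ((add_le_add (norm_add_le _ _) le_rfl).trans ?_)
  have := hp t ht
  linarith

/-- The stability estimate with polynomial weights in the parameter `y`. -/
theorem norm_sub_le_of_weights {K k : ℝ → ℝ} (hK : IsAdmissibleKernel K) (hk : IsMonotoneKernel k)
    {T ℓ A P N y C : ℝ} {χ χ' p p' g g' : ℝ → ℂ} (hT : 0 < T) (hℓ : 0 ≤ ℓ) (hA0 : 0 ≤ A)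
    (hP : 0 ≤ P)
    (hχ : ContinuousOn χ (Icc 0 T)) (hχ' : ContinuousOn χ' (Icc 0 T))
    (hg : ContinuousOn g (Icc 0 T)) (hg' : ContinuousOn g' (Icc 0 T))
    (heq : ∀ t ∈ Icc 0 T, χ t = p t + conv K g t) (heq' : ∀ t ∈ Icc 0 T, χ' t = p' t + conv k g' t)
    (hN : ∫ s in (0 : ℝ)..T, |k s - K s| ≤ N)
    (hp : ∀ t ∈ Icc 0 T, ‖p t - p' t‖ ≤ P * (1 + y ^ 2) ^ 2 * N)
    (hA : ∀ t ∈ Icc 0 T, ‖g' t‖ ≤ A * (1 + y ^ 2) ^ 2)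
    (hgg : ∀ t ∈ Icc 0 T, ‖g t - g' t‖ ≤ ℓ * (1 + y ^ 2) * ‖χ t - χ' t‖)
    (hC : 4 * (P + A) * ((∫ s in (0 : ℝ)..T, K s)⁻¹ + ℓ) + ℓ + 1 ≤ C) :
    ∀ t ∈ Icc 0 T, ‖χ t - χ' t‖ ≤ C * (1 + y ^ 6)
      * (∫ s in (0 : ℝ)..T, canonicalResolvent (C * (1 + y ^ 2)) K s) * N := by
  intro t ht
  have hKm := hK.isMonotoneKernel
  set Q := 1 + y ^ 2 with hQ
  have hQ1 : 1 ≤ Q := by nlinarith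
  have hQ0 : 0 ≤ Q := by linarith
  set κ := ∫ s in (0 : ℝ)..T, K s with hκ
  have hκ0 : 0 < κ := hK.integral_pos hT
  have hκi : 0 < κ⁻¹ := inv_pos.2 hκ0
  have hℓQ : 0 ≤ ℓ * Q := mul_nonneg hℓ hQ0
  have hX : 0 ≤ 4 * (P + A) * (κ⁻¹ + ℓ) := by positivity
  have hN0 : 0 ≤ N := (intervalIntegral.integral_nonneg hT.le fun s _ => abs_nonneg _).trans hN
  have h := norm_sub_le_of_volterra hKm hk hℓQ hχ hχ' hg hg' heq heq' hp hA hgg t ht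
  set e := intResolvent (C * Q) K T with he
  have he1 : intResolvent (ℓ * Q) K t ≤ e :=
    (hKm.intResolvent_mono hℓQ ht.1 ht.2).trans
      (hKm.intResolvent_mono_param hℓQ (mul_le_mul_of_nonneg_right (by linarith) hQ0) hT.le)
  have he2 : κ ≤ e := hKm.integral_le_intResolvent
    (mul_nonneg (by linarith) hQ0) hT.le
  have he0 : 0 ≤ e := hκ0.le.trans he2
  -- This absorbs the `1` of the Gronwall factor into a multiple of `e` and is the source of `κ⁻¹`
  -- in the constant.
  have he3 : 1 ≤ κ⁻¹ * e := by
    rw [inv_mul_eq_div, le_div_iff₀ hκ0]; linarith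
  have hf : P * Q ^ 2 * N + (∫ s in (0 : ℝ)..T, |k s - K s|) * (A * Q ^ 2)
      ≤ (P + A) * Q ^ 2 * N := by
    have := mul_le_mul_of_nonneg_right hN (mul_nonneg hA0 (sq_nonneg Q))
    linarith
  have hg1 : 1 + ℓ * Q * intResolvent (ℓ * Q) K t ≤ (κ⁻¹ + ℓ) * Q * e := by
    have h1 := mul_le_mul_of_nonneg_left he1 hℓQ
    have h2 : κ⁻¹ * e ≤ κ⁻¹ * e * Q := le_mul_of_one_le_right (by positivity) hQ1
    linarith
  have hg0 : 0 ≤ 1 + ℓ * Q * intResolvent (ℓ * Q) K t := by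
    have := mul_nonneg hℓQ (hKm.intResolvent_nonneg hℓQ ht.1)
    linarith
  -- `Q²` from the forcing and `Q` from the Gronwall factor; this is the factor `4` in the constant.
  have hQ3 : Q ^ 3 ≤ 4 * (1 + y ^ 6) := by
    have : 4 * (1 + y ^ 6) - Q ^ 3 = 3 * (1 - y ^ 2) ^ 2 * (1 + y ^ 2) := by rw [hQ]; ring
    have h3 : 0 ≤ 3 * (1 - y ^ 2) ^ 2 * (1 + y ^ 2) := by positivity
    linarith
  calc ‖χ t - χ' t‖ ≤ _ := h
    _ ≤ ((P + A) * Q ^ 2 * N) * ((κ⁻¹ + ℓ) * Q * e) :=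
        mul_le_mul hf hg1 hg0 (by positivity)
    _ = ((P + A) * (κ⁻¹ + ℓ)) * Q ^ 3 * (e * N) := by ring
    _ ≤ ((P + A) * (κ⁻¹ + ℓ)) * (4 * (1 + y ^ 6)) * (e * N) := by gcongr
    _ = (4 * (P + A) * (κ⁻¹ + ℓ)) * (1 + y ^ 6) * (e * N) := by ring
    _ ≤ C * (1 + y ^ 6) * (e * N) := by
        have h6 : 0 ≤ 1 + y ^ 6 := by positivity
        exact mul_le_mul_of_nonneg_right (mul_le_mul_of_nonneg_right (by linarith) h6)
          (mul_nonneg he0 hN0)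
    _ = _ := by rw [he, intResolvent]; ring

end RoughHawkesHeston

/-! ### The equation for `ψ`. -/

namespace RoughHawkesHeston

open scoped Topology ComplexConjugate

variable {ρ b c Λ : ℝ} {ν : Measure ℝ}

/-- The constant that the stability estimate produces from a bound `A` for the nonlinearity, a
Lipschitz constant `ℓ`, and the mass `κ` of the kernel. -/
noncomputable def stabilityConst (A ℓ κ : ℝ) : ℝ := 4 * A * (|κ|⁻¹ + ℓ) + ℓ + 1

/-- The absolute value in `stabilityConst` gives positivity for every real `κ`, as the second claim
asks of its constant; at `κ = 0` the inverse is `0`. -/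
theorem stabilityConst_pos {A ℓ : ℝ} (hA : 0 ≤ A) (hℓ : 0 ≤ ℓ) (κ : ℝ) :
    0 < stabilityConst A ℓ κ := by
  unfold stabilityConst
  positivity

/-- A bound for `F(w, 0)` relative to `1 + (Im w)²`. -/
noncomputable def zeroConst (Λ : ℝ) (ν : Measure ℝ) : ℝ := 2 * (1 + (∫ z, z ^ 2 ∂ν) * Λ ^ 2)

/-- A Lipschitz constant of `F(w, ·)`, relative to `1 + (Im w)²`, on the ball of radius
`D (1 + (Im w)²)`. -/
noncomputable def lipConst (ρ b c Λ : ℝ) (ν : Measure ℝ) (D : ℝ) : ℝ :=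
  |b| + |ρ| * Real.sqrt c + (c + 2 * ∫ z, z ^ 2 ∂ν) * D + 2 * (∫ z, z ^ 2 ∂ν) * Λ

theorem integral_sq_nonneg (ν : Measure ℝ) : 0 ≤ ∫ z, z ^ 2 ∂ν := by
  positivity

theorem zeroConst_pos (Λ : ℝ) (ν : Measure ℝ) : 0 < zeroConst Λ ν := by
  have := integral_sq_nonneg ν
  unfold zeroConst
  positivity

theorem lipConst_nonneg (hc : 0 ≤ c) (hΛ : 0 ≤ Λ) {D : ℝ} (hD : 0 ≤ D) :
    0 ≤ lipConst ρ b c Λ ν D := by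
  have := integral_sq_nonneg ν
  unfold lipConst
  positivity

theorem norm_le_one_add_im_sq {w : ℂ} (h0 : 0 ≤ w.re) (h1 : w.re ≤ 1) :
    ‖w‖ ≤ 1 + |w.im| ^ 2 ∧ ‖w‖ ^ 2 ≤ 1 + |w.im| ^ 2 := by
  have h : ‖w‖ ^ 2 = w.re ^ 2 + w.im ^ 2 := by
    rw [← Complex.normSq_eq_norm_sq, Complex.normSq_apply]; ring
  rw [sq_abs]
  constructor <;> nlinarith [norm_nonneg w, sq_nonneg (‖w‖ - 1)]

theorem norm_F_zero_le_zeroConst (hν : IsJumpMeasure ν) (hΛ : 0 ≤ Λ) {w : ℂ} (h0 : 0 ≤ w.re)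
    (h1 : w.re ≤ 1) : ‖F ρ b c Λ ν w 0‖ ≤ zeroConst Λ ν * (1 + |w.im| ^ 2) := by
  have := integral_sq_nonneg ν
  obtain ⟨h2, h3⟩ := norm_le_one_add_im_sq h0 h1
  refine (norm_F_zero_le hν hΛ h0).trans ?_
  unfold zeroConst
  have : 0 ≤ 1 + (∫ z, z ^ 2 ∂ν) * Λ ^ 2 := by positivity
  nlinarith

theorem norm_F_sub_le_lipConst (hν : IsJumpMeasure ν) (hc : 0 ≤ c) (hΛ : 0 ≤ Λ) {w v v' : ℂ}
    (h0 : 0 ≤ w.re) (h1 : w.re ≤ 1) (hv : v.re ≤ 0) (hv' : v'.re ≤ 0) {D : ℝ}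
    (hD : ‖v‖ ≤ D * (1 + |w.im| ^ 2)) (hD' : ‖v'‖ ≤ D * (1 + |w.im| ^ 2)) :
    ‖F ρ b c Λ ν w v - F ρ b c Λ ν w v'‖
      ≤ lipConst ρ b c Λ ν D * (1 + |w.im| ^ 2) * ‖v - v'‖ := by
  have hM := integral_sq_nonneg ν
  obtain ⟨h2, -⟩ := norm_le_one_add_im_sq h0 h1
  refine (norm_F_sub_le hν hc hΛ h0 hv hv').trans (mul_le_mul_of_nonneg_right ?_ (norm_nonneg _))
  have hQ : 1 ≤ 1 + |w.im| ^ 2 := by nlinarith [sq_nonneg |w.im|]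
  generalize 1 + |w.im| ^ 2 = Q at *
  have e1 := mul_le_mul_of_nonneg_left hQ (abs_nonneg b)
  have e2 := mul_le_mul_of_nonneg_left h2 (mul_nonneg (abs_nonneg ρ) (Real.sqrt_nonneg c))
  have e3 := mul_le_mul_of_nonneg_left (add_le_add hD hD')
    (add_nonneg (div_nonneg hc zero_le_two) hM)
  have e4 := mul_le_mul_of_nonneg_left h2 (mul_nonneg (mul_nonneg zero_le_two hM) hΛ)
  unfold lipConst
  linarith

namespace IsPsi

variable {k : ℝ → ℝ} {w : ℂ} {ψ : ℝ → ℂ}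

theorem continuousOn_F (h : IsPsi ρ b c Λ ν k w ψ) (hν : IsJumpMeasure ν) (hc : 0 ≤ c)
    (hΛ : 0 ≤ Λ) (h0 : 0 ≤ w.re) : ContinuousOn (fun s => F ρ b c Λ ν w (ψ s)) (Ici 0) :=
  continuousOn_comp_of_lipschitz
    (A := |b| + |ρ| * Real.sqrt c * ‖w‖ + 2 * (∫ z, z ^ 2 ∂ν) * Λ * ‖w‖)
    (B := c / 2 + ∫ z, z ^ 2 ∂ν)
    (fun _ _ hv hv' => (norm_F_sub_le hν hc hΛ h0 hv hv').trans_eq (by ring))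
    h.continuousOn h.re_nonpos

/-- The kernel enters only through its integrated resolvent, and not at all when `lam < 0`; this is
why the bound can be uniform over the approximations. -/
theorem norm_le (h : IsPsi ρ b c Λ ν k w ψ) (hk : IsMonotoneKernel k) (hν : IsJumpMeasure ν)
    (hc : 0 ≤ c) (hΛ : 0 ≤ Λ) (h0 : 0 ≤ w.re) (h1 : w.re ≤ 1) {lam : ℝ}
    (hlam : b + max ρ 0 * Real.sqrt c = lam) (T : ℝ) :
    (lam < 0 → ∀ t ∈ Icc 0 T, ‖ψ t‖ ≤ zeroConst Λ ν * (1 + |w.im| ^ 2) / (-lam)) ∧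
    (0 ≤ lam → ∀ t ∈ Icc 0 T,
      ‖ψ t‖ ≤ zeroConst Λ ν * (1 + |w.im| ^ 2) * intResolvent lam k t) := by
  have hF := h.continuousOn_F hν hc hΛ h0
  have ha : 0 < zeroConst Λ ν * (1 + |w.im| ^ 2) := mul_pos (zeroConst_pos Λ ν) (by positivity)
  have hg : BddMeasOn (fun s => F ρ b c Λ ν w (ψ s)) T :=
    BddMeasOn.of_continuousOn (hF.mono Icc_subset_Ici_self)
  have hgc : ∀ t ∈ Ioc 0 T, ContinuousWithinAt (fun s => F ρ b c Λ ν w (ψ s)) (Iic t) t :=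
    fun t ht => (hF.continuousAt (Ici_mem_nhds ht.1)).continuousWithinAt
  have hχ : ContinuousOn ψ (Icc 0 T) := h.continuousOn.mono Icc_subset_Ici_self
  have hd : ∀ t ∈ Ioc 0 T, (conj (ψ t) * F ρ b c Λ ν w (ψ t)).re
      ≤ lam * ‖ψ t‖ ^ 2 + zeroConst Λ ν * (1 + |w.im| ^ 2) * ‖ψ t‖ := fun t ht => by
    refine (re_conj_mul_F_le hν hc hΛ h0 h1 (h.re_nonpos t ht.1.le)).trans ?_
    rw [hlam]
    have := mul_le_mul_of_nonneg_right (norm_F_zero_le_zeroConst (ρ := ρ) (b := b) (c := c)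
      hν hΛ h0 h1) (norm_nonneg (ψ t))
    linarith
  exact ⟨fun hn => hk.norm_le_of_neg hn ha.le hχ hg hgc (fun t ht => h.eq t ht.1) hd,
    fun hn => hk.norm_le_of_nonneg hn ha (hk.continuousOn_intResolvent lam T)
      (fun t ht => hk.intResolvent_nonneg hn ht.1) (fun t ht => hk.intResolvent_eq_conv lam ht.1)
      hχ hg hgc (fun t ht => h.eq t ht.1) hd⟩

theorem norm_sub_le {K : ℝ → ℝ} {ψ' : ℝ → ℂ} (h : IsPsi ρ b c Λ ν K w ψ)
    (h' : IsPsi ρ b c Λ ν k w ψ') (hK : IsAdmissibleKernel K) (hk : IsMonotoneKernel k)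
    (hν : IsJumpMeasure ν) (hc : 0 ≤ c) (hΛ : 0 ≤ Λ) (h0 : 0 ≤ w.re) (h1 : w.re ≤ 1) {T D C : ℝ}
    (hT : 0 < T) (hD0 : 0 ≤ D)
    (hD : ∀ t ∈ Icc 0 T, ‖ψ t‖ ≤ D * (1 + |w.im| ^ 2))
    (hD' : ∀ t ∈ Icc 0 T, ‖ψ' t‖ ≤ D * (1 + |w.im| ^ 2))
    (hC : stabilityConst (zeroConst Λ ν + lipConst ρ b c Λ ν D * D) (lipConst ρ b c Λ ν D)
      (∫ s in (0 : ℝ)..T, K s) = C) :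
    ∀ t ∈ Icc 0 T, ‖ψ t - ψ' t‖ ≤ C * (1 + |w.im| ^ 6)
      * (∫ s in (0 : ℝ)..T, canonicalResolvent (C * (1 + |w.im| ^ 2)) K s)
      * ∫ s in (0 : ℝ)..T, |k s - K s| := by
  have hl := lipConst_nonneg (ρ := ρ) (b := b) (ν := ν) hc hΛ hD0
  have ha := (zeroConst_pos Λ ν).le
  refine norm_sub_le_of_weights hK hk (A := zeroConst Λ ν + lipConst ρ b c Λ ν D * D) (P := 0)
    (p := 0) (p' := 0) hT hl (by positivity) le_rfl
    (h.continuousOn.mono Icc_subset_Ici_self) (h'.continuousOn.mono Icc_subset_Ici_self)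
    ((h.continuousOn_F hν hc hΛ h0).mono Icc_subset_Ici_self)
    ((h'.continuousOn_F hν hc hΛ h0).mono Icc_subset_Ici_self)
    (fun t ht => by simpa using h.eq t ht.1) (fun t ht => by simpa using h'.eq t ht.1)
    le_rfl (fun t _ => by simp) (fun t ht => ?_) (fun t ht => ?_) ?_
  -- Comparison with `F(w, 0)`: the value at `0` costs `zeroConst * Q ≤ zeroConst * Q²`, and the
  -- Lipschitz bound times the size of `ψ'` costs `lipConst * D * Q²`.
  · have e1 := norm_F_sub_le_lipConst (ρ := ρ) (b := b) hν hc hΛ h0 h1 (h'.re_nonpos t ht.1)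
      (v' := 0) (by simp) (hD' t ht) (by simpa using mul_nonneg hD0 (by positivity))
    have e2 := norm_F_zero_le_zeroConst (ρ := ρ) (b := b) (c := c) hν hΛ h0 h1
    have e3 := norm_le_norm_add_norm_sub' (F ρ b c Λ ν w (ψ' t)) (F ρ b c Λ ν w 0)
    have e4 := hD' t ht
    rw [sub_zero] at e1
    have hQ : 1 ≤ 1 + |w.im| ^ 2 := by nlinarith [sq_nonneg |w.im|]
    generalize 1 + |w.im| ^ 2 = Q at *
    have e5 := mul_le_mul_of_nonneg_left e4 (mul_nonneg hl (zero_le_one.trans hQ))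
    have e6 := mul_le_mul_of_nonneg_left (show Q ≤ Q ^ 2 by nlinarith) ha
    linarith
  · exact norm_F_sub_le_lipConst hν hc hΛ h0 h1 (h.re_nonpos t ht.1) (h'.re_nonpos t ht.1)
      (hD t ht) (hD' t ht)
  · rw [← hC, stabilityConst, abs_of_nonneg (hK.integral_pos hT).le, zero_add]

end IsPsi

end RoughHawkesHeston

/-! ### The equation for `φ`. -/

namespace RoughHawkesHeston

open scoped Topology ComplexConjugate

variable {b c Λ δ : ℝ} {ν : Measure ℝ}

open Classical in
theorem BddMeasOn.ite {E : Type*} [NormedAddCommGroup E] {f g : ℝ → E} {S : ℝ}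
    (hf : ContinuousOn f (Icc 0 δ)) (hg : ContinuousOn g (Icc 0 S)) :
    BddMeasOn (fun τ => if τ ≤ δ then f τ else g (τ - δ)) (δ + S) := by
  have hg' : ContinuousOn (fun τ => g (τ - δ)) (Icc δ (δ + S)) :=
    hg.comp (by fun_prop) fun τ hτ => ⟨by linarith [hτ.1], by linarith [hτ.2]⟩
  constructor
  · have : (fun τ => if τ ≤ δ then f τ else g (τ - δ))
        = (Iic δ).piecewise f (fun τ => g (τ - δ)) := rfl
    rw [this]
    refine AEStronglyMeasurable.piecewise measurableSet_Iic ?_ ?_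
    · rw [Measure.restrict_restrict measurableSet_Iic]
      exact (hf.mono fun τ hτ => ⟨hτ.2.1.le, hτ.1⟩).aestronglyMeasurable
        (measurableSet_Iic.inter measurableSet_Ioc)
    · rw [Measure.restrict_restrict measurableSet_Iic.compl]
      exact (hg'.mono fun τ hτ => ⟨(not_le.1 hτ.1).le, hτ.2.2⟩).aestronglyMeasurable
        (measurableSet_Iic.compl.inter measurableSet_Ioc)
  · obtain ⟨A, hA⟩ := isCompact_Icc.exists_bound_of_continuousOn hf
    obtain ⟨B, hB⟩ := isCompact_Icc.exists_bound_of_continuousOn hg'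
    refine ⟨max A B, fun τ hτ => ?_⟩
    split_ifs with h
    · exact (hA τ ⟨hτ.1.le, h⟩).trans (le_max_left _ _)
    · exact (hB τ ⟨(not_le.1 h).le, hτ.2⟩).trans (le_max_right _ _)

theorem h_of_le (K : ℝ → ℝ) {s : ℝ} (hs : s ≤ δ) : h b Λ ν δ K s
    = -10 ^ 4 * (2 / δ) * cOne Λ ν * (1 + b * intResolvent b K (δ - s)) := by
  rw [h, if_pos hs, conv_one, intResolvent]

theorem IsMonotoneKernel.continuousOn_h {K : ℝ → ℝ} (hK : IsMonotoneKernel K) :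
    ContinuousOn (h b Λ ν δ K) (Icc 0 δ) := by
  have : ContinuousOn (fun s => -10 ^ 4 * (2 / δ) * cOne Λ ν
      * (1 + b * intResolvent b K (δ - s))) (Icc 0 δ) :=
    continuousOn_const.mul (continuousOn_const.add (continuousOn_const.mul
      ((hK.continuousOn_intResolvent b δ).comp (by fun_prop)
        fun s hs => ⟨by linarith [hs.2], by linarith [hs.1]⟩)))
  exact this.congr fun s hs => h_of_le K hs.2

theorem integral_h_eq (hδ : 0 ≤ δ) (K k : ℝ → ℝ) (w : ℂ) (t : ℝ) :
    ∫ s in Ioi (0 : ℝ), (w * (h b Λ ν δ K s : ℂ)) * (k (s + t) : ℂ)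
      = ∫ s in (0 : ℝ)..δ, k (t + s) • (w * (h b Λ ν δ K s : ℂ)) := by
  rw [intervalIntegral.integral_of_le hδ,
    setIntegral_eq_of_subset_of_forall_sdiff_eq_zero measurableSet_Ioi Ioc_subset_Ioi_self]
  · congr 1
    ext s
    rw [Complex.real_smul, add_comm t s, mul_comm]
  · intro s hs
    have : ¬ s ≤ δ := fun h => hs.2 ⟨hs.1, h⟩
    simp [h, this]

namespace IsPhi

variable {K k : ℝ → ℝ} {w : ℂ} {φ : ℝ → ℂ}

theorem continuousOn_G (h : IsPhi b c Λ ν δ K k w φ) (hν : IsJumpMeasure ν) (hc : 0 ≤ c) :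
    ContinuousOn (fun s => G b c ν (φ s)) (Ici 0) :=
  continuousOn_comp_of_lipschitz (A := |b|) (B := c / 2 + ∫ z, z ^ 2 ∂ν)
    (fun _ _ hv hv' => norm_G_sub_le hν hc hv hv') h.continuousOn h.re_nonpos

theorem eq_interval (h : IsPhi b c Λ ν δ K k w φ) (hδ : 0 ≤ δ) {t : ℝ} (ht : 0 ≤ t) :
    φ t = (∫ s in (0 : ℝ)..δ, k (t + s) • (w * (RoughHawkesHeston.h b Λ ν δ K s : ℂ)))
      + conv k (fun s => G b c ν (φ s)) t := by
  rw [← integral_h_eq hδ, ← h.eq t ht]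

open Classical in
-- Let `g` be `w h(δ - ·)` up to time `δ` and `G(φ(· - δ))` afterwards. Then `φ t = (k * g)(δ + t)`,
-- so the forced equation is the tail of an unforced one. The `+ 1` with `H` keeps the constant
-- strictly positive.
theorem norm_le (h : IsPhi b c Λ ν δ K k w φ) (hK : IsMonotoneKernel K) (hk : IsMonotoneKernel k)
    (hν : IsJumpMeasure ν) (hc : 0 ≤ c) (hδ : 0 < δ) {H : ℝ}
    (hH : ∀ s ∈ Icc 0 δ, |RoughHawkesHeston.h b Λ ν δ K s| ≤ H) {t : ℝ} (ht : 0 ≤ t) :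
    ‖φ t‖ ≤ (1 + ‖w‖) * (H + 1) * intResolvent (max b 0) k (δ + t) := by
  have hG := h.continuousOn_G hν hc
  have hH0 : 0 ≤ H := (abs_nonneg _).trans (hH 0 ⟨le_rfl, hδ.le⟩)
  set lam := max b 0 with hlam
  have hlam0 : 0 ≤ lam := le_max_right _ _
  have ha : 0 < (1 + ‖w‖) * (H + 1) := by positivity
  have hδt : 0 ≤ δ + t := by linarith
  set f : ℝ → ℂ := fun τ => w * (RoughHawkesHeston.h b Λ ν δ K (δ - τ) : ℂ) with hf
  have hfc : ContinuousOn f (Icc 0 δ) := by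
    refine continuousOn_const.mul (Complex.continuous_ofReal.comp_continuousOn
      (hK.continuousOn_h.comp (by fun_prop) fun s hs => ?_))
    exact ⟨by linarith [hs.2], by linarith [hs.1]⟩
  set g : ℝ → ℂ := fun τ => if τ ≤ δ then f τ else G b c ν (φ (τ - δ)) with hg
  have hgb : ∀ r, BddMeasOn g (δ + r) := fun r =>
    BddMeasOn.ite (g := fun s => G b c ν (φ s)) hfc (hG.mono Icc_subset_Ici_self)
  have hshift : ∀ r, 0 ≤ r → conv k g (δ + r) = φ r := by
    intro r hr
    rw [(conv_add_time hδ.le hr (hk.integrableOn _) (hgb r)).2, h.eq_interval hδ.le hr, add_comm]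
    congr 1
    · refine intervalIntegral.integral_congr fun s hs => ?_
      rw [uIcc_of_le hδ.le] at hs
      simp only [hg, hf, if_pos (show δ - s ≤ δ by linarith [hs.1]), sub_sub_cancel]
    · refine conv_congr hr fun s hs => ?_
      simp only [hg, if_neg (show ¬ δ + s ≤ δ by linarith [hs.1]), add_sub_cancel_left]
  have hχ : ContinuousOn (conv k g) (Icc 0 (δ + t)) := by
    have c1 : ContinuousOn (conv k g) (Icc 0 δ) :=
      (continuousOn_conv (hk.integrableOn δ) hfc).congr fun s hs =>
        conv_congr hs.1 fun r hr => if_pos (hr.2.trans hs.2)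
    have c2 : ContinuousOn (conv k g) (Icc δ (δ + t)) := by
      refine (h.continuousOn.comp (f := fun s => s - δ) (s := Icc δ (δ + t)) (by fun_prop)
        fun s hs => sub_nonneg.2 hs.1).congr fun s hs => ?_
      have := hshift (s - δ) (sub_nonneg.2 hs.1)
      rwa [add_sub_cancel] at this
    have := c1.union_of_isClosed c2 isClosed_Icc isClosed_Icc
    rwa [Icc_union_Icc_eq_Icc hδ.le (by linarith)] at this
  -- `g` may jump at `δ`, but it is left continuous there, and the maximum principle asks for no
  -- more.
  have hgc : ∀ τ ∈ Ioc 0 (δ + t), ContinuousWithinAt g (Iic τ) τ := by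
    intro τ hτ
    rcases le_or_gt τ δ with hle | hgt
    · have h1 : ContinuousWithinAt f (Iic τ) τ :=
        (hfc τ ⟨hτ.1.le, hle⟩).mono_of_mem_nhdsWithin
          (mem_of_superset (Ioc_mem_nhdsLE hτ.1) fun s hs => ⟨hs.1.le, hs.2.trans hle⟩)
      exact h1.congr (fun s hs => if_pos (le_trans hs hle)) (if_pos hle)
    · have h1 : ContinuousAt (fun s => G b c ν (φ (s - δ))) τ :=
        ContinuousAt.comp (f := fun s => s - δ) (g := fun s => G b c ν (φ s))
          (hG.continuousAt (Ici_mem_nhds (sub_pos.2 hgt))) (by fun_prop)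
      refine (h1.congr ?_).continuousWithinAt
      filter_upwards [lt_mem_nhds hgt] with s hs
      exact (if_neg (not_le.2 hs)).symm
  -- Up to `δ` only `‖g‖` is controlled, so the quadratic term must have a nonnegative coefficient;
  -- hence `max b 0` in place of `b`.
  have hd : ∀ τ ∈ Ioc 0 (δ + t), (conj (conv k g τ) * g τ).re
      ≤ lam * ‖conv k g τ‖ ^ 2 + (1 + ‖w‖) * (H + 1) * ‖conv k g τ‖ := by
    intro τ hτ
    rcases le_or_gt τ δ with hle | hgt
    · have h1 : ‖g τ‖ ≤ (1 + ‖w‖) * (H + 1) := by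
        simp only [hg, if_pos hle, hf, norm_mul, Complex.norm_real, Real.norm_eq_abs]
        have := hH (δ - τ) ⟨by linarith, by linarith [hτ.1]⟩
        have h2 := mul_le_mul_of_nonneg_left this (norm_nonneg w)
        linarith [norm_nonneg w]
      have h3 := Complex.re_le_norm (conj (conv k g τ) * g τ)
      rw [norm_mul, Complex.norm_conj] at h3
      have h4 := mul_le_mul_of_nonneg_left h1 (norm_nonneg (conv k g τ))
      have h5 : 0 ≤ lam * ‖conv k g τ‖ ^ 2 := by positivity
      linarith
    · have h1 := hshift (τ - δ) (sub_pos.2 hgt).le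
      rw [add_sub_cancel] at h1
      have h2 : g τ = G b c ν (φ (τ - δ)) := if_neg (not_le.2 hgt)
      rw [h1, h2]
      have h3 := re_conj_mul_G_le (b := b) hν hc (h.re_nonpos (τ - δ) (sub_pos.2 hgt).le)
      have h4 : b * ‖φ (τ - δ)‖ ^ 2 ≤ lam * ‖φ (τ - δ)‖ ^ 2 :=
        mul_le_mul_of_nonneg_right (le_max_left _ _) (sq_nonneg _)
      have h5 : 0 ≤ (1 + ‖w‖) * (H + 1) * ‖φ (τ - δ)‖ := by positivity
      linarith
  have := hk.norm_le_of_nonneg hlam0 ha (hk.continuousOn_intResolvent lam (δ + t))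
    (fun s hs => hk.intResolvent_nonneg hlam0 hs.1)
    (fun s hs => hk.intResolvent_eq_conv lam hs.1) hχ (hgb t) hgc (fun _ _ => rfl) hd
    (δ + t) ⟨hδt, le_rfl⟩
  rwa [hshift t ht] at this

theorem norm_sub_le {φ' : ℝ → ℂ} (h : IsPhi b c Λ ν δ K K w φ)
    (h' : IsPhi b c Λ ν δ K k w φ') (hK : IsAdmissibleKernel K) (hk : IsMonotoneKernel k)
    (hν : IsJumpMeasure ν) (hc : 0 ≤ c) (hδ : 0 < δ) {T D C H : ℝ} (hT : 0 < T) (hD0 : 0 ≤ D)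
    (hH : ∀ s ∈ Icc 0 δ, |RoughHawkesHeston.h b Λ ν δ K s| ≤ H)
    (hD : ∀ t ∈ Icc 0 T, ‖φ t‖ ≤ D * (1 + ‖w‖ ^ 2))
    (hD' : ∀ t ∈ Icc 0 T, ‖φ' t‖ ≤ D * (1 + ‖w‖ ^ 2))
    (hC : stabilityConst (H + (|b| + (c + 2 * ∫ z, z ^ 2 ∂ν) * D) * D)
      (|b| + (c + 2 * ∫ z, z ^ 2 ∂ν) * D) (∫ s in (0 : ℝ)..T, K s) = C) :
    ∀ t ∈ Icc 0 T, ‖φ t - φ' t‖ ≤ C * (1 + ‖w‖ ^ 6)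
      * (∫ s in (0 : ℝ)..T, canonicalResolvent (C * (1 + ‖w‖ ^ 2)) K s)
      * ∫ s in (0 : ℝ)..(T + δ), |k s - K s| := by
  have hM := integral_sq_nonneg ν
  have hKm := hK.isMonotoneKernel
  have hH0 : 0 ≤ H := (abs_nonneg _).trans (hH 0 ⟨le_rfl, hδ.le⟩)
  set ℓ := |b| + (c + 2 * ∫ z, z ^ 2 ∂ν) * D with hℓ
  have hℓ0 : 0 ≤ ℓ := by positivity
  have hw : ‖w‖ ≤ 1 + ‖w‖ ^ 2 := by nlinarith [sq_nonneg (‖w‖ - 1)]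
  have hQ : 1 ≤ 1 + ‖w‖ ^ 2 := by nlinarith [sq_nonneg ‖w‖]
  have hlip : ∀ v v' : ℂ, v.re ≤ 0 → v'.re ≤ 0 → ‖v‖ ≤ D * (1 + ‖w‖ ^ 2) →
      ‖v'‖ ≤ D * (1 + ‖w‖ ^ 2) → ‖G b c ν v - G b c ν v'‖ ≤ ℓ * (1 + ‖w‖ ^ 2) * ‖v - v'‖ := by
    intro v v' hv hv' h1 h2
    refine (norm_G_sub_le hν hc hv hv').trans
      (mul_le_mul_of_nonneg_right ?_ (norm_nonneg _))
    have e1 := mul_le_mul_of_nonneg_left hQ (abs_nonneg b)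
    have e3 := mul_le_mul_of_nonneg_left (add_le_add h1 h2)
      (add_nonneg (div_nonneg hc zero_le_two) hM)
    rw [hℓ]
    linarith
  have hI : ∀ {x y : ℝ}, 0 ≤ x → 0 ≤ y →
      IntervalIntegrable (fun s => |k s - K s|) volume x y := fun hx hy =>
    ((hk.intervalIntegrable hx hy).sub (hKm.intervalIntegrable hx hy)).abs
  have hN0 : 0 ≤ ∫ s in (0 : ℝ)..(T + δ), |k s - K s| :=
    intervalIntegral.integral_nonneg (by linarith) fun s _ => abs_nonneg _
  have hforce : ∀ {q : ℝ → ℝ}, IsMonotoneKernel q → ∀ {t : ℝ}, 0 ≤ t → IntervalIntegrable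
      (fun s => q (t + s) • (w * (RoughHawkesHeston.h b Λ ν δ K s : ℂ))) volume 0 δ := by
    intro q hq t ht
    have := (hq.intervalIntegrable ht (show 0 ≤ t + δ by linarith)).comp_add_left t
    simp only [sub_self, add_sub_cancel_left] at this
    refine this.smul_continuousOn ?_
    rw [uIcc_of_le hδ.le]
    exact continuousOn_const.mul (Complex.continuous_ofReal.comp_continuousOn hKm.continuousOn_h)
  refine norm_sub_le_of_weights hK hk (A := ℓ * D) (P := H)
    hT hℓ0 (by positivity) hH0
    (h.continuousOn.mono Icc_subset_Ici_self) (h'.continuousOn.mono Icc_subset_Ici_self)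
    ((h.continuousOn_G hν hc).mono Icc_subset_Ici_self)
    ((h'.continuousOn_G hν hc).mono Icc_subset_Ici_self)
    (fun t ht => h.eq_interval hδ.le ht.1) (fun t ht => h'.eq_interval hδ.le ht.1)
    (intervalIntegral.integral_mono_interval le_rfl hT.le (by linarith)
      (ae_of_all _ fun s => abs_nonneg _) (hI le_rfl (by linarith)))
    (fun t ht => ?_) (fun t ht => ?_)
    (fun t ht => hlip _ _ (h.re_nonpos t ht.1) (h'.re_nonpos t ht.1) (hD t ht) (hD' t ht)) ?_
  · rw [← intervalIntegral.integral_sub (hforce hKm ht.1) (hforce hk ht.1)]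
    have hs := (hI ht.1 (show 0 ≤ t + δ by linarith [ht.1])).comp_add_left t
    simp only [sub_self, add_sub_cancel_left] at hs
    have e1 : ‖∫ s in (0 : ℝ)..δ, (K (t + s) • (w * (RoughHawkesHeston.h b Λ ν δ K s : ℂ))
        - k (t + s) • (w * (RoughHawkesHeston.h b Λ ν δ K s : ℂ)))‖
        ≤ ∫ s in (0 : ℝ)..δ, |k (t + s) - K (t + s)| * (‖w‖ * H) := by
      refine intervalIntegral.norm_integral_le_of_norm_le hδ.le
        (ae_of_all _ fun s hs => ?_) (hs.mul_const _)
      rw [← sub_smul, norm_smul, norm_mul, Complex.norm_real, Real.norm_eq_abs, Real.norm_eq_abs,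
        abs_sub_comm]
      exact mul_le_mul_of_nonneg_left (mul_le_mul_of_nonneg_left (hH s ⟨hs.1.le, hs.2⟩)
        (norm_nonneg w)) (abs_nonneg _)
    -- The forcing reads the kernels on `[t, t + δ]`, so their distance is needed up to `T + δ`.
    have e2 : ∫ s in (0 : ℝ)..δ, |k (t + s) - K (t + s)|
        ≤ ∫ s in (0 : ℝ)..(T + δ), |k s - K s| := by
      rw [intervalIntegral.integral_comp_add_left (fun s => |k s - K s|) t, add_zero]
      exact intervalIntegral.integral_mono_interval ht.1 (by linarith) (by linarith [ht.2])
        (ae_of_all _ fun s => abs_nonneg _) (hI le_rfl (by linarith))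
    rw [intervalIntegral.integral_mul_const] at e1
    have e3 := mul_le_mul_of_nonneg_right e2 (mul_nonneg (norm_nonneg w) hH0)
    have e4 : ‖w‖ ≤ (1 + ‖w‖ ^ 2) ^ 2 := by nlinarith
    have e5 := mul_le_mul_of_nonneg_right e4 (mul_nonneg hH0 hN0)
    linarith
  · have e1 := hlip _ 0 (h'.re_nonpos t ht.1) (by simp) (hD' t ht)
      (by simpa using mul_nonneg hD0 (by positivity))
    rw [G_zero, sub_zero, sub_zero] at e1
    have e2 := mul_le_mul_of_nonneg_left (hD' t ht) (mul_nonneg hℓ0 (zero_le_one.trans hQ))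
    linarith
  · rw [← hC, stabilityConst, abs_of_nonneg (hK.integral_pos hT).le]

end IsPhi

theorem intResolvent_le_integral_abs (lam : ℝ) (k : ℝ → ℝ) {t : ℝ} (ht : 0 ≤ t) :
    intResolvent lam k t ≤ ∫ s in (0 : ℝ)..t, |canonicalResolvent lam k s| :=
  (le_abs_self _).trans (intervalIntegral.abs_integral_le_integral_abs ht)

end RoughHawkesHeston

/-! ### Choice of the constants. -/

open RoughHawkesHeston in
theorem theorem5p1 (b c Λ : ℝ) (hc : 0 < c) (hΛ : 0 ≤ Λ) (ν : MeasureTheory.Measure ℝ)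
    (hν : IsJumpMeasure ν) :
    -- (i), for the equation of the log returns
    (∀ (ρ : ℝ), -1 ≤ ρ → ρ ≤ 1 →
      ∀ (K : ℝ → ℝ), IsAdmissibleKernel K → ∀ (T : ℝ), 0 < T →
      ∀ (m x : (n : ℕ) → Fin n → ℝ), (∀ n j, 0 < m n j) → (∀ n j, 0 < x n j) →
      (∃ C' : ℝ, 0 < C' ∧ ∀ n : ℕ, 1 ≤ n →
        ∫ s in (0 : ℝ)..T,
          |canonicalResolvent (b + max ρ 0 * Real.sqrt c) (expKernel (m n) (x n)) s| ≤ C') →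
      ∃ C : ℝ, 0 < C ∧ ∀ w : ℂ, 0 ≤ w.re → w.re ≤ 1 → ∀ n : ℕ, 1 ≤ n →
        ∀ ψ ψn : ℝ → ℂ, IsPsi ρ b c Λ ν K w ψ →
          IsPsi ρ b c Λ ν (expKernel (m n) (x n)) w ψn →
          ∀ t : ℝ, 0 ≤ t → t ≤ T →
            ‖ψ t - ψn t‖ ≤ C * (1 + |w.im| ^ 6)
              * (∫ s in (0 : ℝ)..T, canonicalResolvent (C * (1 + |w.im| ^ 2)) K s)
              * ∫ s in (0 : ℝ)..T, |expKernel (m n) (x n) s - K s|) ∧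
    -- the addition to (i): for `b < 0` and `ρ < 0` the constant depends on `ρ, b, c, Λ, ν` and on
    -- the norm of `K` in `L¹([0, T])` only
    (b < 0 → ∀ (ρ : ℝ), -1 ≤ ρ → ρ < 0 →
      ∃ C : ℝ → ℝ, (∀ κ, 0 < C κ) ∧
      ∀ (K : ℝ → ℝ), IsAdmissibleKernel K → ∀ (T : ℝ), 0 < T →
      ∀ (m x : (n : ℕ) → Fin n → ℝ), (∀ n j, 0 < m n j) → (∀ n j, 0 < x n j) →
      ∀ w : ℂ, 0 ≤ w.re → w.re ≤ 1 → ∀ n : ℕ, 1 ≤ n →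
        ∀ ψ ψn : ℝ → ℂ, IsPsi ρ b c Λ ν K w ψ →
          IsPsi ρ b c Λ ν (expKernel (m n) (x n)) w ψn →
          ∀ t : ℝ, 0 ≤ t → t ≤ T →
            ‖ψ t - ψn t‖ ≤ C (∫ s in (0 : ℝ)..T, |K s|) * (1 + |w.im| ^ 6)
              * (∫ s in (0 : ℝ)..T,
                  canonicalResolvent (C (∫ r in (0 : ℝ)..T, |K r|) * (1 + |w.im| ^ 2)) K s)
              * ∫ s in (0 : ℝ)..T, |expKernel (m n) (x n) s - K s|) ∧
    -- (ii), for the equation of the squared volatility index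
    (∀ (K : ℝ → ℝ), IsAdmissibleKernel K → ∀ (T δ : ℝ), 0 < T → 0 < δ →
      ∀ (m x : (n : ℕ) → Fin n → ℝ), (∀ n j, 0 < m n j) → (∀ n j, 0 < x n j) →
      (∃ C' : ℝ, 0 < C' ∧ ∀ n : ℕ, 1 ≤ n →
        ∫ s in (0 : ℝ)..(max T δ),
          |canonicalResolvent (max b 0) (expKernel (m n) (x n)) s| ≤ C') →
      ∃ C : ℝ, 0 < C ∧ ∀ w : ℂ, w.re ≤ 0 → ∀ n : ℕ, 1 ≤ n →
        ∀ φ φn : ℝ → ℂ, IsPhi b c Λ ν δ K K w φ →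
          IsPhi b c Λ ν δ K (expKernel (m n) (x n)) w φn →
          ∀ t : ℝ, 0 ≤ t → t ≤ T →
            ‖φ t - φn t‖ ≤ C * (1 + ‖w‖ ^ 6)
              * (∫ s in (0 : ℝ)..T, canonicalResolvent (C * (1 + ‖w‖ ^ 2)) K s)
              * ∫ s in (0 : ℝ)..(T + δ), |expKernel (m n) (x n) s - K s|) := by
  refine ⟨fun ρ _ _ K hK T hT m x hm hx ⟨C', hC', hE⟩ => ?_, fun hb ρ _ hρ => ?_,
    fun K hK T δ hT hδ m x hm hx ⟨C', hC', hE⟩ => ?_⟩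
  · have hKm := hK.isMonotoneKernel
    have ha := zeroConst_pos Λ ν
    obtain ⟨lam, hlam⟩ : ∃ lam, b + max ρ 0 * Real.sqrt c = lam := ⟨_, rfl⟩
    rw [hlam] at hE
    -- One radius `D` serves `K` and all approximations: for `lam < 0` it is independent of the
    -- kernel, otherwise the integrated resolvents are bounded by that of `K` or by `C'`.
    obtain ⟨D, hD0, hD⟩ : ∃ D : ℝ, 0 ≤ D ∧ ∀ k : ℝ → ℝ, IsMonotoneKernel k →
        (k = K ∨ intResolvent lam k T ≤ C') → ∀ w : ℂ, 0 ≤ w.re → w.re ≤ 1 → ∀ ψ,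
        IsPsi ρ b c Λ ν k w ψ → ∀ t ∈ Icc 0 T, ‖ψ t‖ ≤ D * (1 + |w.im| ^ 2) := by
      rcases lt_or_ge lam 0 with hl | hl
      · refine ⟨zeroConst Λ ν / -lam, (div_pos ha (neg_pos.2 hl)).le,
          fun k hk _ w h0 h1 ψ hψ t ht => ?_⟩
        exact ((hψ.norm_le hk hν hc.le hΛ h0 h1 hlam T).1 hl t ht).trans_eq (by ring)
      · refine ⟨zeroConst Λ ν * max (intResolvent lam K T) C',
          mul_nonneg ha.le (hC'.le.trans (le_max_right _ _)),
          fun k hk hkC w h0 h1 ψ hψ t ht => ?_⟩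
        refine ((hψ.norm_le hk hν hc.le hΛ h0 h1 hlam T).2 hl t ht).trans ?_
        have h2 : intResolvent lam k t ≤ max (intResolvent lam K T) C' := by
          refine (hk.intResolvent_mono hl ht.1 ht.2).trans ?_
          rcases hkC with rfl | h
          · exact le_max_left _ _
          · exact h.trans (le_max_right _ _)
        have h3 : 0 ≤ zeroConst Λ ν * (1 + |w.im| ^ 2) := mul_nonneg ha.le (by positivity)
        exact (mul_le_mul_of_nonneg_left h2 h3).trans_eq (by ring)
    have hl := lipConst_nonneg (ρ := ρ) (b := b) (ν := ν) hc.le hΛ hD0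
    refine ⟨_, stabilityConst_pos (add_nonneg ha.le (mul_nonneg hl hD0)) hl
      (∫ s in (0 : ℝ)..T, K s), fun w h0 h1 n hn ψ ψn hψ hψn t ht htT => ?_⟩
    have hk := expKernel_isMonotoneKernel hn (hm n) (hx n)
    exact hψ.norm_sub_le hψn hK hk hν hc.le hΛ h0 h1 hT hD0
      (hD K hKm (Or.inl rfl) w h0 h1 ψ hψ)
      (hD _ hk (Or.inr ((intResolvent_le_integral_abs lam _ hT.le).trans (hE n hn))) w h0 h1 ψn hψn)
      rfl t ⟨ht, htT⟩
  · have ha := zeroConst_pos Λ ν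
    have hlam : b + max ρ 0 * Real.sqrt c = b := by rw [max_eq_right hρ.le]; ring
    have hD0 : 0 ≤ zeroConst Λ ν / -b := (div_pos ha (neg_pos.2 hb)).le
    have hl := lipConst_nonneg (ρ := ρ) (b := b) (ν := ν) hc.le hΛ hD0
    -- As `ρ < 0`, the rate is `b < 0`, so neither the radius nor the Lipschitz constant involves a
    -- kernel. The mass of `K` remains the only variable of the witness.
    refine ⟨_, stabilityConst_pos (add_nonneg ha.le (mul_nonneg hl hD0)) hl,
      fun K hK T hT m x hm hx w h0 h1 n hn ψ ψn hψ hψn t ht htT => ?_⟩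
    have hk := expKernel_isMonotoneKernel hn (hm n) (hx n)
    have habs : ∫ s in (0 : ℝ)..T, |K s| = ∫ s in (0 : ℝ)..T, K s :=
      intervalIntegral.integral_congr_ae (ae_of_all _ fun s hs => by
        rw [uIoc_of_le hT.le] at hs
        exact abs_of_nonneg (hK.nonneg s hs.1))
    rw [habs]
    exact hψ.norm_sub_le hψn hK hk hν hc.le hΛ h0 h1 hT hD0
      (fun t ht => ((hψ.norm_le hK.isMonotoneKernel hν hc.le hΛ h0 h1 hlam T).1 hb t ht).trans_eq
        (by ring))
      (fun t ht => ((hψn.norm_le hk hν hc.le hΛ h0 h1 hlam T).1 hb t ht).trans_eq (by ring))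
      rfl t ⟨ht, htT⟩
  · have hKm := hK.isMonotoneKernel
    have hM := integral_sq_nonneg ν
    obtain ⟨lam, hlam⟩ : ∃ lam, max b 0 = lam := ⟨_, rfl⟩
    have hl : 0 ≤ lam := hlam ▸ le_max_right b 0
    rw [hlam] at hE
    have hS : 0 ≤ max T δ := hT.le.trans (le_max_left _ _)
    set S := max T δ with hSdef
    obtain ⟨H, hH⟩ := isCompact_Icc.exists_bound_of_continuousOn
      (hKm.continuousOn_h (b := b) (Λ := Λ) (ν := ν) (δ := δ))
    have hH0 : 0 ≤ H := (norm_nonneg _).trans (hH 0 ⟨le_rfl, hδ.le⟩)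
    set B := max (intResolvent lam K S) C' with hB
    have hB0 : 0 ≤ B := hC'.le.trans (le_max_right _ _)
    -- The last factor bounds the integrated resolvent at `δ + t` by subadditivity; the `2` comes
    -- from `1 + ‖w‖ ≤ 2 (1 + ‖w‖²)`.
    have hD0 : 0 ≤ 2 * (H + 1) * (B + (1 + lam * B) * B) := by positivity
    have hD : ∀ k : ℝ → ℝ, IsMonotoneKernel k → intResolvent lam k S ≤ B → ∀ w φ,
        IsPhi b c Λ ν δ K k w φ → ∀ t ∈ Icc 0 T,
          ‖φ t‖ ≤ 2 * (H + 1) * (B + (1 + lam * B) * B) * (1 + ‖w‖ ^ 2) := by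
      intro k hk hkB w φ hφ t ht
      have e1 := hφ.norm_le hKm hk hν hc.le hδ hH ht.1
      rw [hlam] at e1
      have e2 : intResolvent lam k δ ≤ B :=
        (hk.intResolvent_mono hl hδ.le (le_max_right _ _)).trans hkB
      have e3 : intResolvent lam k t ≤ B :=
        (hk.intResolvent_mono hl ht.1 (ht.2.trans (le_max_left _ _))).trans hkB
      have e4 : intResolvent lam k (δ + t) ≤ B + (1 + lam * B) * B := by
        refine (hk.intResolvent_add_le hl hδ.le ht.1).trans (add_le_add e2 ?_)
        exact mul_le_mul (by nlinarith) e3 (hk.intResolvent_nonneg hl ht.1) (by positivity)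
      have e5 : 1 + ‖w‖ ≤ 2 * (1 + ‖w‖ ^ 2) := by nlinarith [sq_nonneg (‖w‖ - 1)]
      have e6 := hk.intResolvent_nonneg hl (add_nonneg hδ.le ht.1)
      calc ‖φ t‖ ≤ (1 + ‖w‖) * (H + 1) * intResolvent lam k (δ + t) := e1
        _ ≤ (2 * (1 + ‖w‖ ^ 2)) * (H + 1) * (B + (1 + lam * B) * B) := by gcongr
        _ = _ := by ring
    set D := 2 * (H + 1) * (B + (1 + lam * B) * B)
    refine ⟨_, stabilityConst_pos (A := H + (|b| + (c + 2 * ∫ z, z ^ 2 ∂ν) * D) * D)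
      (ℓ := |b| + (c + 2 * ∫ z, z ^ 2 ∂ν) * D) (by positivity) (by positivity)
      (∫ s in (0 : ℝ)..T, K s), fun w _ n hn φ φn hφ hφn t ht htT => ?_⟩
    have hk := expKernel_isMonotoneKernel hn (hm n) (hx n)
    exact hφ.norm_sub_le hφn hK hk hν hc.le hδ hT hD0 hH
      (hD K hKm (le_max_left _ _) w φ hφ)
      (hD _ hk (((intResolvent_le_integral_abs lam _ hS).trans (hE n hn)).trans
        (le_max_right _ _)) w φn hφn)
      rfl t ⟨ht, htT⟩
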